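/- Let $n\ge 1$, let $V=\mathbb R^n$, and let $\mathcal S_n$ act on $\mathbb{RP}^{n-1}=\mathbb P(V)$ by permuting coordinates. *The $\mathcal L$-stratification.* For $\ell\in\mathbb{RP}^{n-1}$ and a subgroup $H\le\operatorname{stab}\ell$, let $L(\ell,H)\subseteq T_\ell\mathbb{RP}^{n-1}$ be the span of all lines in the tangent space that are invariant under $H$, let $F(\ell,H)$ be the group of those $h\in H$ that fix $L(\ell,H)$ pointwise, and let $\mathcal L(\ell,H)$ be the connected component containing $\ell$ of the fixed point set of $F(\ell,H)$ on $\mathbb{RP}^{n-1}$. Put $\mathcal L=\{\mathcal L(\ell,H)\}_{\ell,\;H\le\operatorname{stab}\ell}$. The strata of the stratification given by a family of subsets of a space $X$ are all non-empty intersections of members of the family (the empty intersection being $X$). *The braid arrangement.* $\mathcal A_{n-1}=\{H_{ij}\mid i\ne j\}$ with $H_{ij}=\{x\in V\mid x_j=x_i\}$; its intersection lattice $\mathcal L(\mathcal A_{n-1})$ consists of all intersections of members, and the rank of an element $U$ is its codimension. The rank 2 truncation of the projectivized braid arrangement is $\mathbb P\mathcal A_{n-1}^{\mathrm{rk}\ge2}=\{\mathbb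 P U\mid U\in\mathcal L(\mathcal A_{n-1}),\ \operatorname{codim}U\ge2\}$. The maximal projective De Concini–Procesi model $\overline Y$ of $\mathcal A_{n-1}$ is the closure of $$\Big\{\big(\ell,(\langle\ell,U\rangle/U)_U\big)\ \Big|\ \ell\in\mathbb P(V)\setminus\textstyle\bigcup_{i\neq j}\mathbb P H_{ij}\Big\}\quad\text{in}\quad \mathbb P(V)\times\prod_{U\in\mathcal L(\mathcal A_{n-1}),\,U\ne V}\mathbb P(V/U).$$ *The digitalization.* $p:Y_{\mathbb{RP}^{n-1},\mathcal L}\to\mathbb{RP}^{n-1}$ is the maximal wonderful model: the smooth manifold obtained from $\mathbb{RP}^{n-1}$ by successively blowing up all strata $\neq\mathbb{RP}^{n-1}$ of the $\mathcal L$-stratification, respectively their proper transforms, in a linear order in which each stratum comes after all strata strictly contained in it (for instance an order non-decreasing in dimension). **Theorem.** (1) The $\mathcal L$-stratification of $\mathbb{RP}^{n-1}$ coincides with the stratification given by $\mathbb P\mathcal A_{n-1}^{\mathrm{rk}\ge2}$: the two have the same strata. (2) The digitalization $Y_{\mathbb{RP}^{n-1},\mathcal L}$ coincides with the maximal projective De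 Concini–Procesi model of $\mathcal A_{n-1}$: the successive blowup exists, and for every such order of the strata and every resulting manifold $p:Y\to\mathbb{RP}^{n-1}$ there is a smooth closed embedding of $Y$ into $\mathbb P(V)\times\prod_U\mathbb P(V/U)$ whose first component is $p$ and whose image is $\overline Y$. The action of $\mathcal S_n$ on $\mathbb{RP}^{n-1}$ lifts along $p$ to a smooth action on $Y$, and the embedding is equivariant for this action and the action $\sigma(\ell,(w_U)_U)=(\sigma\ell,(\sigma(w_{\sigma^{-1}U}))_U)$ on the product. -/

import Mathlib

open Set
open scoped Manifold ContDiff Topology LinearAlgebra.Projectivization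

/-! ### Stratifications by families of subsets -/

/-- The strata of the stratification of `X` given by a family `𝒜` of subsets: all non-empty
intersections of members of `𝒜`. The empty intersection is `X` itself. -/
def strataOf {X : Type*} (𝒜 : Set (Set X)) : Set (Set X) :=
  {S | S.Nonempty ∧ ∃ ℬ ⊆ 𝒜, S = ⋂₀ ℬ}

/-! ### The `ℒ`-stratification of a manifold with a differentiable action of a finite group -/

/-- The action of `g` on the tangent space at `x`. It is used only for `g` in the stabilizer
of `x`, where source and target of the differential are the same tangent space. -/
noncomputable def tangentAct {d : ℕ} {X : Type*} [TopologicalSpace X]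
    [ChartedSpace (EuclideanSpace ℝ (Fin d)) X] {G : Type*} [Group G] [MulAction G X]
    (x : X) (g : G) :
    TangentSpace (𝓡 d) x →ₗ[ℝ] TangentSpace (𝓡 d) x where
  toFun v := mfderiv (𝓡 d) (𝓡 d) (fun y : X => g • y) x v
  map_add' v w := map_add (mfderiv (𝓡 d) (𝓡 d) (fun y : X => g • y) x) v w
  map_smul' c v := map_smul (mfderiv (𝓡 d) (𝓡 d) (fun y : X => g • y) x) c v

/-- `L(x, H)`: the span of all lines in the tangent space at `x` that are invariant under `H`. -/
noncomputable def tangentL (d : ℕ) {X : Type*} [TopologicalSpace X]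
    [ChartedSpace (EuclideanSpace ℝ (Fin d)) X] {G : Type*} [Group G] [MulAction G X]
    (x : X) (H : Subgroup G) : Submodule ℝ (TangentSpace (𝓡 d) x) :=
  sSup {l : Submodule ℝ (TangentSpace (𝓡 d) x) |
    Module.finrank ℝ l = 1 ∧ ∀ h ∈ H, l.map (tangentAct x h) = l}

/-- `F(x, H)`: the elements of `H` that fix `L(x, H)` pointwise. -/
def kernelF (d : ℕ) {X : Type*} [TopologicalSpace X]
    [ChartedSpace (EuclideanSpace ℝ (Fin d)) X] {G : Type*} [Group G] [MulAction G X]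
    (x : X) (H : Subgroup G) : Set G :=
  {h | h ∈ H ∧ ∀ v ∈ tangentL d x H, tangentAct x h v = v}

/-- `ℒ(x, H)`: the connected component containing `x` of the fixed point set of `F(x, H)`. -/
def stratumL (d : ℕ) {X : Type*} [TopologicalSpace X]
    [ChartedSpace (EuclideanSpace ℝ (Fin d)) X] {G : Type*} [Group G] [MulAction G X]
    (x : X) (H : Subgroup G) : Set X :=
  connectedComponentIn {y : X | ∀ g ∈ kernelF d x H, g • y = y} x

/-- The family `ℒ = {ℒ(x, H)}` over all points `x` and all subgroups `H` of the stabilizer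
of `x`. -/
def familyL (d : ℕ) (G X : Type*) [TopologicalSpace X]
    [ChartedSpace (EuclideanSpace ℝ (Fin d)) X] [Group G] [MulAction G X] : Set (Set X) :=
  {S | ∃ (x : X) (H : Subgroup G), H ≤ MulAction.stabilizer G x ∧ S = stratumL d x H}

/-! ### Successive blowups of smooth manifolds -/

/-- A Hausdorff smooth manifold of dimension `d`, without boundary. -/
structure SmoothMfd (d : ℕ) where
  carrier : Type
  [top : TopologicalSpace carrier]
  [charted : ChartedSpace (EuclideanSpace ℝ (Fin d)) carrier]
  [smooth : IsManifold (𝓡 d) ∞ carrier]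
  [t2 : T2Space carrier]

instance (d : ℕ) : CoeSort (SmoothMfd d) Type := ⟨SmoothMfd.carrier⟩

attribute [instance] SmoothMfd.top SmoothMfd.charted SmoothMfd.smooth SmoothMfd.t2

/-- The `j`-th standard chart of the blowup of `ℝ^d` along the coordinate subspace
`{x | x i = 0 for i ∈ A}`: the points of the blowup are pairs `(x, [l])` with `(x i)_{i ∈ A}` on the
line `[l]`; where `l j ≠ 0` the coordinates are `x j`, the `l i / l j` for `i ∈ A`, `i ≠ j`, and the
`x i` for `i ∉ A`. The map below is the blowdown map in these coordinates. -/
noncomputable def blowdownChart {d : ℕ} (A : Finset (Fin d)) (j : Fin d)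
    (y : EuclideanSpace ℝ (Fin d)) : EuclideanSpace ℝ (Fin d) :=
  WithLp.toLp 2 fun i => if i ∈ A ∧ i ≠ j then y j * y i else y i

/-- `p : Y → X` is the (real) blowup of `X` along the closed submanifold `Z`: it is a
diffeomorphism over the complement of `Z`, and near every point of `Z` there is a chart `φ` of `X`
in which `Z` is the coordinate subspace `{x | x i = 0 for i ∈ A}` and over which `Y` is covered
by the standard charts `ψ j`, `j ∈ A`, of the blowup of that coordinate subspace. -/
structure IsBlowup {d : ℕ} (X Y : SmoothMfd d) (Z : Set X) (p : Y → X) : Prop where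
  isClosed_center : IsClosed Z
  smooth : ContMDiff (𝓡 d) (𝓡 d) ∞ p
  bijOn : BijOn p (p ⁻¹' Zᶜ) Zᶜ
  localDiffeo : ∀ y : Y, p y ∉ Z → IsLocalDiffeomorphAt (𝓡 d) (𝓡 d) ∞ p y
  localModel : ∀ z ∈ Z, ∃ φ ∈ IsManifold.maximalAtlas (𝓡 d) ∞ X, z ∈ φ.source ∧
    ∃ A : Finset (Fin d), A.Nonempty ∧
      (∀ x ∈ φ.source, x ∈ Z ↔ ∀ i ∈ A, φ x i = 0) ∧
      ∃ ψ : Fin d → OpenPartialHomeomorph Y (EuclideanSpace ℝ (Fin d)),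
        (∀ j ∈ A, ψ j ∈ IsManifold.maximalAtlas (𝓡 d) ∞ Y ∧
          (ψ j).target = blowdownChart A j ⁻¹' φ.target ∧
          ∀ y ∈ (ψ j).source, p y ∈ φ.source ∧ φ (p y) = blowdownChart A j (ψ j y)) ∧
        p ⁻¹' φ.source ⊆ ⋃ j ∈ A, (ψ j).source

/-- The proper transform of `S ⊆ X` under a map `q : Y → X` that is the composition of blowups
whose centers come from the subsets of `X` listed in `L`. -/
def properTransform {X Y : Type*} [TopologicalSpace Y] (q : Y → X) (L : List (Set X))
    (S : Set X) : Set Y :=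
  closure (q ⁻¹' (S \ ⋃ T ∈ L, T))

/-- `IsSuccessiveBlowup X L Y q`: `Y`, with the composition `q : Y → X` of the blowdown maps, results
from `X` by blowing up the subsets listed in `L`, respectively their proper transforms, one
after the other in the order of the list. -/
inductive IsSuccessiveBlowup {d : ℕ} (X : SmoothMfd d) :
    List (Set X) → (Y : SmoothMfd d) → (Y → X) → Prop
  | nil : IsSuccessiveBlowup X [] X id
  | snoc {L : List (Set X)} {Y Y' : SmoothMfd d} {q : Y → X} {r : Y' → Y} (S : Set X) :
      IsSuccessiveBlowup X L Y q → IsBlowup Y Y' (properTransform q L S) r →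
      IsSuccessiveBlowup X (L ++ [S]) Y' (q ∘ r)

/-- `p : Y → X` is the maximal wonderful model `Y_{X, 𝒜}` of the (finite) local subspace
arrangement `𝒜` in `X`: the result of blowing up all strata other than `X`, each one after all the
strata strictly contained in it. Every order that is non-decreasing in dimension is of this
kind. -/
def IsMaximalWonderfulModel {d : ℕ} (X : SmoothMfd d) (𝒜 : Set (Set X)) (Y : SmoothMfd d)
    (p : Y → X) : Prop :=
  ∃ L : List (Set X), L.Nodup ∧ (∀ S, S ∈ L ↔ S ∈ strataOf 𝒜 ∧ S ≠ univ) ∧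
    L.Pairwise (fun S T => ¬ T ⊂ S) ∧ IsSuccessiveBlowup X L Y p

/-! ### Real projective space as a smooth manifold -/

/-- The quotient topology on a projective space. -/
noncomputable instance projTopology (V : Type*) [AddCommGroup V] [Module ℝ V] [TopologicalSpace V] :
    TopologicalSpace (ℙ ℝ V) :=
  TopologicalSpace.coinduced (Projectivization.mk' ℝ (V := V)) inferInstance

/-- `ℝℙ^m`, the space of lines in `ℝ^(m+1)`. -/
noncomputable abbrev RP (m : ℕ) : Type := ℙ ℝ (Fin (m + 1) → ℝ)

namespace RP

variable {m : ℕ}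

lemma isQuotientMap_mk' :
    Topology.IsQuotientMap (Projectivization.mk' ℝ (V := Fin (m + 1) → ℝ)) :=
  ⟨⟨rfl⟩, Quotient.mk''_surjective⟩

lemma continuous_coord (i : Fin (m + 1)) :
    Continuous (fun v : {v : Fin (m + 1) → ℝ // v ≠ 0} => v.1 i) :=
  (continuous_apply i).comp continuous_subtype_val

/-- The affine coordinates `(x k / x i)_{k ≠ i}` of `[x]`. -/
noncomputable def affine (i : Fin (m + 1)) (l : RP m) : EuclideanSpace ℝ (Fin m) :=
  Projectivization.lift (fun v : {v : Fin (m + 1) → ℝ // v ≠ 0} => WithLp.toLp 2 fun k => v.1 (i.succAbove k) / v.1 i)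
    (by
      rintro ⟨a, ha⟩ ⟨b, hb⟩ t h
      dsimp only at h ⊢
      subst h
      have ht : t ≠ 0 := fun h0 => ha (by simp [h0])
      ext k
      simp [mul_div_mul_left _ _ ht]) l

/-- The set of points `[x]` with `x i ≠ 0`. -/
def affineOpen (i : Fin (m + 1)) : Set (RP m) :=
  {l | Projectivization.lift (fun v : {v : Fin (m + 1) → ℝ // v ≠ 0} => v.1 i ≠ 0)
    (by
      rintro ⟨a, ha⟩ ⟨b, hb⟩ t h
      dsimp only at h ⊢
      subst h
      have ht : t ≠ 0 := fun h0 => ha (by simp [h0])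
      simp [ht]) l}

lemma mk_mem_affineOpen (i : Fin (m + 1)) (v : Fin (m + 1) → ℝ) (hv : v ≠ 0) :
    Projectivization.mk ℝ v hv ∈ affineOpen i ↔ v i ≠ 0 := Iff.rfl

lemma affine_mk (i : Fin (m + 1)) (v : Fin (m + 1) → ℝ) (hv : v ≠ 0) :
    affine i (Projectivization.mk ℝ v hv) = WithLp.toLp 2 fun k => v (i.succAbove k) / v i := rfl

lemma insertNth_ne_zero (i : Fin (m + 1)) (y : Fin m → ℝ) :
    (i.insertNth (1 : ℝ) y : Fin (m + 1) → ℝ) ≠ 0 := fun h => by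
  have := congrFun h i
  simp at this

/-- The point with affine coordinates `y`. -/
noncomputable def ofAffine (i : Fin (m + 1)) (y : EuclideanSpace ℝ (Fin m)) : RP m :=
  Projectivization.mk ℝ (i.insertNth (1 : ℝ) (fun k => y k)) (insertNth_ne_zero i _)

lemma isOpen_affineOpen (i : Fin (m + 1)) : IsOpen (affineOpen (m := m) i) := by
  rw [← isQuotientMap_mk'.isOpen_preimage]
  change IsOpen {v : {v : Fin (m + 1) → ℝ // v ≠ 0} | v.1 i ≠ 0}
  exact isOpen_ne_fun (continuous_coord i) continuous_const

/-- The affine chart of `ℝℙ^m` on the points `[x]` with `x i ≠ 0`. -/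
noncomputable def affineChart (i : Fin (m + 1)) :
    OpenPartialHomeomorph (RP m) (EuclideanSpace ℝ (Fin m)) where
  toFun := affine i
  invFun := ofAffine i
  source := affineOpen i
  target := univ
  map_source' _ _ := mem_univ _
  map_target' y _ := by
    simp [ofAffine, mk_mem_affineOpen]
  left_inv' l hl := by
    induction l using Projectivization.ind with
    | h v hv =>
      rw [mk_mem_affineOpen] at hl
      rw [affine_mk, ofAffine, Projectivization.mk_eq_mk_iff']
      refine ⟨(v i)⁻¹, ?_⟩
      ext k
      refine Fin.succAboveCases i ?_ (fun j => ?_) k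
      · simp [hl]
      · simp [div_eq_inv_mul]
  right_inv' y _ := by
    ext k
    simp [ofAffine, affine_mk]
  open_source := isOpen_affineOpen i
  open_target := isOpen_univ
  continuousOn_toFun := by
    rw [isQuotientMap_mk'.continuousOn_isOpen_iff (isOpen_affineOpen i)]
    change ContinuousOn (fun v : {v : Fin (m + 1) → ℝ // v ≠ 0} =>
      WithLp.toLp 2 fun k => v.1 (i.succAbove k) / v.1 i) {v | v.1 i ≠ 0}
    refine (PiLp.continuous_toLp 2 _).comp_continuousOn (continuousOn_pi.2 fun k => ?_)
    exact ContinuousOn.div (continuous_coord _).continuousOn (continuous_coord i).continuousOn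
      (fun v hv => hv)
  continuousOn_invFun := by
    refine Continuous.continuousOn ?_
    refine isQuotientMap_mk'.continuous.comp (f := fun y : EuclideanSpace ℝ (Fin m) =>
      (⟨i.insertNth (1 : ℝ) (fun k => y k), insertNth_ne_zero i _⟩ :
        {v : Fin (m + 1) → ℝ // v ≠ 0})) ?_
    refine Continuous.subtype_mk (continuous_pi fun k => ?_) _
    refine Fin.succAboveCases i ?_ (fun j => ?_) k
    · simpa using continuous_const
    · simp only [Fin.insertNth_apply_succAbove]
      fun_prop

lemma exists_mem_affineOpen (l : RP m) : ∃ i, l ∈ affineOpen i := by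
  induction l using Projectivization.ind with
  | h v hv => exact Function.ne_iff.1 hv

noncomputable instance : ChartedSpace (EuclideanSpace ℝ (Fin m)) (RP m) where
  atlas := range affineChart
  chartAt l := affineChart (exists_mem_affineOpen l).choose
  mem_chart_source l := (exists_mem_affineOpen l).choose_spec
  chart_mem_atlas _ := mem_range_self _

instance : IsManifold (𝓡 m) ∞ (RP m) := by
  refine isManifold_of_contDiffOn _ _ _ ?_
  rintro _ _ ⟨i, rfl⟩ ⟨j, rfl⟩
  have key : ContDiffOn ℝ ∞ (fun y : EuclideanSpace ℝ (Fin m) => (WithLp.toLp 2 fun k =>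
      (i.insertNth (1 : ℝ) (fun k => y k) : Fin (m + 1) → ℝ) (j.succAbove k) /
        (i.insertNth (1 : ℝ) (fun k => y k) : Fin (m + 1) → ℝ) j : EuclideanSpace ℝ (Fin m)))
      {y | (i.insertNth (1 : ℝ) (fun k => y k) : Fin (m + 1) → ℝ) j ≠ 0} := by
    have h : ∀ k, ContDiff ℝ ∞ (fun y : EuclideanSpace ℝ (Fin m) =>
        (i.insertNth (1 : ℝ) (fun k => y k) : Fin (m + 1) → ℝ) k) := by
      intro k
      refine Fin.succAboveCases i ?_ (fun j => ?_) k
      · simpa using contDiff_const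
      · simp only [Fin.insertNth_apply_succAbove]
        fun_prop
    rw [contDiffOn_euclidean]
    intro k
    exact (h _).contDiffOn.div (h _).contDiffOn (fun y hy => hy)
  refine key.mono ?_
  rintro y ⟨⟨-, hy⟩, -⟩
  exact hy

instance : T2Space (RP m) := by
  let f : RP m → Fin (m + 1) → Fin (m + 1) → ℝ :=
    Projectivization.lift (fun (v : {v : Fin (m + 1) → ℝ // v ≠ 0}) a b => v.1 a * v.1 b / ∑ k, v.1 k ^ 2) (by
      rintro ⟨a, ha⟩ ⟨b, hb⟩ t h
      dsimp only at h ⊢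
      subst h
      have ht : t ≠ 0 := fun h0 => ha (by simp [h0])
      ext p q
      simp only [Pi.smul_apply, smul_eq_mul, mul_pow, ← Finset.mul_sum]
      rw [show t * b p * (t * b q) = t ^ 2 * (b p * b q) by ring,
        mul_div_mul_left _ _ (pow_ne_zero 2 ht)])
  have pos : ∀ v : Fin (m + 1) → ℝ, v ≠ 0 → 0 < ∑ k, v k ^ 2 := by
    intro v hv
    obtain ⟨i, hi⟩ := Function.ne_iff.1 hv
    exact Finset.sum_pos' (fun _ _ => sq_nonneg _) ⟨i, Finset.mem_univ _, by
      have : v i ≠ 0 := hi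
      positivity⟩
  have hf : Continuous f := by
    rw [isQuotientMap_mk'.continuous_iff]
    change Continuous (fun v : {v : Fin (m + 1) → ℝ // v ≠ 0} =>
      fun a b => v.1 a * v.1 b / ∑ k, v.1 k ^ 2)
    refine continuous_pi fun a => continuous_pi fun b => ?_
    exact Continuous.div ((continuous_coord a).mul (continuous_coord b))
      (continuous_finsetSum _ fun k _ => (continuous_coord k).pow 2) (fun v => (pos v.1 v.2).ne')
  refine T2Space.of_injective_continuous (f := f) ?_ hf
  intro l l' h
  induction l using Projectivization.ind with
  | h v hv =>
    induction l' using Projectivization.ind with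
    | h w hw =>
      have h' : ∀ a b, v a * v b / ∑ k, v k ^ 2 = w a * w b / ∑ k, w k ^ 2 :=
        fun a b => congrFun (congrFun h a) b
      obtain ⟨i, hi⟩ := Function.ne_iff.1 hv
      have hi : v i ≠ 0 := hi
      have hp := pos v hv
      have hq := pos w hw
      rw [Projectivization.mk_eq_mk_iff']
      refine ⟨w i * (∑ k, v k ^ 2) / ((∑ k, w k ^ 2) * v i), ?_⟩
      ext a
      have := h' a i
      rw [div_eq_div_iff hp.ne' hq.ne'] at this
      simp only [Pi.smul_apply, smul_eq_mul]
      field_simp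
      linarith

/-- `ℝℙ^m` as a bundled smooth manifold. -/
noncomputable abbrev mfd (m : ℕ) : SmoothMfd m := ⟨RP m⟩

end RP

/-! ### The permutation action -/

/-- The permutation of coordinates of `ℝ^(m+1)`, sending the basis vector `e_i` to `e_{σ i}`. -/
noncomputable def permMap {m : ℕ} (σ : Equiv.Perm (Fin (m + 1))) :
    (Fin (m + 1) → ℝ) →ₗ[ℝ] (Fin (m + 1) → ℝ) :=
  LinearMap.funLeft ℝ ℝ (σ⁻¹ : Equiv.Perm (Fin (m + 1)))

lemma permMap_injective {m : ℕ} (σ : Equiv.Perm (Fin (m + 1))) :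
    Function.Injective (permMap σ) :=
  LinearMap.funLeft_injective_of_surjective ℝ ℝ _ (Equiv.surjective _)

/-- The action of the symmetric group on `ℝℙ^m` induced by permuting coordinates. -/
noncomputable instance {m : ℕ} : MulAction (Equiv.Perm (Fin (m + 1))) (RP m) where
  smul σ l := l.map (permMap σ) (permMap_injective σ)
  one_smul l := by
    induction l using Projectivization.ind with
    | h v hv => rfl
  mul_smul σ τ l := by
    induction l using Projectivization.ind with
    | h v hv =>
      change Projectivization.mk ℝ _ _ = Projectivization.mk ℝ _ _
      congr 1

/-! ### Subspace arrangements, the braid arrangement and its projectivization -/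

/-- The intersection lattice of an arrangement of linear subspaces: all intersections of its
members, including the empty intersection, which is the whole space. -/
def intersectionLattice {V : Type*} [AddCommGroup V] [Module ℝ V] (𝒜 : Set (Submodule ℝ V)) :
    Set (Submodule ℝ V) :=
  {U | ∃ ℬ ⊆ 𝒜, U = sInf ℬ}

/-- The hyperplane `x_j - x_i = 0`. -/
def braidHyperplane {m : ℕ} (i j : Fin (m + 1)) : Submodule ℝ (Fin (m + 1) → ℝ) :=
  LinearMap.ker ((LinearMap.proj j : (Fin (m + 1) → ℝ) →ₗ[ℝ] ℝ) - LinearMap.proj i)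

/-- The braid arrangement in `ℝ^(m+1)`. -/
def braidArrangement (m : ℕ) : Set (Submodule ℝ (Fin (m + 1) → ℝ)) :=
  {U | ∃ i j : Fin (m + 1), i ≠ j ∧ U = braidHyperplane i j}

/-- The projectivization of a linear subspace, as a set of points of projective space. -/
def projSet {m : ℕ} (U : Submodule ℝ (Fin (m + 1) → ℝ)) : Set (RP m) :=
  {l | l.submodule ≤ U}

/-- The rank 2 truncation of the projectivized braid arrangement: the projectivizations of all
the spaces of rank (that is, codimension) at least 2 in the intersection lattice. -/
def projBraidTruncation (m : ℕ) : Set (Set (RP m)) :=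
  {S | ∃ U ∈ intersectionLattice (braidArrangement m),
    2 ≤ Module.finrank ℝ ((Fin (m + 1) → ℝ) ⧸ U) ∧ S = projSet U}

/-! ### The maximal projective De Concini–Procesi model of the braid arrangement -/

/-- The index set: the elements of the intersection lattice other than the whole space. -/
abbrev BraidIndex (m : ℕ) : Type :=
  {U : Submodule ℝ (Fin (m + 1) → ℝ) // U ∈ intersectionLattice (braidArrangement m) ∧ U ≠ ⊤}

/-- `ℙ(V) × ∏_U ℙ(V/U)` with `V = ℝ^(m+1)`. -/
abbrev ModelAmbient (m : ℕ) : Type :=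
  RP m × ((U : BraidIndex m) → ℙ ℝ ((Fin (m + 1) → ℝ) ⧸ U.1))

/-- The maximal projective De Concini–Procesi model of the braid arrangement: the closure of the set
of all points `(ℓ, (⟨ℓ, U⟩ / U)_U)` with `ℓ` a line in the complement of the arrangement. -/
def projectiveModel (m : ℕ) : Set (ModelAmbient m) :=
  closure {w | (∀ U ∈ braidArrangement m, w.1 ∉ projSet U) ∧
    ∀ U : BraidIndex m, (w.2 U).submodule = w.1.submodule.map U.1.mkQ}

lemma comap_braidHyperplane {m : ℕ} (σ : Equiv.Perm (Fin (m + 1))) (i j : Fin (m + 1)) :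
    (braidHyperplane i j).comap (permMap σ) = braidHyperplane (σ⁻¹ i) (σ⁻¹ j) := rfl

/-- `σ⁻¹(U)` for `U` in the index set. -/
noncomputable def BraidIndex.preimage {m : ℕ} (σ : Equiv.Perm (Fin (m + 1))) (U : BraidIndex m) :
    BraidIndex m :=
  ⟨U.1.comap (permMap σ), by
    obtain ⟨U, ⟨ℬ, hB, rfl⟩, hU⟩ := U
    refine ⟨⟨(fun W => W.comap (permMap σ)) '' ℬ, ?_, ?_⟩, ?_⟩
    · rintro _ ⟨W, hW, rfl⟩
      obtain ⟨i, j, hij, rfl⟩ := hB hW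
      exact ⟨σ⁻¹ i, σ⁻¹ j, fun h => hij (Equiv.injective _ h), comap_braidHyperplane σ i j⟩
    · ext v
      simp [Submodule.mem_sInf]
    · intro h
      refine hU (eq_top_iff.2 fun v _ => ?_)
      have hs : Function.Surjective (permMap σ) :=
        LinearMap.surjective_of_injective (permMap_injective σ)
      obtain ⟨w, rfl⟩ := hs v
      have : w ∈ Submodule.comap (permMap σ) (sInf ℬ) := h ▸ Submodule.mem_top
      exact this⟩

/-- The action of the symmetric group on the ambient space of the model:
`σ (ℓ, (w_U)_U) = (σ ℓ, (σ (w_{σ⁻¹(U)}))_U)`. -/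
noncomputable def ambientAct {m : ℕ} (σ : Equiv.Perm (Fin (m + 1))) (w : ModelAmbient m) :
    ModelAmbient m :=
  (σ • w.1, fun U => (w.2 (U.preimage σ)).map
    (Submodule.mapQ (U.1.comap (permMap σ)) U.1 (permMap σ) le_rfl)
    (LinearMap.ker_eq_bot.1 (by
      rw [Submodule.ker_mapQ, Submodule.mkQ_map_self])))

/-! ### Smooth embeddings into the ambient space -/

/-- `F : Y → ℙ(V) × ∏_U ℙ(V/U)` is a smooth immersion. Smoothness of the component in `ℙ(V/U)` means
that it lifts locally to a smooth map `s U` to `V \ U`; a tangent vector `ξ` is annihilated by the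
differential of this component if and only if the differential of `s U` maps it to the span
of `U` and `s U y`. -/
def IsSmoothImmersion {m : ℕ} (Y : SmoothMfd m) (F : Y → ModelAmbient m) : Prop :=
  ContMDiff (𝓡 m) (𝓡 m) ∞ (fun y => (F y).1) ∧
  ∀ y : Y, ∃ s : BraidIndex m → Y → (Fin (m + 1) → ℝ),
    (∀ U, ContMDiffAt (𝓡 m) 𝓘(ℝ, Fin (m + 1) → ℝ) ∞ (s U) y) ∧
    (∀ U, ∀ᶠ z in 𝓝 y, s U z ∉ U.1 ∧
      ((F z).2 U).submodule = (Submodule.span ℝ {s U z}).map U.1.mkQ) ∧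
    ∀ ξ : TangentSpace (𝓡 m) y,
      mfderiv (𝓡 m) (𝓡 m) (fun z => (F z).1) y ξ = 0 →
      (∀ U, (mfderiv (𝓡 m) 𝓘(ℝ, Fin (m + 1) → ℝ) (s U) y ξ : Fin (m + 1) → ℝ) ∈
        U.1 ⊔ Submodule.span ℝ {s U y}) →
      ξ = 0

/-!
**Strata.** At a line `l` spanned by `v`, the tangent space is the orthogonal complement of `v`, and
the stabilizer acts on it by the permutation action twisted by the character `±1` of the line
(`exists_tangentSpace_equiv`). A group `H` fixing `l` preserves exactly the lines of tangent vectors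
that come from simultaneous eigenvectors of `H` in `V = ℝ^(m+1)`; these span the space
`squareFixed H` of vectors fixed by the squares of all elements of `H`, because modulo squares `H`
is an elementary abelian 2-group. Hence `ℒ(l, H)` is the projectivization of `squareFixed H`
(`stratumL_eq`). This space belongs to the intersection lattice, and it is not a hyperplane since
squares are even permutations. Conversely, squares of 3-cycles and of 4-cycles give all
intersections of two hyperplanes, and with these every element of the lattice of codimension at
least 2.

**The successive blowup.** Let `q : Y → ℝℙ^m` result from some of the blowups. The induction carries
the following description of `Y` (`IsWonderful`, `LocalModel`). Every `y ∈ Y` determines an element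
`W` of the lattice and a chart in which the line `q z`, modulo `W`, is spanned by `∑ φ z i • c i`,
the sum being over a subset `A` of the coordinates, with `c` a basis of `V / W`. For the
elements `U` of the lattice that do not contain `W`, the map to `ℙ(V/U)` lifts near `y` to a
smooth map to `V \ U`. The next center, the proper transform of `ℙ U₀`, is then `{φ z i = 0, i ∈ A}`
near the points with `W = U₀`, and it stays away from all others. In the standard charts of the
blowup `∑ φ z i • c i` is a coordinate times a vector that does not lie in `U₀`: this is the lift
for `U₀`. The new `W` is the smallest element of the lattice containing `U₀` and the value of this
lift, and a change of coordinates brings the lift modulo `W` into linear form (`IsWonderful.step`).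
A chart adapted to the center is not unique, but a diffeomorphism preserving the center lifts to the
blowups (`exists_blowup_lift`, by means of Hadamard's lemma), so any blowup has standard charts over
the chart of the local model. Existence of the blowup follows from the same description: it is the
closure of the graph of the map to `ℙ(V/U₀)` (`CenterData`).

**Comparison with the De Concini–Procesi model.** After all blowups the map to `ℙ(V/U)` is defined
everywhere, for all `U` (if `U` is a hyperplane, `ℙ(V/U)` is a point), which gives a map `F` from
`Y` to the ambient space. It is an injective immersion since each step of the induction separates
points and tangent directions, and `Y` is compact, so it is a closed embedding. Over the complement
of the arrangement, which is dense in `Y`, it is the graph defining the model. The action on the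
ambient space preserves the model; the action it induces on `Y` is smooth since `F` has smooth local
left inverses (`IsModel.exists_local_retraction`).
-/


/-! ### Smooth division by a coordinate -/

/-- The integral is the value at `0` of a convolution with the indicator of the unit interval, the
other factor being cut off to have compact support; such convolutions are smooth in parameters. -/
lemma contDiff_parametric_integral_unit {P : Type*} [NormedAddCommGroup P] [NormedSpace ℝ P]
    {G : P × ℝ → ℝ} (hG : ContDiff ℝ ∞ G) :
    ContDiff ℝ ∞ (fun p => ∫ u in (0 : ℝ)..1, G (p, u)) := by
  let χ : ContDiffBump (0 : ℝ) := ⟨1, 2, one_pos, one_lt_two⟩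
  let g : P → ℝ → ℝ := fun p u => χ u * G (p, -u)
  let f : ℝ → ℝ := indicator (Ioc 0 1) (fun _ => 1)
  have hf : MeasureTheory.LocallyIntegrable f MeasureTheory.volume := by
    refine MeasureTheory.Integrable.locallyIntegrable ?_
    rw [MeasureTheory.integrable_indicator_iff measurableSet_Ioc]
    simp
  have hg : ContDiffOn ℝ ((⊤ : ℕ∞) : WithTop ℕ∞) (↿g) (univ ×ˢ univ) := by
    refine ContDiff.contDiffOn ?_
    change ContDiff ℝ ∞ (fun q : P × ℝ => χ q.2 * G (q.1, -q.2))
    exact (χ.contDiff.comp contDiff_snd).mul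
      (hG.comp (contDiff_fst.prodMk contDiff_snd.neg))
  have key := MeasureTheory.contDiffOn_convolution_right_with_param_comp (n := ⊤)
    (μ := MeasureTheory.volume) (ContinuousLinearMap.mul ℝ ℝ) (v := fun _ : P => (0 : ℝ))
    contDiffOn_const (f := f) (g := g)
    (s := univ) isOpen_univ (isCompact_closedBall (0 : ℝ) 2) (fun p x _ hx => by
      have : χ x = 0 := by
        apply χ.zero_of_le_dist
        rw [Metric.mem_closedBall, not_le] at hx
        exact hx.le
      simp [g, this]) hf hg
  rw [contDiffOn_univ] at key
  convert key using 2 with p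
  rw [intervalIntegral.integral_of_le zero_le_one, ← MeasureTheory.integral_indicator
    measurableSet_Ioc, MeasureTheory.convolution_def]
  refine MeasureTheory.integral_congr_ae (Filter.Eventually.of_forall fun u => ?_)
  by_cases hu : u ∈ Ioc (0 : ℝ) 1
  · have : χ (-u) = 1 := by
      apply χ.one_of_mem_closedBall
      simp only [Metric.mem_closedBall, dist_zero_right, norm_neg, Real.norm_eq_abs]
      rw [abs_of_pos hu.1]; exact hu.2
    simp only [zero_sub, g, this]
    simp [f, hu]
  · simp [f, hu]

/-- Hadamard's lemma in one variable, with parameters: a smooth function that vanishes on the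
hyperplane `t k = 0` is locally the product of `t k` and a smooth function. -/
lemma exists_contDiff_eq_coord_mul {d : ℕ} (k : Fin d) {O : Set (EuclideanSpace ℝ (Fin d))}
    (hO : IsOpen O) {H : EuclideanSpace ℝ (Fin d) → ℝ} (hH : ContDiffOn ℝ ∞ H O)
    (hz : ∀ t ∈ O, t k = 0 → H t = 0) {t₀ : EuclideanSpace ℝ (Fin d)} (ht₀ : t₀ ∈ O) :
    ∃ b : EuclideanSpace ℝ (Fin d) → ℝ, ContDiff ℝ ∞ b ∧ ∀ᶠ t in 𝓝 t₀, H t = t k * b t := by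
  -- multiply by a cutoff to make the function globally smooth
  obtain ⟨ε, hε, hεO⟩ := Metric.isOpen_iff.1 hO t₀ ht₀
  let χ : ContDiffBump t₀ := ⟨ε / 4, ε / 2, by positivity, by linarith⟩
  let K : EuclideanSpace ℝ (Fin d) → ℝ := fun t => χ t * H t
  have hKs : ContDiff ℝ ∞ K := by
    rw [contDiff_iff_contDiffAt]
    intro t
    by_cases ht : t ∈ O
    · exact χ.contDiff.contDiffAt.mul (hH.contDiffAt (hO.mem_nhds ht))
    · have hd : t ∈ (tsupport χ)ᶜ := by
        rw [χ.tsupport_eq]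
        intro h
        apply ht (hεO _)
        rw [Metric.mem_closedBall] at h
        rw [Metric.mem_ball]
        change _ ≤ ε / 2 at h
        linarith
      have : K =ᶠ[𝓝 t] fun _ => 0 := by
        filter_upwards [(isClosed_tsupport χ).isOpen_compl.mem_nhds hd] with s hs
        have : χ s = 0 := image_eq_zero_of_notMem_tsupport hs
        simp [K, this]
      exact contDiffAt_const.congr_of_eventuallyEq this
  have hKz : ∀ t, t k = 0 → K t = 0 := by
    intro t ht
    by_cases h : t ∈ O
    · simp [K, hz t h ht]
    · have : χ t = 0 := by
        apply χ.zero_of_le_dist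
        by_contra! h'
        apply h (hεO _)
        rw [Metric.mem_ball]
        change _ < ε / 2 at h'
        linarith
      simp [K, this]
  -- `γ (t, ·)` is the segment from the projection of `t` to the hyperplane up to `t`
  let e : EuclideanSpace ℝ (Fin d) := EuclideanSpace.single k 1
  let γ : EuclideanSpace ℝ (Fin d) × ℝ → EuclideanSpace ℝ (Fin d) :=
    fun q => q.1 + ((q.2 - 1) * q.1 k) • e
  have hk : ContDiff ℝ ∞ (fun q : EuclideanSpace ℝ (Fin d) × ℝ => q.1 k) := by fun_prop
  have hγ : ContDiff ℝ ∞ γ :=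
    contDiff_fst.add (((contDiff_snd.sub contDiff_const).mul hk).smul contDiff_const)
  let G : EuclideanSpace ℝ (Fin d) × ℝ → ℝ := fun q => fderiv ℝ K (γ q) e
  have hG : ContDiff ℝ ∞ G :=
    ((hKs.fderiv_right (m := ∞) (by simp)).comp hγ).clm_apply contDiff_const
  refine ⟨fun t => ∫ u in (0 : ℝ)..1, G (t, u), contDiff_parametric_integral_unit hG, ?_⟩
  have hmain : ∀ t, K t = t k * ∫ u in (0 : ℝ)..1, G (t, u) := by
    intro t
    have hder : ∀ u : ℝ, HasDerivAt (fun u => K (γ (t, u))) (t k * G (t, u)) u := by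
      intro u
      have h1 : HasDerivAt (fun u : ℝ => γ (t, u)) ((t k) • e) u := by
        have : HasDerivAt (fun u : ℝ => (u - 1) * t k) (t k) u := by
          simpa using ((hasDerivAt_id u).sub_const 1).mul_const (t k)
        simpa [γ] using (this.smul_const e).const_add t
      have h2 := ((hKs.differentiable (by simp)) (γ (t, u))).hasFDerivAt.comp_hasDerivAt u h1
      rw [map_smul] at h2
      exact h2
    have hint := intervalIntegral.integral_eq_sub_of_hasDerivAt (a := 0) (b := 1)
      (fun u _ => hder u) (by
        refine Continuous.intervalIntegrable ?_ _ _
        exact continuous_const.mul (hG.continuous.comp (by fun_prop)))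
    rw [intervalIntegral.integral_const_mul] at hint
    rw [hint]
    have h0 : K (γ (t, 0)) = 0 := hKz _ (by simp [γ, e])
    rw [h0]
    simp [γ]
  have h1 : ∀ᶠ t in 𝓝 t₀, χ t = 1 := χ.eventuallyEq_one
  filter_upwards [h1] with t ht
  rw [← hmain t]
  simp [K, ht]

/-! ### Lifting diffeomorphisms to the standard charts of a blowup -/

section Lift

variable {d : ℕ}

lemma blowdownChart_apply (A : Finset (Fin d)) (j i : Fin d) (y : EuclideanSpace ℝ (Fin d)) :
    blowdownChart A j y i = if i ∈ A ∧ i ≠ j then y j * y i else y i := rfl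

lemma blowdownChart_self (A : Finset (Fin d)) (j : Fin d) (y : EuclideanSpace ℝ (Fin d)) :
    blowdownChart A j y j = y j := by simp [blowdownChart_apply]

lemma contDiff_blowdownChart (A : Finset (Fin d)) (j : Fin d) :
    ContDiff ℝ ∞ (blowdownChart A j) := by
  rw [contDiff_euclidean]
  intro i
  simp only [blowdownChart_apply]
  split_ifs <;> fun_prop

lemma blowdownChart_eq_zero_iff {A : Finset (Fin d)} {j : Fin d} (hj : j ∈ A)
    (y : EuclideanSpace ℝ (Fin d)) : (∀ i ∈ A, blowdownChart A j y i = 0) ↔ y j = 0 := by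
  constructor
  · intro h
    simpa [blowdownChart_self] using h j hj
  · intro h i hi
    rw [blowdownChart_apply]
    by_cases hij : i = j
    · simp [hij, h]
    · simp [hi, hij, h]

lemma blowdownChart_injective_of_ne_zero {A : Finset (Fin d)} {j : Fin d}
    {y y' : EuclideanSpace ℝ (Fin d)} (h0 : y j ≠ 0)
    (h : blowdownChart A j y = blowdownChart A j y') : y = y' := by
  have hj : y j = y' j := by
    simpa [blowdownChart_self] using congrArg (fun z => z j) h
  ext i
  have hi := congrArg (fun z => z i) h
  simp only [blowdownChart_apply] at hi
  split_ifs at hi with hc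
  · rw [← hj] at hi
    exact mul_left_cancel₀ h0 hi
  · exact hi

/-- The lift of a map `h` to the `j`-th standard chart, where `b i` are the quotients of the
components of `h` by the equation of the exceptional divisor. -/
noncomputable def chartLift (A : Finset (Fin d)) (j : Fin d)
    (H : EuclideanSpace ℝ (Fin d) → EuclideanSpace ℝ (Fin d))
    (b : Fin d → EuclideanSpace ℝ (Fin d) → ℝ)
    (t : EuclideanSpace ℝ (Fin d)) : EuclideanSpace ℝ (Fin d) :=
  WithLp.toLp 2 fun i => if i ∈ A ∧ i ≠ j then b i t / b j t else H t i

lemma chartLift_apply (A : Finset (Fin d)) (j : Fin d)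
    (H : EuclideanSpace ℝ (Fin d) → EuclideanSpace ℝ (Fin d))
    (b : Fin d → EuclideanSpace ℝ (Fin d) → ℝ) (t : EuclideanSpace ℝ (Fin d)) (i : Fin d) :
    chartLift A j H b t i = if i ∈ A ∧ i ≠ j then b i t / b j t else H t i := rfl

lemma blowdownChart_chartLift {A : Finset (Fin d)} {j : Fin d} (hj : j ∈ A)
    {H : EuclideanSpace ℝ (Fin d) → EuclideanSpace ℝ (Fin d)}
    {b : Fin d → EuclideanSpace ℝ (Fin d) → ℝ} {t : EuclideanSpace ℝ (Fin d)} {c : ℝ}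
    (hb : ∀ i ∈ A, H t i = c * b i t) (h0 : b j t ≠ 0) :
    blowdownChart A j (chartLift A j H b t) = H t := by
  ext i
  rw [blowdownChart_apply]
  split_ifs with hi
  · rw [chartLift_apply, chartLift_apply, if_pos hi, if_neg (by simp), hb j hj, hb i hi.1]
    field_simp
  · rw [chartLift_apply, if_neg hi]

lemma contDiffAt_chartLift {A : Finset (Fin d)} {j : Fin d}
    {H : EuclideanSpace ℝ (Fin d) → EuclideanSpace ℝ (Fin d)}
    {b : Fin d → EuclideanSpace ℝ (Fin d) → ℝ} {t : EuclideanSpace ℝ (Fin d)}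
    (hH : ContDiffAt ℝ ∞ H t) (hb : ∀ i, ContDiff ℝ ∞ (b i)) (h0 : b j t ≠ 0) :
    ContDiffAt ℝ ∞ (chartLift A j H b) t := by
  rw [contDiffAt_euclidean]
  intro i
  simp only [chartLift_apply]
  split_ifs with hi
  · exact (hb i).contDiffAt.div (hb j).contDiffAt h0
  · exact (contDiffAt_euclidean.1 hH) i

/-- The components of `h ∘ blowdownChart A k` that vanish on the exceptional divisor `t k = 0` are
divisible by `t k`. -/
lemma exists_quotients {A A' : Finset (Fin d)} {k : Fin d} (hk : k ∈ A)
    {O : Set (EuclideanSpace ℝ (Fin d))} (hO : IsOpen O)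
    {h : EuclideanSpace ℝ (Fin d) → EuclideanSpace ℝ (Fin d)} (hh : ContDiffOn ℝ ∞ h O)
    (hz : ∀ x ∈ O, (∀ i ∈ A, x i = 0) → ∀ i ∈ A', h x i = 0)
    {t₀ : EuclideanSpace ℝ (Fin d)} (ht₀ : blowdownChart A k t₀ ∈ O) :
    ∃ b : Fin d → EuclideanSpace ℝ (Fin d) → ℝ, (∀ i, ContDiff ℝ ∞ (b i)) ∧
      ∀ᶠ t in 𝓝 t₀, ∀ i ∈ A', h (blowdownChart A k t) i = t k * b i t := by
  have hO' : IsOpen (blowdownChart A k ⁻¹' O) :=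
    hO.preimage (contDiff_blowdownChart A k).continuous
  have hH : ContDiffOn ℝ ∞ (h ∘ blowdownChart A k) (blowdownChart A k ⁻¹' O) :=
    hh.comp (contDiff_blowdownChart A k).contDiffOn (fun _ h => h)
  rw [contDiffOn_euclidean] at hH
  have : ∀ i, ∃ b : EuclideanSpace ℝ (Fin d) → ℝ, ContDiff ℝ ∞ b ∧
      ∀ᶠ t in 𝓝 t₀, i ∈ A' → h (blowdownChart A k t) i = t k * b t := by
    intro i
    by_cases hi : i ∈ A'
    · obtain ⟨b, hb, hb'⟩ := exists_contDiff_eq_coord_mul k hO' (hH i)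
        (fun t ht htk => hz _ ht ((blowdownChart_eq_zero_iff hk t).2 htk) i hi) ht₀
      exact ⟨b, hb, hb'.mono fun t ht _ => ht⟩
    · exact ⟨0, contDiff_const, Filter.Eventually.of_forall fun t h => (hi h).elim⟩
  choose b hb hb' using this
  exact ⟨b, hb, (Filter.eventually_all.2 hb').mono fun t ht i hi => ht i hi⟩

/-- The complement of a coordinate hyperplane accumulates at every point. -/
lemma eq_of_eventually_ne {k : Fin d} {t₀ : EuclideanSpace ℝ (Fin d)} {Z : Type*}
    [TopologicalSpace Z] [T2Space Z] {f g : EuclideanSpace ℝ (Fin d) → Z}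
    (hf : ContinuousAt f t₀) (hg : ContinuousAt g t₀)
    (h : ∀ᶠ t in 𝓝 t₀, t k ≠ 0 → f t = g t) : f t₀ = g t₀ := by
  let γ : ℝ → EuclideanSpace ℝ (Fin d) := fun ε => t₀ + ε • EuclideanSpace.single k 1
  have hγ : Filter.Tendsto γ (𝓝 0) (𝓝 t₀) := by
    have : Continuous γ := by fun_prop
    simpa [γ] using this.tendsto 0
  have hne : ∀ᶠ ε in 𝓝[≠] (0 : ℝ), γ ε k ≠ 0 := by
    have h1 : ∀ ε, γ ε k = t₀ k + ε := by intro ε; simp [γ]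
    simp only [h1]
    by_cases h0 : t₀ k = 0
    · simp only [h0, zero_add]
      exact eventually_mem_nhdsWithin
    · have : ∀ᶠ ε in 𝓝 (0 : ℝ), t₀ k + ε ≠ 0 := by
        have hc : ContinuousAt (fun ε : ℝ => t₀ k + ε) 0 := by fun_prop
        exact hc.eventually_ne (by simpa using h0)
      exact this.filter_mono nhdsWithin_le_nhds
  have hγ' : Filter.Tendsto γ (𝓝[≠] 0) (𝓝 t₀) := hγ.mono_left nhdsWithin_le_nhds
  refine tendsto_nhds_unique_of_eventuallyEq (hf.tendsto.comp hγ') (hg.tendsto.comp hγ') ?_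
  filter_upwards [hγ'.eventually h, hne] with ε h1 h2 using h1 h2

/-- Two smooth maps that are inverse to each other on neighbourhoods restrict to a local
diffeomorphism with source in a given neighbourhood. -/
lemma exists_openPartialHomeomorph_of_eventually_inverse {E : Type*} [NormedAddCommGroup E]
    [NormedSpace ℝ E] {f g : E → E} {x : E} {O : Set E} (hO : O ∈ 𝓝 x)
    (hf : ∀ᶠ y in 𝓝 x, ContDiffAt ℝ ∞ f y) (hg : ∀ᶠ y in 𝓝 (f x), ContDiffAt ℝ ∞ g y)
    (hgf : ∀ᶠ y in 𝓝 x, g (f y) = y) (hfg : ∀ᶠ y in 𝓝 (f x), f (g y) = y) :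
    ∃ e : OpenPartialHomeomorph E E, x ∈ e.source ∧ e.source ⊆ O ∧ (∀ y, e y = f y) ∧
      ContDiffOn ℝ ∞ e e.source ∧ ContDiffOn ℝ ∞ e.symm e.target := by
  obtain ⟨S, hS, hSo, hxS⟩ := eventually_nhds_iff.1 (hf.and (hgf.and hO))
  obtain ⟨T, hT, hTo, hxT⟩ := eventually_nhds_iff.1 (hg.and hfg)
  have hfS : ContDiffOn ℝ ∞ f S := fun y hy => (hS y hy).1.contDiffWithinAt
  have hgT : ContDiffOn ℝ ∞ g T := fun y hy => (hT y hy).1.contDiffWithinAt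
  let e : OpenPartialHomeomorph E E :=
    { toFun := f
      invFun := g
      source := S ∩ f ⁻¹' T
      target := T ∩ g ⁻¹' S
      map_source' := fun y hy => ⟨hy.2, by
        change g (f y) ∈ S
        rw [(hS y hy.1).2.1]; exact hy.1⟩
      map_target' := fun y hy => ⟨hy.2, by
        change f (g y) ∈ T
        rw [(hT y hy.1).2]; exact hy.1⟩
      left_inv' := fun y hy => (hS y hy.1).2.1
      right_inv' := fun y hy => (hT y hy.1).2
      open_source := hfS.continuousOn.isOpen_inter_preimage hSo hTo
      open_target := hgT.continuousOn.isOpen_inter_preimage hTo hSo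
      continuousOn_toFun := hfS.continuousOn.mono inter_subset_left
      continuousOn_invFun := hgT.continuousOn.mono inter_subset_left }
  exact ⟨e, ⟨hxS, hxT⟩, fun y hy => (hS y hy.1).2.2, fun _ => rfl,
    hfS.mono inter_subset_left, hgT.mono inter_subset_left⟩

end Lift

section Lift

variable {d : ℕ}

/-- If all the quotients `b i` vanished at a point of the exceptional divisor, the differential of
`h` would map the direction transversal to the center into the tangent space of the image of the
center. -/
lemma exists_quotient_ne_zero {A A' : Finset (Fin d)} {k : Fin d} (hk : k ∈ A)
    (h : OpenPartialHomeomorph (EuclideanSpace ℝ (Fin d)) (EuclideanSpace ℝ (Fin d)))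
    (hs : ContDiffOn ℝ ∞ h h.source) (hs' : ContDiffOn ℝ ∞ h.symm h.target)
    (hz : ∀ x ∈ h.target, (∀ i ∈ A', x i = 0) → ∀ i ∈ A, h.symm x i = 0)
    {t₀ : EuclideanSpace ℝ (Fin d)} (ht₀ : blowdownChart A k t₀ ∈ h.source) (h0 : t₀ k = 0)
    {b : Fin d → EuclideanSpace ℝ (Fin d) → ℝ} (hb : ∀ i, ContDiff ℝ ∞ (b i))
    (hbe : ∀ᶠ t in 𝓝 t₀, ∀ i ∈ A', h (blowdownChart A k t) i = t k * b i t) :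
    ∃ j ∈ A', b j t₀ ≠ 0 := by
  -- `f` is the image under `h` of the curve transversal to the exceptional divisor, `w` its
  -- velocity
  by_contra! hcon
  let γ : ℝ → EuclideanSpace ℝ (Fin d) := fun ε => t₀ + ε • EuclideanSpace.single k 1
  have hγs : ContDiff ℝ ∞ γ := by fun_prop
  have hγ0 : γ 0 = t₀ := by simp [γ]
  have hγk : ∀ ε, γ ε k = ε := by intro ε; simp [γ, h0]
  have hγt : Filter.Tendsto γ (𝓝 0) (𝓝 t₀) := by
    simpa [hγ0] using hγs.continuous.tendsto 0
  let f : ℝ → EuclideanSpace ℝ (Fin d) := fun ε => h (blowdownChart A k (γ ε))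
  have hfd : DifferentiableAt ℝ f 0 := by
    have h1 : ContDiffAt ℝ ∞ h (blowdownChart A k (γ 0)) := by
      rw [hγ0]
      exact hs.contDiffAt (h.open_source.mem_nhds ht₀)
    have : ContDiffAt ℝ ∞ f 0 := ContDiffAt.comp (g := h)
      (f := fun ε => blowdownChart A k (γ ε)) 0 h1
      ((contDiff_blowdownChart A k).comp hγs).contDiffAt
    exact this.differentiableAt (by simp)
  set w := deriv f 0 with hw
  set y₀ := h (blowdownChart A k t₀) with hy₀
  have hf0 : f 0 = y₀ := by simp [f, hγ0, hy₀]
  have hy₀t : y₀ ∈ h.target := h.map_source ht₀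
  -- the vanishing of all quotients makes `w` tangent to the image of the center
  have hwi : ∀ i ∈ A', w i = 0 := by
    intro i hi
    have h1 : HasDerivAt (fun ε => f ε i) (w i) 0 := by
      have := (EuclideanSpace.proj (𝕜 := ℝ) i :
        EuclideanSpace ℝ (Fin d) →L[ℝ] ℝ).hasFDerivAt.comp_hasDerivAt (0 : ℝ) hfd.hasDerivAt
      exact this
    have h2 : HasDerivAt (fun ε : ℝ => ε * b i (γ ε)) (b i t₀) 0 := by
      have h3 : DifferentiableAt ℝ (fun ε => b i (γ ε)) 0 :=
        (((hb i).comp hγs).differentiable (by simp)) 0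
      have := (hasDerivAt_id (0 : ℝ)).mul h3.hasDerivAt
      have h4 : (1 : ℝ) * b i (γ 0) + id 0 * deriv (fun ε => b i (γ ε)) 0 = b i t₀ := by
        simp [hγ0]
      rw [h4] at this
      exact this
    have h3 : (fun ε => f ε i) =ᶠ[𝓝 0] fun ε : ℝ => ε * b i (γ ε) := by
      filter_upwards [hγt.eventually hbe] with ε hε
      rw [hε i hi, hγk]
    rw [(h1.congr_of_eventuallyEq h3.symm).unique h2, hcon i hi]
  have hy₀A : ∀ i ∈ A', y₀ i = 0 := by
    intro i hi
    have := hbe.self_of_nhds i hi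
    rw [this, h0, zero_mul]
  -- the `k`-th coordinate of `h.symm` has derivative 1 along `f`, but along the image of the
  -- center, hence in the direction `w`, it is constant
  let p : EuclideanSpace ℝ (Fin d) → ℝ := fun x => h.symm x k
  have hpd : DifferentiableAt ℝ p y₀ := by
    have : ContDiffAt ℝ ∞ h.symm y₀ := hs'.contDiffAt (h.open_target.mem_nhds hy₀t)
    exact ((contDiffAt_euclidean.1 this) k).differentiableAt (by simp)
  have h1 : HasDerivAt (fun ε => p (f ε)) (fderiv ℝ p y₀ w) 0 := by
    have := hpd.hasFDerivAt
    rw [← hf0] at this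
    have := this.comp_hasDerivAt (0 : ℝ) hfd.hasDerivAt
    rw [hf0] at this
    exact this
  have h2 : (fun ε => p (f ε)) =ᶠ[𝓝 0] fun ε => ε := by
    have hcont : Filter.Tendsto (fun ε => blowdownChart A k (γ ε)) (𝓝 0)
        (𝓝 (blowdownChart A k t₀)) :=
      ((contDiff_blowdownChart A k).continuous.tendsto t₀).comp hγt
    filter_upwards [hcont.eventually (h.open_source.mem_nhds ht₀)] with ε hε
    simp only [p, f]
    rw [h.left_inv hε, blowdownChart_self, hγk]
  have h3 : fderiv ℝ p y₀ w = 1 :=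
    (h1.congr_of_eventuallyEq h2.symm).unique (hasDerivAt_id (0 : ℝ))
  let δ : ℝ → EuclideanSpace ℝ (Fin d) := fun ε => y₀ + ε • w
  have hδ : HasDerivAt δ w 0 := by
    simpa [δ] using ((hasDerivAt_id (0 : ℝ)).smul_const w).const_add y₀
  have hδ0 : δ 0 = y₀ := by simp [δ]
  have h4 : HasDerivAt (fun ε => p (δ ε)) (fderiv ℝ p y₀ w) 0 := by
    have := hpd.hasFDerivAt
    rw [← hδ0] at this
    have := this.comp_hasDerivAt (0 : ℝ) hδ
    rw [hδ0] at this
    exact this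
  have h5 : (fun ε => p (δ ε)) =ᶠ[𝓝 0] fun _ => 0 := by
    have hδc : Filter.Tendsto δ (𝓝 0) (𝓝 y₀) := by
      simpa [hδ0] using hδ.continuousAt.tendsto
    filter_upwards [hδc.eventually (h.open_target.mem_nhds hy₀t)] with ε hε
    exact hz _ hε (fun i hi => by simp [δ, hy₀A i hi, hwi i hi]) k hk
  have h6 : fderiv ℝ p y₀ w = 0 :=
    (h4.congr_of_eventuallyEq h5.symm).unique (hasDerivAt_const (0 : ℝ) (0 : ℝ))
  rw [h6] at h3
  exact zero_ne_one h3

/-- A local diffeomorphism of `ℝ^d` that matches two coordinate subspaces lifts to a local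
diffeomorphism between standard charts of their blowups. -/
lemma exists_blowup_lift {A A' : Finset (Fin d)} {k : Fin d} (hk : k ∈ A)
    (h : OpenPartialHomeomorph (EuclideanSpace ℝ (Fin d)) (EuclideanSpace ℝ (Fin d)))
    (hs : ContDiffOn ℝ ∞ h h.source) (hs' : ContDiffOn ℝ ∞ h.symm h.target)
    (hz : ∀ x ∈ h.source, (∀ i ∈ A, x i = 0) ↔ ∀ i ∈ A', h x i = 0)
    {t₀ : EuclideanSpace ℝ (Fin d)} (ht₀ : blowdownChart A k t₀ ∈ h.source) (h0 : t₀ k = 0) :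
    ∃ j ∈ A', ∃ e : OpenPartialHomeomorph (EuclideanSpace ℝ (Fin d)) (EuclideanSpace ℝ (Fin d)),
      t₀ ∈ e.source ∧
      (∀ t ∈ e.source, blowdownChart A k t ∈ h.source ∧
        blowdownChart A' j (e t) = h (blowdownChart A k t)) ∧
      ContDiffOn ℝ ∞ e e.source ∧ ContDiffOn ℝ ∞ e.symm e.target := by
  have hz' : ∀ x ∈ h.target, (∀ i ∈ A', x i = 0) → ∀ i ∈ A, h.symm x i = 0 := by
    intro x hx hxA
    rw [hz _ (h.map_target hx), h.right_inv hx]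
    exact hxA
  obtain ⟨b, hb, hbe⟩ := exists_quotients hk h.open_source hs
    (fun x hx hx0 => (hz x hx).1 hx0) ht₀
  obtain ⟨j, hj, hbj⟩ := exists_quotient_ne_zero hk h hs hs' hz' ht₀ h0 hb hbe
  let H : EuclideanSpace ℝ (Fin d) → EuclideanSpace ℝ (Fin d) := fun t => h (blowdownChart A k t)
  -- `Ψ` is the lift of `h`; its `j`-th chart is the one in which the quotient `b j` does not vanish
  let Ψ := chartLift A' j H b
  have hβk := (contDiff_blowdownChart A k).continuous
  have hβj := (contDiff_blowdownChart A' j).continuous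
  have hsrc : ∀ᶠ t in 𝓝 t₀, blowdownChart A k t ∈ h.source :=
    hβk.continuousAt.eventually (h.open_source.mem_nhds ht₀)
  have hne : ∀ᶠ t in 𝓝 t₀, b j t ≠ 0 := (hb j).continuous.continuousAt.eventually_ne hbj
  have hHs : ∀ᶠ t in 𝓝 t₀, ContDiffAt ℝ ∞ H t := by
    filter_upwards [hsrc] with t ht
    exact ContDiffAt.comp (g := h) t (hs.contDiffAt (h.open_source.mem_nhds ht))
      (contDiff_blowdownChart A k).contDiffAt
  have hΨs : ∀ᶠ t in 𝓝 t₀, ContDiffAt ℝ ∞ Ψ t := by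
    filter_upwards [hHs, hne] with t h1 h2 using contDiffAt_chartLift h1 hb h2
  have hΨβ : ∀ᶠ t in 𝓝 t₀, blowdownChart A' j (Ψ t) = H t := by
    filter_upwards [hbe, hne] with t h1 h2 using blowdownChart_chartLift hj h1 h2
  set τ₀ := Ψ t₀ with hτ₀
  have hτ₀β : blowdownChart A' j τ₀ = H t₀ := hΨβ.self_of_nhds
  have hτ₀t : blowdownChart A' j τ₀ ∈ h.symm.source := by
    rw [hτ₀β]; exact h.map_source ht₀
  obtain ⟨b', hb', hbe'⟩ := exists_quotients hj h.symm.open_source hs' hz' hτ₀t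
  have hΨc : ContinuousAt Ψ t₀ := hΨs.self_of_nhds.continuousAt
  have hΨj : ∀ᶠ t in 𝓝 t₀, Ψ t j = t k * b j t := by
    filter_upwards [hbe] with t ht
    rw [← ht j hj]
    change chartLift A' j H b t j = _
    rw [chartLift_apply, if_neg (by simp)]
  have hinv : ∀ᶠ t in 𝓝 t₀, h.symm (blowdownChart A' j (Ψ t)) = blowdownChart A k t := by
    filter_upwards [hΨβ, hsrc] with t h1 h2
    rw [h1]
    exact h.left_inv h2
  -- the two quotients belonging to the chosen charts are inverse to each other
  have hprod : b' k τ₀ * b j t₀ = 1 := by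
    refine eq_of_eventually_ne (k := k) (f := fun t => b' k (Ψ t) * b j t) (g := fun _ => 1)
      (((hb' k).continuous.continuousAt.comp hΨc).mul (hb j).continuous.continuousAt)
      continuousAt_const ?_
    filter_upwards [hinv, hΨj, hΨc.eventually hbe'] with t h1 h2 h3 htk
    have h4 := h3 k hk
    rw [h1, blowdownChart_self, h2] at h4
    apply mul_left_cancel₀ htk
    linarith
  have hb'k : b' k τ₀ ≠ 0 := fun h => by rw [h, zero_mul] at hprod; exact zero_ne_one hprod
  let H' : EuclideanSpace ℝ (Fin d) → EuclideanSpace ℝ (Fin d) :=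
    fun t => h.symm (blowdownChart A' j t)
  -- `Φ` is the lift of the inverse; away from the exceptional divisors it inverts `Ψ` because the
  -- blowdown maps are injective there
  let Φ := chartLift A k H' b'
  have hsrc' : ∀ᶠ t in 𝓝 τ₀, blowdownChart A' j t ∈ h.target :=
    hβj.continuousAt.eventually (h.open_target.mem_nhds hτ₀t)
  have hne' : ∀ᶠ t in 𝓝 τ₀, b' k t ≠ 0 := (hb' k).continuous.continuousAt.eventually_ne hb'k
  have hHs' : ∀ᶠ t in 𝓝 τ₀, ContDiffAt ℝ ∞ H' t := by
    filter_upwards [hsrc'] with t ht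
    exact ContDiffAt.comp (g := h.symm) t (hs'.contDiffAt (h.open_target.mem_nhds ht))
      (contDiff_blowdownChart A' j).contDiffAt
  have hΦs : ∀ᶠ t in 𝓝 τ₀, ContDiffAt ℝ ∞ Φ t := by
    filter_upwards [hHs', hne'] with t h1 h2 using contDiffAt_chartLift h1 hb' h2
  have hΦβ : ∀ᶠ t in 𝓝 τ₀, blowdownChart A k (Φ t) = H' t := by
    filter_upwards [hbe', hne'] with t h1 h2 using blowdownChart_chartLift hk h1 h2
  have hΦc : ContinuousAt Φ τ₀ := hΦs.self_of_nhds.continuousAt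
  have hΦΨ' : ∀ᶠ t in 𝓝 t₀, t k ≠ 0 → Φ (Ψ t) = t := by
    filter_upwards [hinv, hΨc.eventually hΦβ] with t h1 h2 htk
    refine (blowdownChart_injective_of_ne_zero (A := A) htk ?_).symm
    rw [h2]; exact h1.symm
  have hΦΨ : ∀ᶠ t in 𝓝 t₀, Φ (Ψ t) = t := by
    filter_upwards [hΦΨ'.eventually_nhds, hΨs, hΨc.eventually hΦs] with t h1 h2 h3
    exact eq_of_eventually_ne (k := k) (f := fun t => Φ (Ψ t)) (g := fun t => t)
      (h3.continuousAt.comp h2.continuousAt) continuousAt_id h1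
  have hΦτ₀ : Φ τ₀ = t₀ := hΦΨ.self_of_nhds
  have hΦt : Filter.Tendsto Φ (𝓝 τ₀) (𝓝 t₀) := by
    have := hΦc.tendsto
    rwa [hΦτ₀] at this
  have hΨΦ' : ∀ᶠ t in 𝓝 τ₀, t j ≠ 0 → Ψ (Φ t) = t := by
    filter_upwards [hΦβ, hΦt.eventually hΨβ, hsrc'] with t h1 h2 h3 htj
    refine (blowdownChart_injective_of_ne_zero (A := A') htj ?_).symm
    rw [h2]
    change _ = h (blowdownChart A k (Φ t))
    rw [h1]
    exact (h.right_inv h3).symm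
  have hΨΦ : ∀ᶠ t in 𝓝 τ₀, Ψ (Φ t) = t := by
    filter_upwards [hΨΦ'.eventually_nhds, hΦs, hΦt.eventually hΨs] with t h1 h2 h3
    exact eq_of_eventually_ne (k := j) (f := fun t => Ψ (Φ t)) (g := fun t => t)
      (h3.continuousAt.comp h2.continuousAt) continuousAt_id h1
  obtain ⟨e, he, heO, heq, hes, hes'⟩ := exists_openPartialHomeomorph_of_eventually_inverse
    (O := {t | blowdownChart A k t ∈ h.source ∧ blowdownChart A' j (Ψ t) = H t})
    (hsrc.and hΨβ) hΨs hΦs hΦΨ hΨΦ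
  refine ⟨j, hj, e, he, fun t ht => ⟨(heO ht).1, ?_⟩, hes, hes'⟩
  rw [heq]
  exact (heO ht).2

end Lift

/-! ### Charts, density and compactness of blowups -/

section Blowup

variable {d : ℕ}

lemma trans_mem_maximalAtlas {M : Type*} [TopologicalSpace M]
    [ChartedSpace (EuclideanSpace ℝ (Fin d)) M] [IsManifold (𝓡 d) ∞ M]
    {ψ : OpenPartialHomeomorph M (EuclideanSpace ℝ (Fin d))}
    (hψ : ψ ∈ IsManifold.maximalAtlas (𝓡 d) ∞ M)
    {e : OpenPartialHomeomorph (EuclideanSpace ℝ (Fin d)) (EuclideanSpace ℝ (Fin d))}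
    (he : ContDiffOn ℝ ∞ e e.source) (he' : ContDiffOn ℝ ∞ e.symm e.target) :
    ψ.trans e ∈ IsManifold.maximalAtlas (𝓡 d) ∞ M := by
  rw [IsManifold.mem_maximalAtlas_iff_contMDiffOn] at hψ ⊢
  rw [← contMDiffOn_iff_contDiffOn] at he he'
  constructor
  · refine he.comp (hψ.1.mono ?_) ?_
    · intro x hx; exact hx.1
    · intro x hx; exact hx.2
  · refine hψ.2.comp (he'.mono ?_) ?_
    · intro x hx; exact hx.1
    · intro x hx; exact hx.2

lemma contDiffOn_transition {M : Type*} [TopologicalSpace M]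
    [ChartedSpace (EuclideanSpace ℝ (Fin d)) M] [IsManifold (𝓡 d) ∞ M]
    {φ ψ : OpenPartialHomeomorph M (EuclideanSpace ℝ (Fin d))}
    (hφ : φ ∈ IsManifold.maximalAtlas (𝓡 d) ∞ M) (hψ : ψ ∈ IsManifold.maximalAtlas (𝓡 d) ∞ M) :
    ContDiffOn ℝ ∞ (φ.symm.trans ψ) (φ.symm.trans ψ).source := by
  rw [← contMDiffOn_iff_contDiffOn]
  exact contMDiffOn_of_mem_contDiffGroupoid
    (StructureGroupoid.compatible_of_mem_maximalAtlas hφ hψ)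

namespace IsBlowup

variable {X Y : SmoothMfd d} {Z : Set X} {p : Y → X}

/-- Over a chart of `X` in which the center is a coordinate subspace, `Y` is covered by standard
charts of the blowup; the chart need not be one of those provided by the definition. -/
theorem exists_chart_over_center (hb : IsBlowup X Y Z p) {y : Y} (hy : p y ∈ Z)
    {φ : OpenPartialHomeomorph X (EuclideanSpace ℝ (Fin d))}
    (hφ : φ ∈ IsManifold.maximalAtlas (𝓡 d) ∞ X) (hyφ : p y ∈ φ.source) {A : Finset (Fin d)}
    (hA : ∀ x ∈ φ.source, x ∈ Z ↔ ∀ i ∈ A, φ x i = 0) :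
    ∃ j ∈ A, ∃ ψ ∈ IsManifold.maximalAtlas (𝓡 d) ∞ Y, y ∈ ψ.source ∧
      ∀ y' ∈ ψ.source, p y' ∈ φ.source ∧ φ (p y') = blowdownChart A j (ψ y') := by
  obtain ⟨φ₀, hφ₀, hyφ₀, A₀, -, hA₀, ψ₀, hψ₀, hcov⟩ := hb.localModel (p y) hy
  have := hcov hyφ₀
  simp only [mem_iUnion] at this
  obtain ⟨k, hk, hyk⟩ := this
  obtain ⟨hψk, -, hψp⟩ := hψ₀ k hk
  have hyβ := (hψp y hyk).2
  have hz : ∀ x ∈ (φ₀.symm.trans φ).source,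
      (∀ i ∈ A₀, x i = 0) ↔ ∀ i ∈ A, (φ₀.symm.trans φ) x i = 0 := by
    rintro x ⟨hx, hx'⟩
    have h1 := hA₀ _ (φ₀.map_target hx)
    rw [φ₀.right_inv hx] at h1
    rw [← h1]
    exact hA _ hx'
  have hs' : ContDiffOn ℝ ∞ (φ₀.symm.trans φ).symm (φ₀.symm.trans φ).target := by
    have := contDiffOn_transition hφ hφ₀
    rw [OpenPartialHomeomorph.trans_symm_eq_symm_trans_symm, OpenPartialHomeomorph.symm_symm]
    have ht : (φ₀.symm.trans φ).target = (φ.symm.trans φ₀).source := by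
      rw [← OpenPartialHomeomorph.symm_source,
        OpenPartialHomeomorph.trans_symm_eq_symm_trans_symm, OpenPartialHomeomorph.symm_symm]
    rw [ht]
    exact this
  have hsrc : blowdownChart A₀ k (ψ₀ k y) ∈ (φ₀.symm.trans φ).source := by
    rw [← hyβ]
    refine ⟨φ₀.map_source hyφ₀, ?_⟩
    change φ₀.symm (φ₀ (p y)) ∈ φ.source
    rw [φ₀.left_inv hyφ₀]
    exact hyφ
  have h0 : ψ₀ k y k = 0 := by
    rw [← blowdownChart_eq_zero_iff hk, ← hyβ]
    exact (hA₀ _ hyφ₀).1 hy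
  obtain ⟨j, hj, e, he, heβ, hes, hes'⟩ := exists_blowup_lift hk (φ₀.symm.trans φ)
    (contDiffOn_transition hφ₀ hφ) hs' hz hsrc h0
  refine ⟨j, hj, (ψ₀ k).trans e, trans_mem_maximalAtlas hψk hes hes', ⟨hyk, he⟩, ?_⟩
  rintro y' ⟨hy', hye⟩
  replace hye : ψ₀ k y' ∈ e.source := hye
  obtain ⟨h1, h2⟩ := heβ _ hye
  obtain ⟨h3, h4⟩ := hψp y' hy'
  rw [← h4] at h1 h2
  have h5 : φ₀.symm (φ₀ (p y')) ∈ φ.source := h1.2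
  rw [φ₀.left_inv h3] at h5
  refine ⟨h5, ?_⟩
  change _ = blowdownChart A j (e (ψ₀ k y'))
  rw [h2]
  change φ (p y') = φ (φ₀.symm (φ₀ (p y')))
  rw [φ₀.left_inv h3]

/-- Away from the center any chart of the base is pulled back to a chart of the blowup. -/
theorem exists_chart_off_center (hb : IsBlowup X Y Z p) {y : Y} (hy : p y ∉ Z)
    {φ : OpenPartialHomeomorph X (EuclideanSpace ℝ (Fin d))}
    (hφ : φ ∈ IsManifold.maximalAtlas (𝓡 d) ∞ X) (hyφ : p y ∈ φ.source) :
    ∃ ψ ∈ IsManifold.maximalAtlas (𝓡 d) ∞ Y, y ∈ ψ.source ∧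
      ∀ y' ∈ ψ.source, p y' ∈ φ.source ∧ p y' ∉ Z ∧ φ (p y') = ψ y' := by
  obtain ⟨Φ, hyΦ, hΦ⟩ := hb.localDiffeo y hy
  have hU : IsOpen (p ⁻¹' Zᶜ) := hb.isClosed_center.isOpen_compl.preimage hb.smooth.continuous
  refine ⟨(Φ.toOpenPartialHomeomorph.trans φ).restr (p ⁻¹' Zᶜ), ?_, ?_, ?_⟩
  · refine restr_mem_maximalAtlas _ ?_ hU
    rw [IsManifold.mem_maximalAtlas_iff_contMDiffOn] at hφ
    refine (IsManifold.mem_maximalAtlas_iff_contMDiffOn (I := 𝓡 d) (n := ∞) _).2 ⟨?_, ?_⟩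
    · refine hφ.1.comp (Φ.contMDiffOn_toFun.mono ?_) ?_
      · intro x hx; exact hx.1
      · intro x hx; exact hx.2
    · refine Φ.contMDiffOn_invFun.comp (hφ.2.mono ?_) ?_
      · intro x hx; exact hx.1
      · intro x hx; exact hx.2
  · rw [OpenPartialHomeomorph.restr_source, hU.interior_eq]
    refine ⟨⟨hyΦ, ?_⟩, hy⟩
    change Φ y ∈ φ.source
    rw [← hΦ hyΦ]; exact hyφ
  · intro y' hy'
    rw [OpenPartialHomeomorph.restr_source, hU.interior_eq] at hy'
    obtain ⟨⟨h1, h2⟩, h3⟩ := hy'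
    change Φ y' ∈ φ.source at h2
    have h4 : p y' = Φ y' := hΦ h1
    refine ⟨by rw [h4]; exact h2, h3, ?_⟩
    rw [h4]; rfl

lemma eq_of_map_eq (hb : IsBlowup X Y Z p) {y y' : Y} (hy : p y ∉ Z) (h : p y = p y') : y = y' :=
  hb.bijOn.injOn hy (by change p y' ∉ Z; rw [← h]; exact hy) h

lemma map_nhds_eq (hb : IsBlowup X Y Z p) {y : Y} (hy : p y ∉ Z) :
    Filter.map p (𝓝 y) = 𝓝 (p y) := by
  obtain ⟨Φ, hyΦ, hΦ⟩ := hb.localDiffeo y hy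
  have h1 := Φ.toOpenPartialHomeomorph.map_nhds_eq hyΦ
  have h2 : p =ᶠ[𝓝 y] Φ := Filter.eventuallyEq_of_mem (Φ.open_source.mem_nhds hyΦ) hΦ
  rw [Filter.map_congr h2, hΦ hyΦ]
  exact h1

/-- The coordinate curves transversal to the exceptional divisor in a standard chart. -/
lemma tendsto_chart_curve {M : Type*} [TopologicalSpace M]
    (ψ : OpenPartialHomeomorph M (EuclideanSpace ℝ (Fin d))) {y : M} (hy : y ∈ ψ.source)
    (w : EuclideanSpace ℝ (Fin d)) :
    Filter.Tendsto (fun ε : ℝ => ψ.symm (ψ y + ε • w)) (𝓝 0) (𝓝 y) ∧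
      ∀ᶠ ε : ℝ in 𝓝 0, ψ y + ε • w ∈ ψ.target := by
  have hc : Filter.Tendsto (fun ε : ℝ => ψ y + ε • w) (𝓝 0) (𝓝 (ψ y)) := by
    have : Continuous (fun ε : ℝ => ψ y + ε • w) := by fun_prop
    simpa using this.tendsto 0
  refine ⟨?_, hc.eventually (ψ.open_target.mem_nhds (ψ.map_source hy))⟩
  have := (ψ.continuousAt_symm (ψ.map_source hy)).tendsto.comp hc
  rwa [ψ.left_inv hy] at this

/-- The exceptional divisor has empty interior, by the curves transversal to it. -/
theorem dense_preimage_compl_center (hb : IsBlowup X Y Z p) : Dense (p ⁻¹' Zᶜ) := by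
  intro y
  by_cases hy : p y ∈ Z
  · obtain ⟨φ, hφ, hyφ, A, -, hA, ψ, hψ, hcov⟩ := hb.localModel (p y) hy
    have := hcov hyφ
    simp only [mem_iUnion] at this
    obtain ⟨k, hk, hyk⟩ := this
    obtain ⟨-, -, hψp⟩ := hψ k hk
    have h0 : ψ k y k = 0 := by
      rw [← blowdownChart_eq_zero_iff hk, ← (hψp y hyk).2]
      exact (hA _ hyφ).1 hy
    obtain ⟨h1, h2⟩ := tendsto_chart_curve (ψ k) hyk (EuclideanSpace.single k 1)
    have h1' := h1.mono_left (nhdsWithin_le_nhds (s := {(0 : ℝ)}ᶜ))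
    refine mem_closure_of_tendsto h1' ?_
    filter_upwards [h2.filter_mono nhdsWithin_le_nhds, self_mem_nhdsWithin] with ε hε hε0
    obtain ⟨h3, h4⟩ := hψp _ ((ψ k).map_target hε)
    change p _ ∉ Z
    rw [hA _ h3, h4, (ψ k).right_inv hε, blowdownChart_eq_zero_iff hk]
    simpa [h0] using hε0
  · exact subset_closure hy

theorem dense_preimage (hb : IsBlowup X Y Z p) {D : Set X} (hD : Dense D) : Dense (p ⁻¹' D) := by
  rw [dense_iff_inter_open]
  intro O hO hne
  obtain ⟨y, hyO, hy⟩ := hb.dense_preimage_compl_center.inter_open_nonempty O hO hne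
  have h1 : p '' O ∈ 𝓝 (p y) := by
    rw [← hb.map_nhds_eq hy]
    exact Filter.image_mem_map (hO.mem_nhds hyO)
  obtain ⟨_, hy', ⟨y', hy'O, rfl⟩⟩ := hD.inter_nhds_nonempty h1
  exact ⟨y', hy'O, hy'⟩

/-- In a standard chart, the ratios of coordinates being bounded by `1`, the preimage of a ball is
bounded: the coordinates other than the ratios are coordinates of the image. -/
lemma isCompact_blowdownChart_preimage (A : Finset (Fin d)) (j : Fin d)
    (x : EuclideanSpace ℝ (Fin d)) (ε : ℝ) :
    IsCompact {t | blowdownChart A j t ∈ Metric.closedBall x ε ∧ ∀ i ∈ A, i ≠ j → |t i| ≤ 1} := by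
  have hclosed : IsClosed
      {t | blowdownChart A j t ∈ Metric.closedBall x ε ∧ ∀ i ∈ A, i ≠ j → |t i| ≤ 1} := by
    have h1 : IsClosed {t | blowdownChart A j t ∈ Metric.closedBall x ε} :=
      Metric.isClosed_closedBall.preimage (contDiff_blowdownChart A j).continuous
    have h2 : IsClosed {t : EuclideanSpace ℝ (Fin d) | ∀ i ∈ A, i ≠ j → |t i| ≤ 1} := by
      simp only [ofPred_forall]
      refine isClosed_iInter fun i => isClosed_iInter fun _ => isClosed_iInter fun _ => ?_
      exact isClosed_le (by fun_prop) continuous_const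
    exact h1.inter h2
  refine Metric.isCompact_of_isClosed_isBounded hclosed ?_
  rw [Metric.isBounded_iff_subset_closedBall 0]
  refine ⟨∑ _i : Fin d, (1 + ‖x‖ + |ε|), fun t ht => ?_⟩
  rw [mem_closedBall_zero_iff]
  have hR : ∀ i, ‖t i‖ ≤ 1 + ‖x‖ + |ε| := by
    intro i
    have hx : 0 ≤ ‖x‖ := norm_nonneg _
    by_cases hi : i ∈ A ∧ i ≠ j
    · have h1 := ht.2 i hi.1 hi.2
      have h2 : 0 ≤ |ε| := abs_nonneg _
      rw [Real.norm_eq_abs]; linarith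
    · have h1 : blowdownChart A j t i = t i := by rw [blowdownChart_apply, if_neg hi]
      have h3 : ‖blowdownChart A j t - x‖ ≤ ε := by
        rw [← dist_eq_norm]; exact ht.1
      have h4 := norm_le_norm_add_norm_sub' (blowdownChart A j t) x
      have h5 := PiLp.norm_apply_le (blowdownChart A j t) i
      have h6 := le_abs_self ε
      rw [h1] at h5
      linarith
  have h1 : t = ∑ i, EuclideanSpace.single i (t i) := by
    ext k
    simp [Finset.sum_apply, Pi.single_apply]
  calc ‖t‖ = ‖∑ i, EuclideanSpace.single i (t i)‖ := by rw [← h1]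
    _ ≤ ∑ i, ‖EuclideanSpace.single i (t i)‖ := norm_sum_le _ _
    _ ≤ _ := Finset.sum_le_sum fun i _ => by rw [PiLp.norm_single]; exact hR i

/-- Over a point of the center, the part of the standard charts where the ratios of coordinates are
at most `1` is compact, and it already covers a neighbourhood of the fibre. -/
lemma exists_compact_over_center (hb : IsBlowup X Y Z p) {x : X} (hx : x ∈ Z) :
    ∃ N ∈ 𝓝 x, ∃ K : Set Y, IsCompact K ∧ p ⁻¹' N ⊆ K := by
  obtain ⟨φ, hφ, hxφ, A, hAne, hA, ψ, hψ, hcov⟩ := hb.localModel x hx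
  obtain ⟨ε, hε, hball⟩ := Metric.nhds_basis_closedBall.mem_iff.1
    (φ.open_target.mem_nhds (φ.map_source hxφ))
  set B := Metric.closedBall (φ x) ε with hB
  let C : Fin d → Set (EuclideanSpace ℝ (Fin d)) := fun j =>
    {t | blowdownChart A j t ∈ B ∧ ∀ i ∈ A, i ≠ j → |t i| ≤ 1}
  have hCc : ∀ j, IsCompact (C j) := fun j => isCompact_blowdownChart_preimage A j (φ x) ε
  have hCt : ∀ j ∈ A, C j ⊆ (ψ j).target := by
    intro j hj t ht
    rw [(hψ j hj).2.1]
    exact hball ht.1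
  let K : Set Y := ⋃ j ∈ A, (ψ j).symm '' C j
  have hK : IsCompact K := by
    refine A.isCompact_biUnion fun j hj => ?_
    exact (hCc j).image_of_continuousOn ((ψ j).continuousOn_symm.mono (hCt j hj))
  let N : Set X := φ.source ∩ φ ⁻¹' Metric.ball (φ x) ε
  have hNo : IsOpen N := φ.continuousOn.isOpen_inter_preimage φ.open_source Metric.isOpen_ball
  refine ⟨N, hNo.mem_nhds ⟨hxφ, Metric.mem_ball_self hε⟩, K, hK, ?_⟩
  have hsub : p ⁻¹' N ∩ p ⁻¹' Zᶜ ⊆ K := by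
    rintro y ⟨⟨hyφ, hyB⟩, hyZ⟩
    have hyZ' : ¬ ∀ i ∈ A, φ (p y) i = 0 := fun h => hyZ ((hA _ hyφ).2 h)
    -- dividing by the coordinate of largest absolute value makes all ratios at most `1`
    obtain ⟨j, hj, hmax⟩ := A.exists_max_image (fun i => |φ (p y) i|) hAne
    set τ := φ (p y) with hτ
    have hτj : τ j ≠ 0 := by
      intro h0
      refine hyZ' fun i hi => ?_
      have := hmax i hi
      rw [h0, abs_zero] at this
      exact abs_nonpos_iff.1 this
    let t : EuclideanSpace ℝ (Fin d) :=
      WithLp.toLp 2 fun i => if i ∈ A ∧ i ≠ j then τ i / τ j else τ i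
    have ht : ∀ i, t i = if i ∈ A ∧ i ≠ j then τ i / τ j else τ i := fun _ => rfl
    have hβ : blowdownChart A j t = τ := by
      ext i
      rw [blowdownChart_apply]
      split_ifs with hi
      · rw [ht, ht, if_neg (by simp), if_pos hi]
        field_simp
      · rw [ht, if_neg hi]
    have htC : t ∈ C j := by
      refine ⟨by rw [hβ]; exact Metric.ball_subset_closedBall hyB, fun i hi hij => ?_⟩
      rw [ht, if_pos ⟨hi, hij⟩, abs_div]
      exact div_le_one_of_le₀ (hmax i hi) (abs_nonneg _)
    have hy' : y = (ψ j).symm t := by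
      obtain ⟨h1, h2⟩ := (hψ j hj).2.2 _ ((ψ j).map_target (hCt j hj htC))
      refine hb.eq_of_map_eq hyZ (φ.injOn hyφ h1 ?_)
      rw [h2, (ψ j).right_inv (hCt j hj htC), hβ]
    simp only [K, mem_iUnion]
    exact ⟨j, hj, t, htC, hy'.symm⟩
  have h1 := hb.dense_preimage_compl_center.open_subset_closure_inter
    (hNo.preimage hb.smooth.continuous)
  exact h1.trans (closure_minimal hsub hK.isClosed)

/-- A blowup of a compact manifold is compact: it is covered by the preimages of finitely many
neighbourhoods, each of them contained in a compact set. -/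
theorem compactSpace [CompactSpace X] (hb : IsBlowup X Y Z p) : CompactSpace Y := by
  have key : ∀ x : X, ∃ N ∈ 𝓝 x, ∃ K : Set Y, IsCompact K ∧ p ⁻¹' N ⊆ K := by
    intro x
    by_cases hx : x ∈ Z
    · exact hb.exists_compact_over_center hx
    · obtain ⟨y, hyZ, rfl⟩ := hb.bijOn.surjOn hx
      have hU : IsOpen (p ⁻¹' Zᶜ) := hb.isClosed_center.isOpen_compl.preimage hb.smooth.continuous
      have : LocallyCompactSpace Y := ChartedSpace.locallyCompactSpace (EuclideanSpace ℝ (Fin d)) Y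
      obtain ⟨K, hKy, hKU, hK⟩ := LocallyCompactSpace.local_compact_nhds y _ (hU.mem_nhds hyZ)
      refine ⟨p '' K, ?_, K, hK, ?_⟩
      · rw [← hb.map_nhds_eq hyZ]
        exact Filter.image_mem_map hKy
      · rintro y' ⟨k, hk, hky⟩
        rw [← hb.eq_of_map_eq (hKU hk) hky]
        exact hk
  choose N hN K hK hNK using key
  obtain ⟨s, -, hs⟩ := isCompact_univ.elim_nhds_subcover N (fun x _ => hN x)
  refine ⟨?_⟩
  have : (univ : Set Y) = ⋃ x ∈ s, K x := by
    refine (eq_univ_of_forall fun y => ?_).symm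
    have := hs (mem_univ (p y))
    simp only [mem_iUnion] at this ⊢
    obtain ⟨x, hx, hxy⟩ := this
    exact ⟨x, hx, hNK x hxy⟩
  rw [this]
  exact s.isCompact_biUnion fun x _ => hK x

end IsBlowup

end Blowup

/-! ### Lines modulo a subspace and the intersection lattice -/

section Lattice

lemma sInf_mem_intersectionLattice {V : Type*} [AddCommGroup V] [Module ℝ V]
    {𝒜 S : Set (Submodule ℝ V)} (hS : S ⊆ intersectionLattice 𝒜) :
    sInf S ∈ intersectionLattice 𝒜 := by
  refine ⟨{B | B ∈ 𝒜 ∧ sInf S ≤ B}, fun B hB => hB.1, le_antisymm ?_ ?_⟩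
  · exact le_sInf fun B hB => hB.2
  · refine le_sInf fun U hU => ?_
    obtain ⟨ℬ, hℬ, rfl⟩ := hS hU
    refine le_sInf fun B hB => sInf_le ⟨hℬ hB, (sInf_le hU).trans (sInf_le hB)⟩

/-- The smallest element of the intersection lattice that contains `W` and `x`. -/
def latticeHull {V : Type*} [AddCommGroup V] [Module ℝ V] (𝒜 : Set (Submodule ℝ V))
    (W : Submodule ℝ V) (x : V) : Submodule ℝ V :=
  sInf {U | U ∈ intersectionLattice 𝒜 ∧ W ≤ U ∧ x ∈ U}

section Hull

variable {V : Type*} [AddCommGroup V] [Module ℝ V] {𝒜 : Set (Submodule ℝ V)}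
  {W : Submodule ℝ V} {x : V}

lemma latticeHull_mem : latticeHull 𝒜 W x ∈ intersectionLattice 𝒜 :=
  sInf_mem_intersectionLattice fun _ h => h.1

lemma le_latticeHull : W ≤ latticeHull 𝒜 W x := le_sInf fun _ h => h.2.1

lemma mem_latticeHull : x ∈ latticeHull 𝒜 W x := by
  rw [latticeHull, Submodule.mem_sInf]
  exact fun _ h => h.2.2

lemma latticeHull_le {U : Submodule ℝ V} (hU : U ∈ intersectionLattice 𝒜) (hWU : W ≤ U)
    (hx : x ∈ U) : latticeHull 𝒜 W x ≤ U := sInf_le ⟨hU, hWU, hx⟩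

end Hull

variable {m : ℕ}

lemma mem_projSet_mk {U : Submodule ℝ (Fin (m + 1) → ℝ)} {v : Fin (m + 1) → ℝ} (hv : v ≠ 0) :
    Projectivization.mk ℝ v hv ∈ projSet U ↔ v ∈ U := by
  change (Projectivization.mk ℝ v hv).submodule ≤ U ↔ _
  rw [Projectivization.submodule_mk, Submodule.span_singleton_le_iff_mem]

lemma projSet_subset_iff {U U' : Submodule ℝ (Fin (m + 1) → ℝ)} :
    projSet U ⊆ projSet U' ↔ U ≤ U' := by
  constructor
  · intro h v hv
    by_cases h0 : v = 0
    · rw [h0]; exact zero_mem _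
    · exact (mem_projSet_mk h0).1 (h ((mem_projSet_mk h0).2 hv))
  · intro h l hl
    exact le_trans hl h

lemma projSet_injective : Function.Injective (projSet (m := m)) := fun _ _ h =>
  le_antisymm (projSet_subset_iff.1 h.subset) (projSet_subset_iff.1 h.superset)

lemma projSet_ssubset_iff {U U' : Submodule ℝ (Fin (m + 1) → ℝ)} :
    projSet U ⊂ projSet U' ↔ U < U' := by
  rw [ssubset_iff_subset_not_subset, projSet_subset_iff, projSet_subset_iff, lt_iff_le_not_ge]

lemma projSet_top : projSet (⊤ : Submodule ℝ (Fin (m + 1) → ℝ)) = univ :=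
  eq_univ_of_forall fun l => (le_top : l.submodule ≤ ⊤)

/-- Modulo `U`, the line `l` and the vector `x` span the same subspace. -/
def SameLineMod (U : Submodule ℝ (Fin (m + 1) → ℝ)) (x : Fin (m + 1) → ℝ) (l : RP m) : Prop :=
  U ⊔ l.submodule = U ⊔ Submodule.span ℝ {x}

namespace SameLineMod

variable {U U' : Submodule ℝ (Fin (m + 1) → ℝ)} {x x' : Fin (m + 1) → ℝ} {l : RP m}

lemma mono (h : SameLineMod U x l) (hU : U ≤ U') : SameLineMod U' x l := by
  unfold SameLineMod at *
  rw [← sup_eq_right.2 hU, sup_comm U U', sup_assoc, sup_assoc, h]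

lemma mem_projSet_iff (h : SameLineMod U x l) : l ∈ projSet U ↔ x ∈ U := by
  change l.submodule ≤ U ↔ _
  rw [← Submodule.span_singleton_le_iff_mem, ← sup_eq_left (b := Submodule.span ℝ {x}), ← h,
    sup_eq_left]

lemma of_smul {c : ℝ} (hc : c ≠ 0) (h : SameLineMod U (c • x) l) : SameLineMod U x l := by
  unfold SameLineMod at *
  rw [h, Submodule.span_singleton_smul_eq (IsUnit.mk0 c hc)]

lemma congr (h : SameLineMod U x l) (hx : x - x' ∈ U) : SameLineMod U x' l := by
  unfold SameLineMod at *
  rw [h]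
  have key : ∀ y y' : Fin (m + 1) → ℝ, y - y' ∈ U →
      U ⊔ Submodule.span ℝ {y} ≤ U ⊔ Submodule.span ℝ {y'} := by
    intro y y' hy
    refine sup_le le_sup_left ?_
    rw [Submodule.span_singleton_le_iff_mem, Submodule.mem_sup]
    exact ⟨y - y', hy, y', Submodule.mem_span_singleton_self _, by simp⟩
  exact le_antisymm (key _ _ hx) (key _ _ (by rw [← neg_sub]; exact neg_mem hx))

lemma of_submodule_eq (h : l.submodule = Submodule.span ℝ {x}) : SameLineMod U x l := by
  rw [SameLineMod, h]

end SameLineMod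

/-- The vectors `c i`, `i ∈ A`, are a basis of a complement of `W`. -/
structure IsFrame (W : Submodule ℝ (Fin (m + 1) → ℝ)) (A : Finset (Fin m))
    (c : Fin m → Fin (m + 1) → ℝ) : Prop where
  span : W ⊔ Submodule.span ℝ (c '' A) = ⊤
  indep : ∀ a : Fin m → ℝ, ∑ i ∈ A, a i • c i ∈ W → ∀ i ∈ A, a i = 0

lemma exists_coeff_of_span {W : Submodule ℝ (Fin (m + 1) → ℝ)} {A : Finset (Fin m)}
    {c : Fin m → Fin (m + 1) → ℝ} {x : Fin (m + 1) → ℝ}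
    (h : x ∈ W ⊔ Submodule.span ℝ (c '' A)) : ∃ a : Fin m → ℝ, x - ∑ i ∈ A, a i • c i ∈ W := by
  obtain ⟨w, hw, u, hu, rfl⟩ := Submodule.mem_sup.1 h
  obtain ⟨a, ha⟩ := (Submodule.mem_span_image_finset_iff_exists_fun (R := ℝ)).1 hu
  refine ⟨fun i => if hi : i ∈ A then a ⟨i, hi⟩ else 0, ?_⟩
  have : ∑ i ∈ A, (if hi : i ∈ A then a ⟨i, hi⟩ else 0) • c i = u := by
    rw [← ha, ← Finset.sum_coe_sort A]
    exact Finset.sum_congr rfl fun i _ => by simp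
  rw [this]
  simpa using hw

lemma IsFrame.sum_mem_iff {W : Submodule ℝ (Fin (m + 1) → ℝ)} {A : Finset (Fin m)}
    {c : Fin m → Fin (m + 1) → ℝ} (h : IsFrame W A c) (a : Fin m → ℝ) :
    ∑ i ∈ A, a i • c i ∈ W ↔ ∀ i ∈ A, a i = 0 :=
  ⟨h.indep a, fun h0 => by
    rw [Finset.sum_eq_zero fun i hi => by rw [h0 i hi, zero_smul]]; exact zero_mem _⟩

/-- The coordinates of `V / W` dual to a frame. -/
lemma IsFrame.exists_dual {W : Submodule ℝ (Fin (m + 1) → ℝ)} {A : Finset (Fin m)}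
    {c : Fin m → Fin (m + 1) → ℝ} (h : IsFrame W A c) :
    ∃ f : Fin m → (Fin (m + 1) → ℝ) →ₗ[ℝ] ℝ, (∀ x, x - ∑ i ∈ A, f i x • c i ∈ W) ∧
      ∀ a : Fin m → ℝ, ∀ w ∈ W, ∀ i ∈ A, f i (w + ∑ k ∈ A, a k • c k) = a i := by
  have hex : ∀ x, ∃ a : Fin m → ℝ, x - ∑ i ∈ A, a i • c i ∈ W := fun x =>
    exists_coeff_of_span (h.span ▸ Submodule.mem_top)
  choose a ha using hex
  have huniq : ∀ x (b : Fin m → ℝ), x - ∑ i ∈ A, b i • c i ∈ W → ∀ i ∈ A, a x i = b i := by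
    intro x b hb i hi
    have := W.sub_mem hb (ha x)
    rw [sub_sub_sub_cancel_left, ← Finset.sum_sub_distrib] at this
    simp only [← sub_smul] at this
    exact sub_eq_zero.1 (h.indep (fun i => a x i - b i) this i hi)
  let f : Fin m → (Fin (m + 1) → ℝ) →ₗ[ℝ] ℝ := fun i =>
    { toFun := fun x => if i ∈ A then a x i else 0
      map_add' := fun x y => by
        split_ifs with hi
        · refine huniq _ (fun i => a x i + a y i) ?_ i hi
          simp only [add_smul, Finset.sum_add_distrib]
          convert W.add_mem (ha x) (ha y) using 1
          abel
        · simp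
      map_smul' := fun r x => by
        split_ifs with hi
        · refine huniq _ (fun i => r * a x i) ?_ i hi
          simp only [mul_smul, ← Finset.smul_sum, ← smul_sub]
          exact W.smul_mem r (ha x)
        · simp }
  have hf : ∀ i ∈ A, ∀ x, f i x = a x i := fun i hi x => by simp [f, hi]
  refine ⟨f, fun x => ?_, fun b w hw i hi => ?_⟩
  · rw [Finset.sum_congr rfl fun i hi => by rw [hf i hi x]]
    exact ha x
  · rw [hf i hi]
    exact huniq _ b (by simpa using hw) i hi

/-- A family that spans `V / W` contains a basis of it. -/
lemma exists_isFrame {W : Submodule ℝ (Fin (m + 1) → ℝ)} {B : Finset (Fin m)}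
    {c : Fin m → Fin (m + 1) → ℝ} (h : W ⊔ Submodule.span ℝ (c '' B) = ⊤) :
    ∃ A ⊆ B, IsFrame W A c := by
  obtain ⟨b, hbB, -, hspan, hli⟩ := exists_linearIndepOn_extension
    (K := ℝ) (v := fun i => W.mkQ (c i)) (s := ∅) (t := (B : Set (Fin m)))
    (linearIndepOn_empty _ _) (empty_subset _)
  classical
  have hfin : b.Finite := B.finite_toSet.subset hbB
  refine ⟨hfin.toFinset, fun i hi => by simpa using hbB (hfin.mem_toFinset.1 hi), ?_, ?_⟩
  · rw [eq_top_iff, ← h]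
    refine sup_le le_sup_left ?_
    rw [Submodule.span_le]
    rintro _ ⟨i, hi, rfl⟩
    have h1 : W.mkQ (c i) ∈ Submodule.span ℝ (W.mkQ '' (c '' b)) := by
      rw [← image_comp]; exact hspan ⟨i, hi, rfl⟩
    rw [← Submodule.map_span] at h1
    obtain ⟨u, hu, hue⟩ := h1
    have h2 : c i - u ∈ W := by
      rw [← Submodule.Quotient.mk_eq_zero, ← Submodule.mkQ_apply, map_sub, hue, sub_self]
    rw [SetLike.mem_coe, Submodule.mem_sup]
    exact ⟨c i - u, h2, u, by simpa using hu, by simp⟩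
  · intro a ha i hi
    rw [← Submodule.Quotient.mk_eq_zero, ← Submodule.mkQ_apply, map_sum] at ha
    simp only [map_smul] at ha
    rw [linearIndepOn_iff'] at hli
    exact hli hfin.toFinset a (by simp) ha i hi

end Lattice

/-! ### Adapted charts -/

section Adapted

variable {m : ℕ}

/-- A shear that changes only the coordinates in `A`, by functions of the other coordinates. -/
lemma exists_shear (A : Finset (Fin m)) (g : EuclideanSpace ℝ (Fin m) → Fin m → ℝ)
    (hg : ∀ i, ContDiff ℝ ∞ (fun t => g t i))
    (hgA : ∀ t t' : EuclideanSpace ℝ (Fin m), (∀ i ∉ A, t i = t' i) → g t = g t') :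
    ∃ e : OpenPartialHomeomorph (EuclideanSpace ℝ (Fin m)) (EuclideanSpace ℝ (Fin m)),
      e.source = univ ∧ (∀ t i, e t i = if i ∈ A then t i + g t i else t i) ∧
      ContDiffOn ℝ ∞ e e.source ∧ ContDiffOn ℝ ∞ e.symm e.target := by
  let F : EuclideanSpace ℝ (Fin m) → EuclideanSpace ℝ (Fin m) := fun t =>
    WithLp.toLp 2 fun i => if i ∈ A then t i + g t i else t i
  let F' : EuclideanSpace ℝ (Fin m) → EuclideanSpace ℝ (Fin m) := fun t =>
    WithLp.toLp 2 fun i => if i ∈ A then t i - g t i else t i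
  have hF : ContDiff ℝ ∞ F := by
    rw [contDiff_euclidean]
    intro i
    by_cases hi : i ∈ A
    · simp only [F, hi, if_true]
      exact ContDiff.add (by fun_prop) (hg i)
    · simp only [F, hi, if_false]
      fun_prop
  have hF' : ContDiff ℝ ∞ F' := by
    rw [contDiff_euclidean]
    intro i
    by_cases hi : i ∈ A
    · simp only [F', hi, if_true]
      exact ContDiff.sub (by fun_prop) (hg i)
    · simp only [F', hi, if_false]
      fun_prop
  have hgF : ∀ t, g (F t) = g t := fun t => hgA _ _ fun i hi => by simp [F, hi]
  have hgF' : ∀ t, g (F' t) = g t := fun t => hgA _ _ fun i hi => by simp [F', hi]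
  let e : Homeomorph (EuclideanSpace ℝ (Fin m)) (EuclideanSpace ℝ (Fin m)) :=
    { toFun := F
      invFun := F'
      left_inv := fun t => by
        ext i
        by_cases hi : i ∈ A
        · change (if i ∈ A then F t i - g (F t) i else F t i) = t i
          rw [hgF]; simp [F, hi]
        · simp [F, F', hi]
      right_inv := fun t => by
        ext i
        by_cases hi : i ∈ A
        · change (if i ∈ A then F' t i + g (F' t) i else F' t i) = t i
          rw [hgF']; simp [F', hi]
        · simp [F, F', hi]
      continuous_toFun := hF.continuous
      continuous_invFun := hF'.continuous }
  exact ⟨e.toOpenPartialHomeomorph, rfl, fun t i => rfl, hF.contDiffOn, hF'.contDiffOn⟩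

/-- An affine function of the coordinates in `B` with values in `V / W` that vanishes at `y` and is
submersive becomes linear, with basis coefficients, after a change of the coordinates in a
subset `A` of `B`. -/
theorem exists_adapted_chart {M : Type*} [TopologicalSpace M]
    [ChartedSpace (EuclideanSpace ℝ (Fin m)) M] [IsManifold (𝓡 m) ∞ M]
    {φ : OpenPartialHomeomorph M (EuclideanSpace ℝ (Fin m))}
    (hφ : φ ∈ IsManifold.maximalAtlas (𝓡 m) ∞ M) (y : M)
    {W : Submodule ℝ (Fin (m + 1) → ℝ)} {B : Finset (Fin m)} {x : Fin m → Fin (m + 1) → ℝ}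
    (hB : W ⊔ Submodule.span ℝ (x '' B) = ⊤) (a : Fin (m + 1) → ℝ)
    (hy : a + ∑ i ∈ B, φ y i • x i ∈ W) :
    ∃ A ⊆ B, IsFrame W A x ∧ ∃ ψ ∈ IsManifold.maximalAtlas (𝓡 m) ∞ M, ψ.source = φ.source ∧
      (∀ i ∈ A, ψ y i = 0) ∧ (∀ z, ∀ i ∉ A, ψ z i = φ z i) ∧
      ∀ z, (a + ∑ i ∈ B, φ z i • x i) - ∑ i ∈ A, ψ z i • x i ∈ W := by
  classical
  obtain ⟨A, hAB, hA⟩ := exists_isFrame hB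
  have hex : ∀ k, ∃ b : Fin m → ℝ, x k - ∑ i ∈ A, b i • x i ∈ W := fun k =>
    exists_coeff_of_span (hA.span ▸ Submodule.mem_top)
  choose L hL using hex
  -- express the vectors outside `A` by those in `A`; the shear absorbs them into the coordinates in
  -- `A`, which are also shifted to vanish at `y`
  let g : EuclideanSpace ℝ (Fin m) → Fin m → ℝ := fun t i =>
    - φ y i + ∑ k ∈ B \ A, (t k - φ y k) * L k i
  obtain ⟨e, hes, he, hse, hse'⟩ := exists_shear A g (fun i => by simp only [g]; fun_prop)
    (fun t t' h => by
      ext i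
      simp only [g]
      congr 1
      refine Finset.sum_congr rfl fun k hk => ?_
      rw [h k (Finset.mem_sdiff.1 hk).2])
  have hψ : ∀ z i, (φ.trans e) z i = if i ∈ A then φ z i + g (φ z) i else φ z i :=
    fun z i => he (φ z) i
  refine ⟨A, hAB, hA, φ.trans e, trans_mem_maximalAtlas hφ hse hse', ?_, ?_, ?_, ?_⟩
  · rw [OpenPartialHomeomorph.trans_source, hes]; simp
  · intro i hi
    rw [hψ, if_pos hi]
    simp [g]
  · intro z i hi
    rw [hψ, if_neg hi]
  · intro z
    rw [← Submodule.Quotient.mk_eq_zero, ← Submodule.mkQ_apply] at hy ⊢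
    have hL' : ∀ k, W.mkQ (x k) = ∑ i ∈ A, L k i • W.mkQ (x i) := by
      intro k
      have := hL k
      rw [← Submodule.Quotient.mk_eq_zero, ← Submodule.mkQ_apply, map_sub, sub_eq_zero,
        map_sum] at this
      simpa using this
    simp only [map_sub, map_add, map_sum, map_smul] at hy ⊢
    have h1 : ∑ i ∈ A, (φ.trans e) z i • W.mkQ (x i) =
        ∑ i ∈ A, (φ z i - φ y i) • W.mkQ (x i) +
          ∑ k ∈ B \ A, (φ z k - φ y k) • W.mkQ (x k) := by
      have h2 : ∑ k ∈ B \ A, (φ z k - φ y k) • W.mkQ (x k) =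
          ∑ i ∈ A, (∑ k ∈ B \ A, (φ z k - φ y k) * L k i) • W.mkQ (x i) := by
        simp only [Finset.sum_smul]
        rw [Finset.sum_comm]
        refine Finset.sum_congr rfl fun k _ => ?_
        rw [hL' k, Finset.smul_sum]
        simp only [mul_smul]
      rw [h2, ← Finset.sum_add_distrib]
      refine Finset.sum_congr rfl fun i hi => ?_
      rw [← add_smul, hψ, if_pos hi]
      congr 1
      simp only [g]
      ring
    have h3 : ∀ f : Fin m → ℝ, ∑ i ∈ B, f i • W.mkQ (x i) =
        ∑ i ∈ A, f i • W.mkQ (x i) + ∑ i ∈ B \ A, f i • W.mkQ (x i) := by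
      intro f
      exact (Finset.sum_sdiff hAB).symm.trans (add_comm _ _)
    rw [h1, ← h3 (fun i => φ z i - φ y i)]
    simp only [sub_smul, Finset.sum_sub_distrib]
    rw [← hy]
    abel

end Adapted

/-! ### Real projective space -/

namespace RP

variable {m : ℕ}

lemma affineChart_mem_maximalAtlas (i : Fin (m + 1)) :
    affineChart i ∈ IsManifold.maximalAtlas (𝓡 m) ∞ (RP m) :=
  StructureGroupoid.subset_maximalAtlas _ (mem_range_self i)

/-- The vector on the line `l` whose `i`-th coordinate is `1`, for `l` in the domain of the `i`-th
affine chart. -/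
noncomputable def affineLift (i : Fin (m + 1)) (l : RP m) : Fin (m + 1) → ℝ :=
  i.insertNth (1 : ℝ) (fun k => affine i l k)

lemma affineLift_self (i : Fin (m + 1)) (l : RP m) : affineLift i l i = 1 := by
  simp [affineLift]

lemma affineLift_ne_zero (i : Fin (m + 1)) (l : RP m) : affineLift i l ≠ 0 :=
  insertNth_ne_zero i _

lemma mk_affineLift {i : Fin (m + 1)} {l : RP m} (hl : l ∈ affineOpen i) :
    Projectivization.mk ℝ (affineLift i l) (affineLift_ne_zero i l) = l :=
  (affineChart i).left_inv hl

lemma submodule_eq_span_affineLift {i : Fin (m + 1)} {l : RP m} (hl : l ∈ affineOpen i) :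
    l.submodule = Submodule.span ℝ {affineLift i l} := by
  conv_lhs => rw [← mk_affineLift hl]
  rw [Projectivization.submodule_mk]

lemma mem_projSet_iff_affineLift {i : Fin (m + 1)} {l : RP m} (hl : l ∈ affineOpen i)
    (U : Submodule ℝ (Fin (m + 1) → ℝ)) : l ∈ projSet U ↔ affineLift i l ∈ U := by
  rw [← mem_projSet_mk (affineLift_ne_zero i l), mk_affineLift hl]

lemma affineLift_eq_sum (i : Fin (m + 1)) (l : RP m) :
    affineLift i l = Pi.single i 1 + ∑ k, affine i l k • Pi.single (i.succAbove k) (1 : ℝ) := by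
  ext a
  refine Fin.succAboveCases i ?_ (fun b => ?_) a
  · simp [affineLift, Finset.sum_apply, (Fin.succAbove_ne i _).symm]
  · simp [affineLift, Finset.sum_apply, Pi.single_apply, Fin.succAbove_ne i b]

lemma contMDiffOn_affineLift (i : Fin (m + 1)) :
    ContMDiffOn (𝓡 m) 𝓘(ℝ, Fin (m + 1) → ℝ) ∞ (affineLift i) (affineOpen i) := by
  have h1 : ContMDiffOn (𝓡 m) (𝓡 m) ∞ (affine i) (affineOpen i) :=
    contMDiffOn_of_mem_maximalAtlas (affineChart_mem_maximalAtlas i)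
  have h2 : ContDiff ℝ ∞ (fun t : EuclideanSpace ℝ (Fin m) =>
      (Pi.single i 1 + ∑ k, t k • Pi.single (i.succAbove k) (1 : ℝ) : Fin (m + 1) → ℝ)) := by
    fun_prop
  have h3 := h2.contMDiff.comp_contMDiffOn h1
  refine h3.congr fun l _ => ?_
  exact affineLift_eq_sum i l

lemma continuous_mk {T : Type*} [TopologicalSpace T] {f : T → Fin (m + 1) → ℝ} (hf : Continuous f)
    (h0 : ∀ t, f t ≠ 0) : Continuous (fun t => Projectivization.mk ℝ (f t) (h0 t)) :=
  isQuotientMap_mk'.continuous.comp (hf.subtype_mk h0)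

instance : CompactSpace (RP m) := by
  let S := Metric.sphere (0 : Fin (m + 1) → ℝ) 1
  have h0 : ∀ v : S, v.1 ≠ 0 := fun v => Metric.ne_of_mem_sphere v.2 one_ne_zero
  have : CompactSpace S := isCompact_iff_compactSpace.1 (isCompact_sphere _ _)
  have hs : Function.Surjective (fun v : S => Projectivization.mk ℝ v.1 (h0 v)) := by
    intro l
    induction l using Projectivization.ind with
    | h v hv =>
      refine ⟨⟨‖v‖⁻¹ • v, ?_⟩, ?_⟩
      · rw [mem_sphere_zero_iff_norm, norm_smul, norm_inv, norm_norm,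
          inv_mul_cancel₀ (norm_ne_zero_iff.2 hv)]
      · rw [Projectivization.mk_eq_mk_iff']
        exact ⟨‖v‖⁻¹, rfl⟩
  exact hs.compactSpace (continuous_mk continuous_subtype_val h0)

end RP

section BraidComplement

variable {m : ℕ}

lemma mem_braidHyperplane {i j : Fin (m + 1)} {v : Fin (m + 1) → ℝ} :
    v ∈ braidHyperplane i j ↔ v i = v j := by
  rw [braidHyperplane, LinearMap.mem_ker, LinearMap.sub_apply, sub_eq_zero]
  exact eq_comm

/-- The lines that lie in no hyperplane of the braid arrangement. -/
def braidComplement (m : ℕ) : Set (RP m) :=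
  {l | ∀ U ∈ braidArrangement m, l ∉ projSet U}

lemma mem_braidComplement_iff {l : RP m} {i : Fin (m + 1)} (hl : l ∈ RP.affineOpen i) :
    l ∈ braidComplement m ↔ Function.Injective (RP.affineLift i l) := by
  constructor
  · intro h a b hab
    by_contra hne
    refine h _ ⟨a, b, hne, rfl⟩ ?_
    rw [RP.mem_projSet_iff_affineLift hl, mem_braidHyperplane]
    exact hab
  · rintro h _ ⟨a, b, hne, rfl⟩ hmem
    rw [RP.mem_projSet_iff_affineLift hl, mem_braidHyperplane] at hmem
    exact hne (h hmem)

lemma le_of_mem_intersectionLattice {U : Submodule ℝ (Fin (m + 1) → ℝ)}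
    (hU : U ∈ intersectionLattice (braidArrangement m)) (htop : U ≠ ⊤) :
    ∃ B ∈ braidArrangement m, U ≤ B := by
  obtain ⟨ℬ, hℬ, rfl⟩ := hU
  rcases ℬ.eq_empty_or_nonempty with rfl | ⟨B, hB⟩
  · exact (htop (by simp)).elim
  · exact ⟨B, hℬ hB, sInf_le hB⟩

lemma notMem_projSet_of_mem_braidComplement {l : RP m} (hl : l ∈ braidComplement m)
    {U : Submodule ℝ (Fin (m + 1) → ℝ)} (hU : U ∈ intersectionLattice (braidArrangement m))
    (htop : U ≠ ⊤) : l ∉ projSet U := by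
  obtain ⟨B, hB, hUB⟩ := le_of_mem_intersectionLattice hU htop
  exact fun h => hl B hB (projSet_subset_iff.2 hUB h)

/-- Moving a vector in a direction with pairwise distinct coordinates makes all its coordinates
distinct. -/
lemma dense_braidComplement : Dense (braidComplement m) := by
  intro l
  obtain ⟨i, hi⟩ := RP.exists_mem_affineOpen l
  -- in homogeneous coordinates the direction has the entry `0` at `i`, so its other entries have to
  -- be non-zero
  let w : EuclideanSpace ℝ (Fin m) := WithLp.toLp 2 fun k => (k : ℝ) + 1
  obtain ⟨h1, -⟩ := IsBlowup.tendsto_chart_curve (RP.affineChart i) hi w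
  refine mem_closure_of_tendsto (h1.mono_left (nhdsWithin_le_nhds (s := {(0 : ℝ)}ᶜ))) ?_
  let v : Fin (m + 1) → ℝ := RP.affineLift i l
  let w' : Fin (m + 1) → ℝ := i.insertNth (0 : ℝ) (fun k => w k)
  have hw' : Function.Injective w' := by
    have hpos : ∀ k : Fin m, w k ≠ 0 := fun k => by
      have : (0 : ℝ) ≤ (k : ℝ) := by positivity
      simp only [w]; positivity
    intro a b
    refine Fin.succAboveCases i ?_ (fun a' => ?_) a
    · refine Fin.succAboveCases i ?_ (fun b' => ?_) b
      · simp
      · simp only [w', Fin.insertNth_apply_same, Fin.insertNth_apply_succAbove]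
        exact fun h => (hpos b' h.symm).elim
    · refine Fin.succAboveCases i ?_ (fun b' => ?_) b
      · simp only [w', Fin.insertNth_apply_same, Fin.insertNth_apply_succAbove]
        exact fun h => (hpos a' h).elim
      · simp only [w', Fin.insertNth_apply_succAbove, w, add_left_inj, Nat.cast_inj]
        intro h
        rw [Fin.ext h]
  have hlift : ∀ ε : ℝ, RP.affineLift i ((RP.affineChart i).symm (RP.affineChart i l + ε • w)) =
      v + ε • w' := by
    intro ε
    have h2 : RP.affine i ((RP.affineChart i).symm (RP.affineChart i l + ε • w)) =
        RP.affine i l + ε • w := (RP.affineChart i).right_inv (mem_univ _)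
    ext a
    rw [RP.affineLift, h2]
    refine Fin.succAboveCases i ?_ (fun b => ?_) a
    · simp [v, w', RP.affineLift]
    · simp [v, w', RP.affineLift]
  -- the differences of coordinates are affine in `ε` and not identically zero
  have hev : ∀ a b : Fin (m + 1), a ≠ b →
      ∀ᶠ ε : ℝ in 𝓝[≠] 0, (v + ε • w') a ≠ (v + ε • w') b := by
    intro a b hab
    by_cases hv : v a = v b
    · filter_upwards [self_mem_nhdsWithin] with ε hε h
      simp only [Pi.add_apply, Pi.smul_apply, smul_eq_mul, hv, add_right_inj] at h
      exact hab (hw' (mul_left_cancel₀ hε h))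
    · have hc : ContinuousAt (fun ε : ℝ => (v + ε • w') a - (v + ε • w') b) 0 := by
        simp only [Pi.add_apply, Pi.smul_apply]
        fun_prop
      have := hc.eventually_ne (y := 0) (by simpa [sub_eq_zero] using hv)
      filter_upwards [this.filter_mono nhdsWithin_le_nhds] with ε hε h
      exact hε (sub_eq_zero.2 h)
  have hev' : ∀ᶠ ε : ℝ in 𝓝[≠] 0, ∀ a b : Fin (m + 1), a ≠ b →
      (v + ε • w') a ≠ (v + ε • w') b := by
    simp only [Filter.eventually_all]
    exact hev
  filter_upwards [hev'] with ε hε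
  rw [mem_braidComplement_iff ((RP.affineChart i).map_target (mem_univ _)), hlift]
  intro a b hab
  by_contra hne
  exact hε a b hne hab

end BraidComplement

/-! ### Local models of a successive blowup -/

section Invariant

variable {m : ℕ}

/-- The points of `Y` that lie over none of the subsets in the list `L`. -/
def offStrata {Y : Type*} (q : Y → RP m) (L : List (Set (RP m))) : Set Y :=
  {z | ∀ T ∈ L, q z ∉ T}

/-- `s` is a smooth lift near `y` of the map to `ℙ(V/U)` given by the line `q z` where `q z` lies in
no member of `L`. -/
def IsLocalLift {Y : SmoothMfd m} (q : Y → RP m) (L : List (Set (RP m)))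
    (U : Submodule ℝ (Fin (m + 1) → ℝ)) (y : Y) (s : Y → Fin (m + 1) → ℝ) : Prop :=
  ∀ᶠ z in 𝓝 y, ContMDiffAt (𝓡 m) 𝓘(ℝ, Fin (m + 1) → ℝ) ∞ s z ∧ s z ∉ U ∧
    (z ∈ offStrata q L → SameLineMod U (s z) (q z))

/-- The local structure at `y` of the manifold `q : Y → ℝℙ^m` obtained by blowing up the strata in
`L`. The space `W` is the smallest element of the lattice whose proper transform passes through `y`;
in a suitable chart the line `q z` is given modulo `W` by a linear function of the coordinates in
`A`, and for the `U` not above `W` the map to `ℙ(V/U)` lifts smoothly near `y`. -/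
structure LocalModel {Y : SmoothMfd m} (q : Y → RP m) (L : List (Set (RP m))) (y : Y) where
  W : Submodule ℝ (Fin (m + 1) → ℝ)
  W_mem : W ∈ intersectionLattice (braidArrangement m)
  φ : OpenPartialHomeomorph Y (EuclideanSpace ℝ (Fin m))
  φ_mem : φ ∈ IsManifold.maximalAtlas (𝓡 m) ∞ Y
  mem_source : y ∈ φ.source
  A : Finset (Fin m)
  c : Fin m → Fin (m + 1) → ℝ
  frame : IsFrame W A c
  coord_eq_zero : ∀ i ∈ A, φ y i = 0
  sameLine : ∀ z ∈ φ.source, z ∈ offStrata q L → SameLineMod W (∑ i ∈ A, φ z i • c i) (q z)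
  cylinder : ∀ z ∈ φ.source, ∀ z' ∈ φ.source, (∀ i ∉ A, φ z i = φ z' i) →
    z ∈ offStrata q L → z' ∈ offStrata q L
  projSet_notMem : ∀ U ∈ intersectionLattice (braidArrangement m), W ≤ U → U ≠ ⊤ → projSet U ∉ L
  s : Submodule ℝ (Fin (m + 1) → ℝ) → Y → Fin (m + 1) → ℝ
  lift : ∀ U ∈ intersectionLattice (braidArrangement m), ¬ W ≤ U → IsLocalLift q L U y (s U)
  immersion : ∀ ξ : TangentSpace (𝓡 m) y, mfderiv (𝓡 m) (𝓡 m) q y ξ = 0 →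
    (∀ U ∈ intersectionLattice (braidArrangement m), U ≠ ⊤ → projSet U ∈ L →
      (mfderiv (𝓡 m) 𝓘(ℝ, Fin (m + 1) → ℝ) (s U) y ξ : Fin (m + 1) → ℝ) ∈
        U ⊔ Submodule.span ℝ {s U y}) → ξ = 0

/-- What is known about the manifold `q : Y → ℝℙ^m` obtained by blowing up the strata in `L`. -/
structure IsWonderful (Y : SmoothMfd m) (q : Y → RP m) (L : List (Set (RP m))) : Prop where
  smooth : ContMDiff (𝓡 m) (𝓡 m) ∞ q
  existsUnique : ∀ x, (∀ T ∈ L, x ∉ T) → ∃! y, q y = x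
  dense : Dense (q ⁻¹' braidComplement m)
  compact : CompactSpace Y
  localModel : ∀ y, Nonempty (LocalModel q L y)
  separated : ∀ y₁ y₂, q y₁ = q y₂ →
    (∀ U ∈ intersectionLattice (braidArrangement m), projSet U ∈ L → ∀ s₁ s₂,
      IsLocalLift q L U y₁ s₁ → IsLocalLift q L U y₂ s₂ →
        U ⊔ Submodule.span ℝ {s₁ y₁} = U ⊔ Submodule.span ℝ {s₂ y₂}) → y₁ = y₂

lemma isOpen_compl_submodule (U : Submodule ℝ (Fin (m + 1) → ℝ)) :
    IsOpen {x : Fin (m + 1) → ℝ | x ∉ U} :=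
  (Submodule.closed_of_finiteDimensional U).isOpen_compl

/-- The vectors `c` of the frame of the standard affine chart. -/
lemma span_affine_frame (i : Fin (m + 1)) (W : Submodule ℝ (Fin (m + 1) → ℝ)) (l : RP m)
    (hl : RP.affineLift i l ∈ W) :
    W ⊔ Submodule.span ℝ ((fun k => Pi.single (i.succAbove k) (1 : ℝ)) ''
      ((Finset.univ : Finset (Fin m)) : Set (Fin m))) = ⊤ := by
  set S := W ⊔ Submodule.span ℝ ((fun k => Pi.single (i.succAbove k) (1 : ℝ)) ''
      ((Finset.univ : Finset (Fin m)) : Set (Fin m))) with hS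
  have h1 : ∀ k, (Pi.single (i.succAbove k) (1 : ℝ) : Fin (m + 1) → ℝ) ∈ S := fun k =>
    Submodule.mem_sup_right (Submodule.subset_span ⟨k, by simp, rfl⟩)
  have h2 : (Pi.single i (1 : ℝ) : Fin (m + 1) → ℝ) ∈ S := by
    have h3 : RP.affineLift i l ∈ S := Submodule.mem_sup_left hl
    rw [RP.affineLift_eq_sum] at h3
    exact (Submodule.add_mem_iff_left _ (Submodule.sum_mem _ fun k _ => S.smul_mem _ (h1 k))).1 h3
  rw [eq_top_iff]
  intro x _
  have hx : x = ∑ a, x a • Pi.single a (1 : ℝ) := by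
    ext b
    simp [Finset.sum_apply, Pi.single_apply]
  rw [hx]
  refine Submodule.sum_mem _ fun a _ => ?_
  refine S.smul_mem _ ?_
  refine Fin.succAboveCases i h2 (fun k => h1 k) a

/-- Before any blowup, the local model at a line `l` is the affine chart, and `W` is the smallest
element of the lattice that contains `l`. -/
theorem isWonderful_nil : IsWonderful (RP.mfd m) (id : RP m → RP m) [] where
  smooth := contMDiff_id
  existsUnique x _ := ⟨x, rfl, fun y hy => hy⟩
  dense := dense_braidComplement
  compact := inferInstanceAs (CompactSpace (RP m))
  separated y₁ y₂ h _ := h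
  localModel l := by
    change RP m at l
    obtain ⟨i, hi⟩ := RP.exists_mem_affineOpen l
    set W := latticeHull (braidArrangement m) ⊥ (RP.affineLift i l) with hW
    obtain ⟨A, -, hA, ψ, hψ, hs, h0, -, hlin⟩ := exists_adapted_chart (M := RP m)
      (RP.affineChart_mem_maximalAtlas i) l (W := W) (span_affine_frame i W l mem_latticeHull)
      (Pi.single i 1) (by
        change Pi.single i 1 + ∑ k, RP.affine i l k • Pi.single (i.succAbove k) (1 : ℝ) ∈ W
        rw [← RP.affineLift_eq_sum]; exact mem_latticeHull)
    exact ⟨{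
      W := W
      W_mem := latticeHull_mem
      φ := ψ
      φ_mem := hψ
      mem_source := by rw [hs]; exact hi
      A := A
      c := _
      frame := hA
      coord_eq_zero := h0
      sameLine := fun z hz _ => by
        rw [hs] at hz
        refine SameLineMod.congr (x := RP.affineLift i z)
          (SameLineMod.of_submodule_eq (RP.submodule_eq_span_affineLift hz)) ?_
        rw [RP.affineLift_eq_sum]
        exact hlin z
      cylinder := fun _ _ _ _ _ _ T hT => by simp at hT
      projSet_notMem := fun _ _ _ _ h => by simp at h
      s := fun _ => RP.affineLift i
      lift := fun U hU hWU => by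
        have hlU : RP.affineLift i l ∉ U := fun h => hWU (latticeHull_le hU bot_le h)
        have hc : ContinuousAt (RP.affineLift i) l :=
          ((RP.contMDiffOn_affineLift i).contMDiffAt
            ((RP.isOpen_affineOpen i).mem_nhds hi)).continuousAt
        filter_upwards [(RP.isOpen_affineOpen i).mem_nhds hi,
          hc.eventually ((isOpen_compl_submodule U).mem_nhds hlU)] with z hz hzU
        exact ⟨(RP.contMDiffOn_affineLift i).contMDiffAt
          ((RP.isOpen_affineOpen i).mem_nhds hz), hzU, fun _ =>
          SameLineMod.of_submodule_eq (RP.submodule_eq_span_affineLift hz)⟩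
      immersion := fun ξ hξ _ => by
        rw [mfderiv_id] at hξ
        exact hξ }⟩

end Invariant

/-! ### The inductive step -/

section Step

variable {m : ℕ}

lemma offStrata_append_singleton {Y : Type*} (q : Y → RP m) (L : List (Set (RP m)))
    (S : Set (RP m)) {z : Y} : z ∈ offStrata q (L ++ [S]) ↔ z ∈ offStrata q L ∧ q z ∉ S := by
  constructor
  · intro h
    exact ⟨fun T hT => h T (by simp [hT]), h S (by simp)⟩
  · rintro ⟨h1, h2⟩ T hT
    rcases List.mem_append.1 hT with hT | hT
    · exact h1 T hT
    · rw [List.mem_singleton.1 hT]; exact h2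

/-- `U₀` is the next element of the lattice whose projectivization is to be blown up after those in
`L`. -/
structure IsNext (L : List (Set (RP m))) (U₀ : Submodule ℝ (Fin (m + 1) → ℝ)) : Prop where
  mem : U₀ ∈ intersectionLattice (braidArrangement m)
  ne_top : U₀ ≠ ⊤
  notMem : projSet U₀ ∉ L
  lt_mem : ∀ W ∈ intersectionLattice (braidArrangement m), W < U₀ → projSet W ∈ L

namespace LocalModel

variable {Y : SmoothMfd m} {q : Y → RP m} {L : List (Set (RP m))} {y : Y}
  {U₀ : Submodule ℝ (Fin (m + 1) → ℝ)}

lemma W_eq_of_le (M : LocalModel q L y) (hU : IsNext L U₀) (h : M.W ≤ U₀) : M.W = U₀ := by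
  by_contra hne
  have hlt := lt_of_le_of_ne h hne
  exact M.projSet_notMem _ M.W_mem le_rfl hlt.ne_top (hU.lt_mem _ M.W_mem hlt)

/-- Near a point whose local model belongs to `U₀` the proper transform of the projectivization of
`U₀` is the coordinate subspace given by the vanishing of the coordinates in `A`. -/
theorem mem_properTransform_iff (M : LocalModel q L y) (hd : Dense (offStrata q L))
    (hW : M.W = U₀) :
    ∀ x ∈ M.φ.source, x ∈ properTransform q L (projSet U₀) ↔ ∀ i ∈ M.A, M.φ x i = 0 := by
  intro x hx
  have hcoord : ∀ z, ∑ i ∈ M.A, M.φ z i • M.c i ∈ U₀ ↔ ∀ i ∈ M.A, M.φ z i = 0 := fun z => by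
    rw [← hW]; exact M.frame.sum_mem_iff _
  have hoff : ∀ z, z ∈ q ⁻¹' (projSet U₀ \ ⋃ T ∈ L, T) ↔ q z ∈ projSet U₀ ∧ z ∈ offStrata q L := by
    intro z
    simp [offStrata]
  constructor
  · intro hxZ i hi
    -- near `x` the coordinate `i` is non-zero, so no point there lies over `ℙ U₀` and off the
    -- strata
    by_contra hne
    have hc : ContinuousAt (fun z => M.φ z i) x :=
      (EuclideanSpace.proj (𝕜 := ℝ) i).continuous.continuousAt.comp (M.φ.continuousAt hx)
    have hev : ∀ᶠ z in 𝓝 x, M.φ z i ≠ 0 ∧ z ∈ M.φ.source :=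
      (hc.eventually_ne hne).and (M.φ.open_source.mem_nhds hx)
    obtain ⟨z, hz, hz0, hzs⟩ := ((mem_closure_iff_frequently.1 hxZ).and_eventually hev).exists
    rw [hoff] at hz
    have h1 := M.sameLine z hzs hz.2
    rw [hW] at h1
    exact hz0 ((hcoord z).1 (h1.mem_projSet_iff.1 hz.1) i hi)
  · intro hx0
    refine mem_closure_iff_nhds.2 fun N hN => ?_
    have h1 : M.φ.target ∩ M.φ.symm ⁻¹' N ∈ 𝓝 (M.φ x) := by
      refine Filter.inter_mem (M.φ.open_target.mem_nhds (M.φ.map_source hx)) ?_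
      have := M.φ.continuousAt_symm (M.φ.map_source hx)
      refine this.preimage_mem_nhds ?_
      rw [M.φ.left_inv hx]; exact hN
    -- setting the coordinates in `A` to zero keeps a point in the preimage of the given
    -- neighbourhood
    let π : EuclideanSpace ℝ (Fin m) → EuclideanSpace ℝ (Fin m) := fun t =>
      WithLp.toLp 2 fun i => if i ∈ M.A then 0 else t i
    have hπ : Continuous π := by
      refine (PiLp.continuous_toLp 2 _).comp (continuous_pi fun i => ?_)
      split_ifs <;> fun_prop
    have hπx : π (M.φ x) = M.φ x := by
      ext i
      by_cases hi : i ∈ M.A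
      · simp [π, hi, hx0 i hi]
      · simp [π, hi]
    have h2 : ∀ᶠ z in 𝓝 x, π (M.φ z) ∈ M.φ.target ∩ M.φ.symm ⁻¹' N ∧ z ∈ M.φ.source := by
      refine Filter.Eventually.and ?_ (M.φ.open_source.mem_nhds hx)
      refine (hπ.continuousAt.comp (M.φ.continuousAt hx)).eventually ?_
      change _ ∈ 𝓝 (π (M.φ x))
      rw [hπx]
      exact h1
    obtain ⟨z, hzoff, ⟨hzt, hzN⟩, hzs⟩ :=
      ((mem_closure_iff_frequently.1 (hd x)).and_eventually h2).exists
    refine ⟨M.φ.symm (π (M.φ z)), hzN, ?_⟩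
    have hs' := M.φ.map_target hzt
    have hval : M.φ (M.φ.symm (π (M.φ z))) = π (M.φ z) := M.φ.right_inv hzt
    have hoff' : M.φ.symm (π (M.φ z)) ∈ offStrata q L := by
      refine M.cylinder z hzs _ hs' (fun i hi => ?_) hzoff
      rw [hval]; simp [π, hi]
    rw [hoff]
    refine ⟨?_, hoff'⟩
    have h3 := M.sameLine _ hs' hoff'
    rw [hW] at h3
    rw [h3.mem_projSet_iff, hcoord]
    intro i hi
    rw [hval]; simp [π, hi]

/-- Near points whose local model does not belong to `U₀`, the lift takes values outside `U₀`, so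
the proper transform does not come near. -/
theorem notMem_properTransform (M : LocalModel q L y) (hU : IsNext L U₀) (hW : M.W ≠ U₀) :
    y ∉ properTransform q L (projSet U₀) := by
  intro hy
  have hnle : ¬ M.W ≤ U₀ := fun h => hW (M.W_eq_of_le hU h)
  have hl := M.lift U₀ hU.mem hnle
  obtain ⟨z, hz, hz'⟩ := ((mem_closure_iff_frequently.1 hy).and_eventually hl).exists
  have hoff : q z ∈ projSet U₀ ∧ z ∈ offStrata q L := by simpa [offStrata] using hz
  exact hz'.2.1 ((hz'.2.2 hoff.2).mem_projSet_iff.1 hoff.1)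

theorem W_eq_of_mem_properTransform (M : LocalModel q L y) (hU : IsNext L U₀)
    (hy : y ∈ properTransform q L (projSet U₀)) : M.W = U₀ := by
  by_contra h
  exact M.notMem_properTransform hU h hy

end LocalModel

namespace IsWonderful

variable {Y Y' : SmoothMfd m} {q : Y → RP m} {r : Y' → Y} {L : List (Set (RP m))}
  {U₀ : Submodule ℝ (Fin (m + 1) → ℝ)}

/-- The members of `L` are projectivizations of proper elements of the lattice. -/
def _root_.IsStrataList (L : List (Set (RP m))) : Prop :=
  ∀ T ∈ L, ∃ U ∈ intersectionLattice (braidArrangement m), U ≠ ⊤ ∧ T = projSet U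

lemma dense_offStrata (hq : IsWonderful Y q L) (hL : IsStrataList L) : Dense (offStrata q L) := by
  refine hq.dense.mono fun y hy T hT => ?_
  obtain ⟨U, hU, htop, rfl⟩ := hL T hT
  exact notMem_projSet_of_mem_braidComplement hy hU htop

/-- Where no earlier center interferes, the proper transform is the preimage. -/
lemma mem_properTransform_iff (hq : IsWonderful Y q L) (hU : IsNext L U₀)
    {z : Y} (hz : z ∈ offStrata q L) :
    z ∈ properTransform q L (projSet U₀) ↔ q z ∈ projSet U₀ := by
  constructor
  · intro h
    obtain ⟨M⟩ := hq.localModel z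
    have hW := M.W_eq_of_mem_properTransform hU h
    have h1 := M.sameLine z M.mem_source hz
    rw [hW] at h1
    rw [h1.mem_projSet_iff, ← hW, M.frame.sum_mem_iff]
    exact M.coord_eq_zero
  · intro h
    exact subset_closure ⟨h, by simpa [offStrata] using hz⟩

lemma offStrata_comp (hq : IsWonderful Y q L) (hU : IsNext L U₀) {z : Y'} :
    z ∈ offStrata (q ∘ r) (L ++ [projSet U₀]) ↔
      r z ∈ offStrata q L ∧ r z ∉ properTransform q L (projSet U₀) := by
  rw [offStrata_append_singleton]
  change r z ∈ offStrata q L ∧ _ ↔ _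
  refine and_congr_right fun h => ?_
  rw [hq.mem_properTransform_iff hU h]
  rfl

lemma _root_.IsLocalLift.comp {U : Submodule ℝ (Fin (m + 1) → ℝ)}
    {s : Y → Fin (m + 1) → ℝ} {y' : Y'} (h : IsLocalLift q L U (r y') s)
    (hr : ContMDiff (𝓡 m) (𝓡 m) ∞ r) (S : Set (RP m)) :
    IsLocalLift (q ∘ r) (L ++ [S]) U y' (s ∘ r) := by
  filter_upwards [hr.continuous.continuousAt.eventually h] with z hz
  refine ⟨hz.1.comp z hr.contMDiffAt, hz.2.1, fun hoff => hz.2.2 ?_⟩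
  exact ((offStrata_append_singleton (q ∘ r) L S).1 hoff).1

lemma _root_.mfderiv_eq_zero_of_mem_maximalAtlas {M : Type*} [TopologicalSpace M]
    [ChartedSpace (EuclideanSpace ℝ (Fin m)) M] [IsManifold (𝓡 m) ∞ M]
    {ψ : OpenPartialHomeomorph M (EuclideanSpace ℝ (Fin m))}
    (hψ : ψ ∈ IsManifold.maximalAtlas (𝓡 m) ∞ M) {y : M} (hy : y ∈ ψ.source)
    {ξ : TangentSpace (𝓡 m) y} (h : mfderiv (𝓡 m) (𝓡 m) ψ y ξ = 0) : ξ = 0 := by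
  rw [IsManifold.mem_maximalAtlas_iff_contMDiffOn] at hψ
  have hd : ψ.MDifferentiable (𝓡 m) (𝓡 m) :=
    ⟨hψ.1.mdifferentiableOn (by simp), hψ.2.mdifferentiableOn (by simp)⟩
  have := hd.ker_mfderiv_eq_bot hy
  rw [LinearMap.ker_eq_bot'] at this
  exact this ξ h

/-- Away from the center the local model is pulled back. -/
theorem localModel_off_center (hq : IsWonderful Y q L) (hL : IsStrataList L) (hU : IsNext L U₀)
    (hb : IsBlowup Y Y' (properTransform q L (projSet U₀)) r) {y' : Y'}
    (hy : r y' ∉ properTransform q L (projSet U₀)) :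
    Nonempty (LocalModel (q ∘ r) (L ++ [projSet U₀]) y') := by
  obtain ⟨M⟩ := hq.localModel (r y')
  obtain ⟨ψ, hψ, hyψ, hψr⟩ := hb.exists_chart_off_center hy M.φ_mem M.mem_source
  have hWU : M.W ≠ U₀ := by
    intro h
    exact hy ((M.mem_properTransform_iff (hq.dense_offStrata hL) h _ M.mem_source).2
      M.coord_eq_zero)
  have hoff : ∀ z ∈ ψ.source, (z ∈ offStrata (q ∘ r) (L ++ [projSet U₀]) ↔
      r z ∈ offStrata q L) := fun z hz => by
    rw [hq.offStrata_comp hU]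
    exact and_iff_left (hψr z hz).2.1
  exact ⟨{
    W := M.W
    W_mem := M.W_mem
    φ := ψ
    φ_mem := hψ
    mem_source := hyψ
    A := M.A
    c := M.c
    frame := M.frame
    coord_eq_zero := fun i hi => by
      rw [← (hψr y' hyψ).2.2]; exact M.coord_eq_zero i hi
    sameLine := fun z hz hzo => by
      rw [← (hψr z hz).2.2]
      exact M.sameLine _ (hψr z hz).1 ((hoff z hz).1 hzo)
    cylinder := fun z hz z' hz' h hzo => by
      rw [hoff z' hz']
      refine M.cylinder _ (hψr z hz).1 _ (hψr z' hz').1 (fun i hi => ?_) ((hoff z hz).1 hzo)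
      rw [(hψr z hz).2.2, (hψr z' hz').2.2]
      exact h i hi
    projSet_notMem := fun U hUm hWU' htop hmem => by
      rcases List.mem_append.1 hmem with h | h
      · exact M.projSet_notMem U hUm hWU' htop h
      · rw [projSet_injective (List.mem_singleton.1 h)] at hWU'
        exact hWU (M.W_eq_of_le hU hWU')
    s := fun U => M.s U ∘ r
    lift := fun U hUm hWU' => (M.lift U hUm hWU').comp hb.smooth _
    immersion := fun ξ hξ hs => by
      have hrd : MDifferentiableAt (𝓡 m) (𝓡 m) r y' := hb.smooth.mdifferentiableAt (by simp)
      rw [mfderiv_comp y' (hq.smooth.mdifferentiableAt (by simp)) hrd] at hξ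
      have h1 : mfderiv (𝓡 m) (𝓡 m) r y' ξ = 0 := by
        refine M.immersion _ hξ fun U hUm htop hUL => ?_
        have h2 := hs U hUm htop (by simp [hUL])
        have h3 := M.lift U hUm fun hle => M.projSet_notMem U hUm hle htop hUL
        rw [mfderiv_comp y' (h3.self_of_nhds.1.mdifferentiableAt (by simp)) hrd] at h2
        exact h2
      have h4 := hb.localDiffeo y' hy
      have h5 := (h4.mfderivToContinuousLinearEquiv (by simp)).injective
      have h6 : (h4.mfderivToContinuousLinearEquiv (by simp)) ξ = 0 := by
        rw [← h1]
        exact congrArg (fun f => f ξ) (h4.mfderivToContinuousLinearEquiv_coe (by simp))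
      exact h5 (h6.trans (map_zero _).symm) }⟩

end IsWonderful

end Step

section StepOver

variable {m : ℕ}

/-- The direction in `V / W` of a point of the `j`-th standard chart of the blowup of a coordinate
subspace with coordinates in `A`, where the coordinates of `V / W` belong to the frame `c`. -/
noncomputable def directionLift (A : Finset (Fin m)) (c : Fin m → Fin (m + 1) → ℝ) (j : Fin m)
    (t : EuclideanSpace ℝ (Fin m)) : Fin (m + 1) → ℝ :=
  ∑ i ∈ A, (if i = j then 1 else t i) • c i

lemma contDiff_directionLift (A : Finset (Fin m)) (c : Fin m → Fin (m + 1) → ℝ) (j : Fin m) :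
    ContDiff ℝ ∞ (directionLift A c j) := by
  refine ContDiff.sum fun i _ => ?_
  split_ifs
  · exact contDiff_const
  · fun_prop

lemma sum_blowdownChart_smul (A : Finset (Fin m)) (c : Fin m → Fin (m + 1) → ℝ) (j : Fin m)
    (t : EuclideanSpace ℝ (Fin m)) :
    ∑ i ∈ A, blowdownChart A j t i • c i = t j • directionLift A c j t := by
  rw [directionLift, Finset.smul_sum]
  refine Finset.sum_congr rfl fun i hi => ?_
  rw [smul_smul, blowdownChart_apply]
  by_cases hij : i = j
  · simp [hij]
  · simp [hi, hij]

lemma directionLift_notMem {W : Submodule ℝ (Fin (m + 1) → ℝ)} {A : Finset (Fin m)}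
    {c : Fin m → Fin (m + 1) → ℝ} (h : IsFrame W A c) {j : Fin m} (hj : j ∈ A)
    (t : EuclideanSpace ℝ (Fin m)) : directionLift A c j t ∉ W := by
  intro hmem
  have := h.indep _ hmem j hj
  simp at this

lemma directionLift_eq_add (A : Finset (Fin m)) (c : Fin m → Fin (m + 1) → ℝ) {j : Fin m}
    (hj : j ∈ A) (t : EuclideanSpace ℝ (Fin m)) :
    directionLift A c j t = c j + ∑ i ∈ A.erase j, t i • c i := by
  rw [directionLift, ← Finset.add_sum_erase _ _ hj, if_pos rfl, one_smul]
  congr 1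
  exact Finset.sum_congr rfl fun i hi => by rw [if_neg (Finset.ne_of_mem_erase hi)]

lemma fderiv_directionLift (A : Finset (Fin m)) (c : Fin m → Fin (m + 1) → ℝ) {j : Fin m}
    (t η : EuclideanSpace ℝ (Fin m)) :
    fderiv ℝ (directionLift A c j) t η = ∑ i ∈ A, (if i = j then 0 else η i) • c i := by
  have h : HasFDerivAt (directionLift A c j)
      (∑ i ∈ A, ((if i = j then 0 else EuclideanSpace.proj (𝕜 := ℝ) i :
        EuclideanSpace ℝ (Fin m) →L[ℝ] ℝ)).smulRight (c i)) t := by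
    unfold directionLift
    refine HasFDerivAt.fun_sum fun i _ => HasFDerivAt.smul_const ?_ _
    split_ifs
    · exact hasFDerivAt_const _ _
    · exact (EuclideanSpace.proj (𝕜 := ℝ) i : EuclideanSpace ℝ (Fin m) →L[ℝ] ℝ).hasFDerivAt
  rw [h.fderiv]
  simp only [_root_.sum_apply, ContinuousLinearMap.smulRight_apply]
  refine Finset.sum_congr rfl fun i _ => ?_
  split_ifs <;> simp

/-- The kernel of the differential of the blowdown map consists of directions that change only the
ratios of coordinates. -/
lemma eq_zero_of_fderiv_blowdownChart {A : Finset (Fin m)} {j : Fin m}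
    {t η : EuclideanSpace ℝ (Fin m)} (h : fderiv ℝ (blowdownChart A j) t η = 0) :
    η j = 0 ∧ ∀ i ∉ A, η i = 0 := by
  have hd : DifferentiableAt ℝ (blowdownChart A j) t :=
    (contDiff_blowdownChart A j).contDiffAt.differentiableAt (by simp)
  have key : ∀ i, ¬ (i ∈ A ∧ i ≠ j) → η i = 0 := by
    intro i hi
    have h1 : HasFDerivAt (fun x => blowdownChart A j x i)
        ((EuclideanSpace.proj (𝕜 := ℝ) i : EuclideanSpace ℝ (Fin m) →L[ℝ] ℝ).comp
          (fderiv ℝ (blowdownChart A j) t)) t :=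
      (EuclideanSpace.proj (𝕜 := ℝ) i : EuclideanSpace ℝ (Fin m) →L[ℝ] ℝ).hasFDerivAt.comp t
        hd.hasFDerivAt
    have h2 : HasFDerivAt (fun x => blowdownChart A j x i)
        (EuclideanSpace.proj (𝕜 := ℝ) i : EuclideanSpace ℝ (Fin m) →L[ℝ] ℝ) t := by
      have : (fun x => blowdownChart A j x i) = fun x => x i := by
        ext x; rw [blowdownChart_apply, if_neg hi]
      rw [this]
      exact (EuclideanSpace.proj (𝕜 := ℝ) i : EuclideanSpace ℝ (Fin m) →L[ℝ] ℝ).hasFDerivAt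
    have h3 := congrArg (fun f => f η) (h1.unique h2)
    simpa [h] using h3.symm
  exact ⟨key j (by simp), fun i hi => key i (fun h => hi h.1)⟩

namespace IsWonderful

variable {Y Y' : SmoothMfd m} {q : Y → RP m} {r : Y' → Y} {L : List (Set (RP m))}
  {U₀ : Submodule ℝ (Fin (m + 1) → ℝ)}

/-- A chart of the blowup over a local model that belongs to the center. -/
structure ChartOver (r : Y' → Y) {y : Y} (M : LocalModel q L y) (j : Fin m)
    (ψ : OpenPartialHomeomorph Y' (EuclideanSpace ℝ (Fin m))) : Prop where
  j_mem : j ∈ M.A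
  mem_maximalAtlas : ψ ∈ IsManifold.maximalAtlas (𝓡 m) ∞ Y'
  map_mem : ∀ z ∈ ψ.source, r z ∈ M.φ.source
  map_eq : ∀ z ∈ ψ.source, M.φ (r z) = blowdownChart M.A j (ψ z)

section ChartOver

variable {y : Y} {M : LocalModel q L y} {j : Fin m}
  {ψ : OpenPartialHomeomorph Y' (EuclideanSpace ℝ (Fin m))}

lemma ChartOver.mem_center_iff (hψ : ChartOver r M j ψ) (hq : IsWonderful Y q L)
    (hL : IsStrataList L) (hW : M.W = U₀) {z : Y'} (hz : z ∈ ψ.source) :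
    r z ∈ properTransform q L (projSet U₀) ↔ ψ z j = 0 := by
  rw [M.mem_properTransform_iff (hq.dense_offStrata hL) hW _ (hψ.map_mem z hz), hψ.map_eq z hz,
    blowdownChart_eq_zero_iff hψ.j_mem]

lemma ChartOver.sameLine (hψ : ChartOver r M j ψ) (hq : IsWonderful Y q L) (hL : IsStrataList L)
    (hU : IsNext L U₀) (hW : M.W = U₀) {z : Y'} (hz : z ∈ ψ.source)
    (hoff : z ∈ offStrata (q ∘ r) (L ++ [projSet U₀])) :
    SameLineMod U₀ (directionLift M.A M.c j (ψ z)) ((q ∘ r) z) := by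
  rw [hq.offStrata_comp hU, hψ.mem_center_iff hq hL hW hz] at hoff
  have h1 := M.sameLine _ (hψ.map_mem z hz) hoff.1
  rw [hψ.map_eq z hz, sum_blowdownChart_smul, hW] at h1
  exact h1.of_smul hoff.2

lemma ChartOver.contMDiffAt (hψ : ChartOver r M j ψ) {z : Y'} (hz : z ∈ ψ.source) :
    ContMDiffAt (𝓡 m) 𝓘(ℝ, Fin (m + 1) → ℝ) ∞ (fun z => directionLift M.A M.c j (ψ z)) z :=
  (contDiff_directionLift M.A M.c j).contMDiff.contMDiffAt.comp z
    (contMDiffAt_of_mem_maximalAtlas hψ.mem_maximalAtlas hz)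

lemma ChartOver.isLocalLift (hψ : ChartOver r M j ψ) (hq : IsWonderful Y q L)
    (hL : IsStrataList L) (hU : IsNext L U₀) (hW : M.W = U₀) {z : Y'} (hz : z ∈ ψ.source)
    {U : Submodule ℝ (Fin (m + 1) → ℝ)} (hUU : U₀ ≤ U)
    (hmem : directionLift M.A M.c j (ψ z) ∉ U) :
    IsLocalLift (q ∘ r) (L ++ [projSet U₀]) U z (fun z => directionLift M.A M.c j (ψ z)) := by
  filter_upwards [ψ.open_source.mem_nhds hz,
    (hψ.contMDiffAt hz).continuousAt.eventually ((isOpen_compl_submodule U).mem_nhds hmem)]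
    with x hx hxU
  exact ⟨hψ.contMDiffAt hx, hxU, fun hoff => (hψ.sameLine hq hL hU hW hx hoff).mono hUU⟩

end ChartOver

lemma exists_chartOver (hq : IsWonderful Y q L) (hL : IsStrataList L)
    (hb : IsBlowup Y Y' (properTransform q L (projSet U₀)) r) {y : Y} (M : LocalModel q L y)
    (hW : M.W = U₀) {y' : Y'} (hy : r y' = y) :
    ∃ j ψ, ChartOver r M j ψ ∧ y' ∈ ψ.source := by
  have hsrc : r y' ∈ M.φ.source := by rw [hy]; exact M.mem_source
  have hA := M.mem_properTransform_iff (hq.dense_offStrata hL) hW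
  have hmem : r y' ∈ properTransform q L (projSet U₀) := by
    rw [hA _ hsrc, hy]; exact M.coord_eq_zero
  obtain ⟨j, hj, ψ, hψ, hyψ, h⟩ := hb.exists_chart_over_center hmem M.φ_mem hsrc hA
  exact ⟨j, ψ, ⟨hj, hψ, fun z hz => (h z hz).1, fun z hz => (h z hz).2⟩, hyψ⟩

/-- The local model at a point of the exceptional divisor: the new `W` is the smallest element of
the lattice that contains the center and the direction of the point. -/
theorem localModel_over_center (hq : IsWonderful Y q L) (hL : IsStrataList L) (hU : IsNext L U₀)
    (hb : IsBlowup Y Y' (properTransform q L (projSet U₀)) r) {y' : Y'}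
    (hy : r y' ∈ properTransform q L (projSet U₀)) :
    Nonempty (LocalModel (q ∘ r) (L ++ [projSet U₀]) y') := by
  classical
  obtain ⟨M⟩ := hq.localModel (r y')
  have hW := M.W_eq_of_mem_properTransform hU hy
  obtain ⟨j, ψ, hψ, hyψ⟩ := hq.exists_chartOver hL hb M hW rfl
  have hj := hψ.j_mem
  -- `x₀` represents the direction of `y'` in `V / U₀`
  set x₀ := directionLift M.A M.c j (ψ y') with hx₀
  have hx₀U : x₀ ∉ U₀ := by rw [← hW]; exact directionLift_notMem M.frame hj _
  set W := latticeHull (braidArrangement m) U₀ x₀ with hWdef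
  have hyj : ψ y' j = 0 := (hψ.mem_center_iff hq hL hW hyψ).1 hy
  -- modulo `W` the vector `c j` is a combination of the others, as `x₀ ∈ W` has coefficient 1 at
  -- `j`
  have hspan : W ⊔ Submodule.span ℝ (M.c '' (M.A.erase j : Finset (Fin m))) = ⊤ := by
    set S := W ⊔ Submodule.span ℝ (M.c '' (M.A.erase j : Finset (Fin m))) with hS
    have h1 : ∀ i ∈ M.A.erase j, M.c i ∈ S := fun i hi =>
      Submodule.mem_sup_right (Submodule.subset_span ⟨i, hi, rfl⟩)
    have h2 : M.c j ∈ S := by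
      have h3 : x₀ ∈ S := Submodule.mem_sup_left mem_latticeHull
      rw [hx₀, directionLift_eq_add _ _ hj] at h3
      exact (Submodule.add_mem_iff_left _
        (Submodule.sum_mem _ fun k hk => S.smul_mem _ (h1 k hk))).1 h3
    rw [eq_top_iff, ← M.frame.span]
    refine sup_le ?_ ?_
    · rw [hW]; exact le_latticeHull.trans le_sup_left
    · rw [Submodule.span_le]
      rintro _ ⟨i, hi, rfl⟩
      by_cases hij : i = j
      · rw [hij]; exact h2
      · exact h1 i (Finset.mem_erase.2 ⟨hij, hi⟩)
  -- the lift `c j + ∑ t i • c i` is affine in the chart; make it linear modulo `W`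
  obtain ⟨A', hA', hframe, ψ', hψ', hsrc, h0, hcoord, hlin⟩ := exists_adapted_chart
    hψ.mem_maximalAtlas y' hspan (M.c j) (by
      rw [← directionLift_eq_add _ _ hj]; exact mem_latticeHull)
  have hjA' : j ∉ A' := fun h => by simpa using hA' h
  have hA'A : ∀ i ∉ M.A, i ∉ A' := fun i hi h => hi (Finset.mem_of_mem_erase (hA' h))
  -- for `U ⊇ U₀` not containing the direction `x₀`, the lift of the direction is also a lift modulo
  -- `U`
  let s : Submodule ℝ (Fin (m + 1) → ℝ) → Y' → Fin (m + 1) → ℝ := fun U =>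
    if U₀ ≤ U then fun z => directionLift M.A M.c j (ψ z) else M.s U ∘ r
  exact ⟨{
    W := W
    W_mem := latticeHull_mem
    φ := ψ'
    φ_mem := hψ'
    mem_source := by rw [hsrc]; exact hyψ
    A := A'
    c := M.c
    frame := hframe
    coord_eq_zero := h0
    sameLine := fun z hz hoff => by
      rw [hsrc] at hz
      have h1 := (hψ.sameLine hq hL hU hW hz hoff).mono (U' := W) le_latticeHull
      refine h1.congr ?_
      rw [directionLift_eq_add _ _ hj]
      exact hlin z
    cylinder := fun z hz z' hz' h hoff => by
      rw [hsrc] at hz hz'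
      rw [hq.offStrata_comp hU] at hoff ⊢
      have h' : ∀ i ∉ A', ψ z i = ψ z' i := fun i hi => by
        rw [← hcoord z i hi, ← hcoord z' i hi]; exact h i hi
      refine ⟨M.cylinder _ (hψ.map_mem z hz) _ (hψ.map_mem z' hz') (fun i hi => ?_) hoff.1, ?_⟩
      · rw [hψ.map_eq z hz, hψ.map_eq z' hz', blowdownChart_apply, blowdownChart_apply,
          if_neg (fun h => hi h.1), if_neg (fun h => hi h.1)]
        exact h' i (hA'A i hi)
      · rw [hψ.mem_center_iff hq hL hW hz', ← h' j hjA', ← hψ.mem_center_iff hq hL hW hz]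
        exact hoff.2
    projSet_notMem := fun U hUm hWU htop hmem => by
      have hle : U₀ ≤ U := le_latticeHull.trans hWU
      rcases List.mem_append.1 hmem with h | h
      · exact M.projSet_notMem U hUm (by rw [hW]; exact hle) htop h
      · rw [projSet_injective (List.mem_singleton.1 h)] at hWU
        exact hx₀U (hWU mem_latticeHull)
    s := s
    lift := fun U hUm hWU => by
      by_cases hle : U₀ ≤ U
      · simp only [s, if_pos hle]
        exact hψ.isLocalLift hq hL hU hW hyψ hle fun h => hWU (latticeHull_le hUm hle h)
      · simp only [s, if_neg hle]
        exact (M.lift U hUm (by rwa [hW])).comp hb.smooth _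
    immersion := fun ξ hξ hs => by
      have hrd : MDifferentiableAt (𝓡 m) (𝓡 m) r y' := hb.smooth.mdifferentiableAt (by simp)
      rw [mfderiv_comp y' (hq.smooth.mdifferentiableAt (by simp)) hrd] at hξ
      have h1 : mfderiv (𝓡 m) (𝓡 m) r y' ξ = 0 := by
        refine M.immersion _ hξ fun U hUm htop hUL => ?_
        have hnle : ¬ M.W ≤ U := fun hle => M.projSet_notMem U hUm hle htop hUL
        have h2 := hs U hUm htop (by simp [hUL])
        have h3 := M.lift U hUm hnle
        rw [hW] at hnle
        have hsU : s U = M.s U ∘ r := if_neg hnle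
        rw [hsU] at h2
        rw [mfderiv_comp y' (h3.self_of_nhds.1.mdifferentiableAt (by simp)) hrd] at h2
        exact h2
      set η : EuclideanSpace ℝ (Fin m) := mfderiv (𝓡 m) (𝓡 m) ψ y' ξ with hη
      have hψd : MDifferentiableAt (𝓡 m) (𝓡 m) ψ y' :=
        (contMDiffAt_of_mem_maximalAtlas hψ.mem_maximalAtlas hyψ).mdifferentiableAt (by simp)
      -- a tangent vector killed by `q ∘ r` is killed by `r`, so it changes only the ratios, and the
      -- direction modulo `U₀` detects these
      have hβ : fderiv ℝ (blowdownChart M.A j) (ψ y') η = 0 := by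
        have hφd : MDifferentiableAt (𝓡 m) (𝓡 m) M.φ (r y') :=
          (contMDiffAt_of_mem_maximalAtlas M.φ_mem M.mem_source).mdifferentiableAt (by simp)
        have hβd : MDifferentiableAt (𝓡 m) (𝓡 m) (blowdownChart M.A j) (ψ y') :=
          (contDiff_blowdownChart M.A j).contMDiff.mdifferentiableAt (by simp)
        have he : M.φ ∘ r =ᶠ[𝓝 y'] blowdownChart M.A j ∘ ψ := by
          filter_upwards [ψ.open_source.mem_nhds hyψ] with z hz using hψ.map_eq z hz
        have h2 := he.mfderiv_eq (I := 𝓡 m) (I' := 𝓡 m)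
        rw [mfderiv_comp y' hφd hrd, mfderiv_comp y' hβd hψd] at h2
        have h3 := congrArg (fun f => f ξ) h2
        change mfderiv (𝓡 m) (𝓡 m) M.φ (r y') (mfderiv (𝓡 m) (𝓡 m) r y' ξ) =
          mfderiv (𝓡 m) (𝓡 m) (blowdownChart M.A j) (ψ y') η at h3
        rw [h1, map_zero, mfderiv_eq_fderiv] at h3
        exact h3.symm
      obtain ⟨hηj, hηA⟩ := eq_zero_of_fderiv_blowdownChart hβ
      have h4 := hs U₀ hU.mem hU.ne_top (by simp)
      have hsU : s U₀ = fun z => directionLift M.A M.c j (ψ z) := if_pos le_rfl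
      rw [hsU] at h4
      have h5 : (mfderiv (𝓡 m) 𝓘(ℝ, Fin (m + 1) → ℝ)
          (fun z => directionLift M.A M.c j (ψ z)) y' ξ : Fin (m + 1) → ℝ) =
          ∑ i ∈ M.A, (if i = j then 0 else η i) • M.c i := by
        have hd : MDifferentiableAt (𝓡 m) 𝓘(ℝ, Fin (m + 1) → ℝ) (directionLift M.A M.c j)
            (ψ y') := (contDiff_directionLift M.A M.c j).contMDiff.mdifferentiableAt (by simp)
        have h6 := mfderiv_comp y' hd hψd
        rw [mfderiv_eq_fderiv] at h6
        rw [← fderiv_directionLift M.A M.c (ψ y') η]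
        exact congrArg (fun f => f ξ) h6
      have h6 : ∑ i ∈ M.A, (if i = j then 0 else η i) • M.c i ∈
          U₀ ⊔ Submodule.span ℝ {x₀} := by rw [← h5]; exact h4
      obtain ⟨w, hw, u, hu, hwu⟩ := Submodule.mem_sup.1 h6
      obtain ⟨a, rfl⟩ := Submodule.mem_span_singleton.1 hu
      have h7 : ∑ i ∈ M.A, ((if i = j then 0 else η i) - a * (if i = j then 1 else ψ y' i)) •
          M.c i ∈ M.W := by
        have : w = ∑ i ∈ M.A, ((if i = j then 0 else η i) -
            a * (if i = j then 1 else ψ y' i)) • M.c i := by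
          simp only [sub_smul, Finset.sum_sub_distrib, mul_smul, ← Finset.smul_sum]
          rw [← hwu, hx₀, directionLift]
          abel
        rw [← this, hW]; exact hw
      have h8 := M.frame.indep _ h7
      have ha : a = 0 := by simpa using h8 j hj
      have hη0 : η = 0 := by
        ext i
        by_cases hi : i ∈ M.A
        · by_cases hij : i = j
          · rw [hij]; exact hηj
          · simpa [ha, hij] using h8 i hi
        · exact hηA i hi
      exact mfderiv_eq_zero_of_mem_maximalAtlas hψ.mem_maximalAtlas hyψ hη0 }⟩

/-- Two points of the exceptional divisor with the same image and the same direction coincide: the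
transversal curves through them agree away from the exceptional divisor. -/
theorem eq_of_direction_eq (hq : IsWonderful Y q L) (hL : IsStrataList L)
    (hb : IsBlowup Y Y' (properTransform q L (projSet U₀)) r) {y : Y} (M : LocalModel q L y)
    (hW : M.W = U₀) {y₁ y₂ : Y'} (h₁ : r y₁ = y) (h₂ : r y₂ = y) {j₁ j₂ : Fin m}
    {ψ₁ ψ₂ : OpenPartialHomeomorph Y' (EuclideanSpace ℝ (Fin m))} (hψ₁ : ChartOver r M j₁ ψ₁)
    (hψ₂ : ChartOver r M j₂ ψ₂) (hy₁ : y₁ ∈ ψ₁.source) (hy₂ : y₂ ∈ ψ₂.source)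
    (h : U₀ ⊔ Submodule.span ℝ {directionLift M.A M.c j₁ (ψ₁ y₁)} =
      U₀ ⊔ Submodule.span ℝ {directionLift M.A M.c j₂ (ψ₂ y₂)}) : y₁ = y₂ := by
  have hymem : y ∈ properTransform q L (projSet U₀) :=
    (M.mem_properTransform_iff (hq.dense_offStrata hL) hW _ M.mem_source).2 M.coord_eq_zero
  have h1 : directionLift M.A M.c j₁ (ψ₁ y₁) ∈
      U₀ ⊔ Submodule.span ℝ {directionLift M.A M.c j₂ (ψ₂ y₂)} := by
    rw [← h]
    exact Submodule.mem_sup_right (Submodule.mem_span_singleton_self _)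
  obtain ⟨w, hw, u, hu, hwu⟩ := Submodule.mem_sup.1 h1
  obtain ⟨a, rfl⟩ := Submodule.mem_span_singleton.1 hu
  have h2 : ∀ i ∈ M.A,
      (if i = j₁ then 1 else ψ₁ y₁ i) - a * (if i = j₂ then 1 else ψ₂ y₂ i) = 0 := by
    refine M.frame.indep _ ?_
    have : w = ∑ i ∈ M.A, ((if i = j₁ then 1 else ψ₁ y₁ i) -
        a * (if i = j₂ then 1 else ψ₂ y₂ i)) • M.c i := by
      simp only [sub_smul, Finset.sum_sub_distrib, mul_smul, ← Finset.smul_sum]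
      simp only [directionLift] at hwu
      rw [← hwu]
      abel
    rw [← this, hW]; exact hw
  -- run the second curve with speed `a`, the factor between the two directions
  have h01 : ψ₁ y₁ j₁ = 0 := (hψ₁.mem_center_iff hq hL hW hy₁).1 (by rw [h₁]; exact hymem)
  have h02 : ψ₂ y₂ j₂ = 0 := (hψ₂.mem_center_iff hq hL hW hy₂).1 (by rw [h₂]; exact hymem)
  obtain ⟨ht₁, hev₁⟩ := IsBlowup.tendsto_chart_curve ψ₁ hy₁ (EuclideanSpace.single j₁ 1)
  obtain ⟨ht₂, hev₂⟩ := IsBlowup.tendsto_chart_curve ψ₂ hy₂ (EuclideanSpace.single j₂ 1)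
  have hmul : Filter.Tendsto (fun ε : ℝ => a * ε) (𝓝 0) (𝓝 0) := by
    have : Continuous (fun ε : ℝ => a * ε) := by fun_prop
    simpa using this.tendsto 0
  have ht₂' := ht₂.comp hmul
  have hev₂' := hmul.eventually hev₂
  refine tendsto_nhds_unique_of_eventuallyEq
    (ht₁.mono_left (nhdsWithin_le_nhds (s := {(0 : ℝ)}ᶜ)))
    (ht₂'.mono_left (nhdsWithin_le_nhds (s := {(0 : ℝ)}ᶜ))) ?_
  filter_upwards [hev₁.filter_mono nhdsWithin_le_nhds, hev₂'.filter_mono nhdsWithin_le_nhds,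
    self_mem_nhdsWithin] with ε he₁ he₂ hε
  have hs₁ := ψ₁.map_target he₁
  have hs₂ := ψ₂.map_target he₂
  have hnot : r (ψ₁.symm (ψ₁ y₁ + ε • EuclideanSpace.single j₁ 1)) ∉
      properTransform q L (projSet U₀) := by
    rw [hψ₁.mem_center_iff hq hL hW hs₁, ψ₁.right_inv he₁]
    simpa [h01] using hε
  refine hb.eq_of_map_eq hnot (M.φ.injOn (hψ₁.map_mem _ hs₁) (hψ₂.map_mem _ hs₂) ?_)
  change _ = M.φ (r (ψ₂.symm (ψ₂ y₂ + (a * ε) • EuclideanSpace.single j₂ 1)))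
  rw [hψ₁.map_eq _ hs₁, hψ₂.map_eq _ hs₂, ψ₁.right_inv he₁, ψ₂.right_inv he₂]
  have hb₁ := congrArg M.φ h₁
  have hb₂ := congrArg M.φ h₂
  rw [hψ₁.map_eq _ hy₁] at hb₁
  rw [hψ₂.map_eq _ hy₂] at hb₂
  -- compare coordinates: in `A` both points are `ε` times the first direction, the others agree
  -- because the two points have the same image
  ext i
  simp only [blowdownChart_apply]
  by_cases hi : i ∈ M.A
  · have h3 := h2 i hi
    by_cases hi₁ : i = j₁ <;> by_cases hi₂ : i = j₂
    · subst hi₁; subst hi₂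
      simp only [if_true] at h3
      simp [h01, h02]; linear_combination ε * h3
    · subst hi₁
      simp only [if_true, if_neg hi₂] at h3
      simp [h01, h02, hi, hi₂]; linear_combination ε * h3
    · subst hi₂
      simp only [if_true, if_neg hi₁] at h3
      simp [h01, h02, hi, hi₁]; linear_combination ε * h3
    · simp only [if_neg hi₁, if_neg hi₂] at h3
      simp [h01, h02, hi, hi₁, hi₂]; linear_combination ε * h3
  · have h3 := congrArg (fun t => t i) (hb₁.trans hb₂.symm)
    simp only [blowdownChart_apply, hi, false_and, if_false] at h3
    have hi₁ : i ≠ j₁ := fun h => hi (h ▸ hψ₁.j_mem)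
    have hi₂ : i ≠ j₂ := fun h => hi (h ▸ hψ₂.j_mem)
    simp [hi, hi₁, hi₂, h3]

/-- The description of a successive blowup is inherited by the next blowup. -/
theorem step (hq : IsWonderful Y q L) (hL : IsStrataList L) (hU : IsNext L U₀)
    (hb : IsBlowup Y Y' (properTransform q L (projSet U₀)) r) :
    IsWonderful Y' (q ∘ r) (L ++ [projSet U₀]) where
  smooth := hq.smooth.comp hb.smooth
  existsUnique x hx := by
    obtain ⟨y, rfl, hy⟩ := hq.existsUnique x (fun T hT => hx T (by simp [hT]))
    have hyoff : y ∈ offStrata q L := fun T hT => hx T (by simp [hT])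
    have hyZ : y ∉ properTransform q L (projSet U₀) := by
      rw [hq.mem_properTransform_iff hU hyoff]
      exact hx _ (by simp)
    obtain ⟨y', -, rfl⟩ := hb.bijOn.surjOn hyZ
    refine ⟨y', rfl, fun z hz => (hb.eq_of_map_eq hyZ (hy _ hz).symm).symm⟩
  dense := hb.dense_preimage hq.dense
  compact := by
    have := hq.compact
    exact hb.compactSpace
  localModel y' := by
    by_cases hy : r y' ∈ properTransform q L (projSet U₀)
    · exact hq.localModel_over_center hL hU hb hy
    · exact hq.localModel_off_center hL hU hb hy
  separated y₁ y₂ h hs := by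
    have hr : r y₁ = r y₂ := hq.separated _ _ h fun U hUm hUL s₁ s₂ h₁ h₂ =>
      hs U hUm (List.mem_append_left _ hUL) (s₁ ∘ r) (s₂ ∘ r)
        (IsLocalLift.comp h₁ hb.smooth _) (IsLocalLift.comp h₂ hb.smooth _)
    by_cases hy : r y₁ ∈ properTransform q L (projSet U₀)
    · obtain ⟨M⟩ := hq.localModel (r y₁)
      have hW := M.W_eq_of_mem_properTransform hU hy
      obtain ⟨j₁, ψ₁, hψ₁, hy₁⟩ := hq.exists_chartOver hL hb M hW rfl
      obtain ⟨j₂, ψ₂, hψ₂, hy₂⟩ := hq.exists_chartOver hL hb M hW hr.symm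
      refine hq.eq_of_direction_eq hL hb M hW rfl hr.symm hψ₁ hψ₂ hy₁ hy₂ ?_
      have hn : ∀ j t, j ∈ M.A → directionLift M.A M.c j t ∉ U₀ := fun j t hj => by
        rw [← hW]; exact directionLift_notMem M.frame hj t
      have hl₁ := hψ₁.isLocalLift hq hL hU hW hy₁ le_rfl (hn _ _ hψ₁.j_mem)
      have hl₂ := hψ₂.isLocalLift hq hL hU hW hy₂ le_rfl (hn _ _ hψ₂.j_mem)
      have hmem : projSet U₀ ∈ L ++ [projSet U₀] := by simp
      exact hs U₀ hU.mem hmem (fun z => directionLift M.A M.c j₁ (ψ₁ z))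
        (fun z => directionLift M.A M.c j₂ (ψ₂ z)) hl₁ hl₂
    · exact hb.eq_of_map_eq hy hr

end IsWonderful

end StepOver

/-! ### Existence of blowups -/

section Represents

variable {m : ℕ}

/-- The non-zero vector `x` spans the line `l`. -/
def Represents {V : Type*} [AddCommGroup V] [Module ℝ V] (x : V) (l : ℙ ℝ V) : Prop :=
  ∃ h : x ≠ 0, Projectivization.mk ℝ x h = l

namespace Represents

section

variable {V : Type*} [AddCommGroup V] [Module ℝ V] {x x' : V} {l l' : ℙ ℝ V}

lemma unique (h : Represents x l) (h' : Represents x l') : l = l' := by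
  obtain ⟨_, rfl⟩ := h
  obtain ⟨_, rfl⟩ := h'
  rfl

lemma exists_smul (h : Represents x l) (h' : Represents x' l) : ∃ a : ℝ, a ≠ 0 ∧ x = a • x' := by
  obtain ⟨h0, rfl⟩ := h
  obtain ⟨h0', he⟩ := h'
  obtain ⟨a, ha⟩ := (Projectivization.mk_eq_mk_iff' ℝ _ _ h0 h0').1 he.symm
  refine ⟨a, fun ha0 => h0 ?_, ha.symm⟩
  rw [← ha, ha0, zero_smul]

lemma of_smul {a : ℝ} (h : Represents (a • x) l) : Represents x l := by
  obtain ⟨h0, rfl⟩ := h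
  have hx : x ≠ 0 := fun h => h0 (by rw [h, smul_zero])
  refine ⟨hx, ?_⟩
  have ha : a ≠ 0 := fun h => h0 (by rw [h, zero_smul])
  rw [Projectivization.mk_eq_mk_iff']
  exact ⟨a⁻¹, by rw [smul_smul, inv_mul_cancel₀ ha, one_smul]⟩

lemma rep (l : ℙ ℝ V) : Represents l.rep l := ⟨l.rep_nonzero, l.mk_rep⟩

lemma submodule_eq (h : Represents x l) : l.submodule = Submodule.span ℝ {x} := by
  obtain ⟨h0, rfl⟩ := h
  exact Projectivization.submodule_mk _ _

lemma of_submodule_eq (hx : x ≠ 0) (h : l.submodule = Submodule.span ℝ {x}) : Represents x l :=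
  ⟨hx, Projectivization.submodule_injective (by rw [Projectivization.submodule_mk, h])⟩

lemma map (h : Represents x l) {W : Type*} [AddCommGroup W] [Module ℝ W] (f : V →ₗ[ℝ] W)
    (hf : Function.Injective f) : Represents (f x) (l.map f hf) := by
  obtain ⟨h0, rfl⟩ := h
  exact ⟨fun h => h0 (hf (h.trans (map_zero f).symm)), (Projectivization.map_mk f hf x h0).symm⟩

end

variable {x : Fin (m + 1) → ℝ} {l : RP m}

lemma affineLift {i : Fin (m + 1)} (hl : l ∈ RP.affineOpen i) : Represents (RP.affineLift i l) l :=
  ⟨RP.affineLift_ne_zero i l, RP.mk_affineLift hl⟩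

lemma mem_projSet_iff (h : Represents x l) (U : Submodule ℝ (Fin (m + 1) → ℝ)) :
    l ∈ projSet U ↔ x ∈ U := by
  obtain ⟨h0, rfl⟩ := h
  exact mem_projSet_mk h0

end Represents

lemma continuousAt_of_represents {M : Type*} [TopologicalSpace M] {s : M → Fin (m + 1) → ℝ}
    {g : M → RP m} {z : M} (hs : ContinuousAt s z) (h : ∀ᶠ z' in 𝓝 z, Represents (s z') (g z')) :
    ContinuousAt g z := by
  obtain ⟨h0, -⟩ := h.self_of_nhds
  obtain ⟨i, hi⟩ := Function.ne_iff.1 h0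
  have hsi : ContinuousAt (fun z' => s z' i) z := (continuous_apply i).continuousAt.comp hs
  let a : M → EuclideanSpace ℝ (Fin m) := fun z' =>
    WithLp.toLp 2 fun k => s z' (i.succAbove k) / s z' i
  have ha : ContinuousAt a z := by
    refine (PiLp.continuous_toLp 2 _).continuousAt.comp (continuousAt_pi.2 fun k => ?_)
    exact ((continuous_apply _).continuousAt.comp hs).div hsi hi
  have hc : Continuous (RP.affineChart i).symm := by
    rw [← continuousOn_univ]
    exact (RP.affineChart i).continuousOn_symm
  refine (hc.continuousAt.comp ha).congr ?_
  filter_upwards [h, hsi.eventually_ne hi] with z' hz' hi'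
  obtain ⟨h0', he⟩ := hz'
  have hmem : g z' ∈ RP.affineOpen i := by
    rw [← he]; exact hi'
  have : a z' = RP.affineChart i (g z') := by
    rw [← he]; rfl
  change (RP.affineChart i).symm (a z') = g z'
  rw [this]
  exact (RP.affineChart i).left_inv hmem

/-- The quotient of two linear forms as a function on projective space. -/
noncomputable def formRatio (f f' : (Fin (m + 1) → ℝ) →ₗ[ℝ] ℝ) (l : RP m) : ℝ :=
  f l.rep / f' l.rep

lemma Represents.formRatio_eq {x : Fin (m + 1) → ℝ} {l : RP m} (h : Represents x l)
    (f f' : (Fin (m + 1) → ℝ) →ₗ[ℝ] ℝ) : formRatio f f' l = f x / f' x := by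
  obtain ⟨a, ha, he⟩ := (Represents.rep l).exists_smul h
  rw [formRatio, he, map_smul, map_smul, smul_eq_mul, smul_eq_mul, mul_div_mul_left _ _ ha]

lemma Represents.form_rep_ne_zero_iff {x : Fin (m + 1) → ℝ} {l : RP m} (h : Represents x l)
    (f : (Fin (m + 1) → ℝ) →ₗ[ℝ] ℝ) : f l.rep ≠ 0 ↔ f x ≠ 0 := by
  obtain ⟨a, ha, he⟩ := (Represents.rep l).exists_smul h
  rw [he, map_smul, smul_eq_mul]
  simp [ha]

lemma continuousAt_form_affineLift (f : (Fin (m + 1) → ℝ) →ₗ[ℝ] ℝ) {i : Fin (m + 1)} {l : RP m}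
    (hl : l ∈ RP.affineOpen i) : ContinuousAt (fun l => f (RP.affineLift i l)) l :=
  (LinearMap.continuous_of_finiteDimensional f).continuousAt.comp
    ((RP.contMDiffOn_affineLift i).contMDiffAt ((RP.isOpen_affineOpen i).mem_nhds hl)).continuousAt

lemma isOpen_form_rep_ne_zero (f : (Fin (m + 1) → ℝ) →ₗ[ℝ] ℝ) :
    IsOpen {l : RP m | f l.rep ≠ 0} := by
  rw [isOpen_iff_mem_nhds]
  intro l hl
  obtain ⟨i, hi⟩ := RP.exists_mem_affineOpen l
  have h1 := ((Represents.affineLift hi).form_rep_ne_zero_iff f).1 hl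
  filter_upwards [(continuousAt_form_affineLift f hi).eventually_ne h1,
    (RP.isOpen_affineOpen i).mem_nhds hi] with l' h2 h3
  exact ((Represents.affineLift h3).form_rep_ne_zero_iff f).2 h2

lemma continuousAt_formRatio (f f' : (Fin (m + 1) → ℝ) →ₗ[ℝ] ℝ) {l : RP m} (hl : f' l.rep ≠ 0) :
    ContinuousAt (formRatio f f') l := by
  obtain ⟨i, hi⟩ := RP.exists_mem_affineOpen l
  have h1 := ((Represents.affineLift hi).form_rep_ne_zero_iff f').1 hl
  refine ((continuousAt_form_affineLift f hi).div (continuousAt_form_affineLift f' hi) h1).congr ?_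
  filter_upwards [(RP.isOpen_affineOpen i).mem_nhds hi] with l' h3
  exact ((Represents.affineLift h3).formRatio_eq f f').symm

end Represents

section Existence

variable {m : ℕ}

/-- A closed subset `Z` of `Y` that is locally the transversal zero locus of a function with values
in `V / U`, determined up to non-vanishing factors; `P` is a projection of `V` along `U`, and `g` is
the map to projective space given by this function outside `Z`. -/
structure CenterData (Y : SmoothMfd m) where
  Z : Set Y
  U : Submodule ℝ (Fin (m + 1) → ℝ)
  P : (Fin (m + 1) → ℝ) →ₗ[ℝ] (Fin (m + 1) → ℝ)
  g : Y → RP m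
  isClosed : IsClosed Z
  ne_top : U ≠ ⊤
  P_eq_zero_iff : ∀ x, P x = 0 ↔ x ∈ U
  P_P : ∀ x, P (P x) = P x
  off : ∀ z ∉ Z, ∃ s : Y → Fin (m + 1) → ℝ, ∀ᶠ z' in 𝓝 z,
    ContMDiffAt (𝓡 m) 𝓘(ℝ, Fin (m + 1) → ℝ) ∞ s z' ∧ Represents (P (s z')) (g z')
  near_center : ∀ z ∈ Z, ∃ φ ∈ IsManifold.maximalAtlas (𝓡 m) ∞ Y, z ∈ φ.source ∧
    ∃ (A : Finset (Fin m)) (c : Fin m → Fin (m + 1) → ℝ), IsFrame U A c ∧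
      (∀ x ∈ φ.source, x ∈ Z ↔ ∀ i ∈ A, φ x i = 0) ∧
      ∀ x ∈ φ.source, x ∉ Z → Represents (P (∑ i ∈ A, φ x i • c i)) (g x)

namespace CenterData

variable {Y : SmoothMfd m} (D : CenterData Y)

lemma sub_P_mem (x : Fin (m + 1) → ℝ) : x - D.P x ∈ D.U := by
  rw [← D.P_eq_zero_iff, map_sub, D.P_P, sub_self]

lemma P_ne_zero {x : Fin (m + 1) → ℝ} (hx : x ∉ D.U) : D.P x ≠ 0 := fun h =>
  hx ((D.P_eq_zero_iff x).1 h)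

lemma P_eq_self {x : Fin (m + 1) → ℝ} (hx : x ∈ LinearMap.range D.P) : D.P x = x := by
  obtain ⟨y, rfl⟩ := hx
  exact D.P_P y

/-- The blowup: over a point of `Z` all the lines in the image of `P`, over any other point `y` the
line `g y`. -/
def total : Set (Y × RP m) :=
  {w | (w.1 ∈ D.Z → w.2 ∈ projSet (LinearMap.range D.P)) ∧ (w.1 ∉ D.Z → w.2 = D.g w.1)}

lemma exists_line : ∃ l : RP m, l ∈ projSet (LinearMap.range D.P) := by
  obtain ⟨x, -, hx⟩ := SetLike.exists_of_lt D.ne_top.lt_top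
  exact ⟨Projectivization.mk ℝ (D.P x) (D.P_ne_zero hx), (mem_projSet_mk _).2 ⟨x, rfl⟩⟩

open Classical in
/-- A section of the projection from the blowup. -/
noncomputable def sec (z : Y) : D.total :=
  ⟨(z, if z ∈ D.Z then D.exists_line.choose else D.g z), fun h => by
    simp only at h ⊢
    rw [if_pos h]; exact D.exists_line.choose_spec, fun h => by
    simp only at h ⊢
    rw [if_neg h]⟩

lemma sec_snd {z : Y} (hz : z ∉ D.Z) : (D.sec z).1.2 = D.g z := if_neg hz

/-- A map to the blowup is smooth if its first component is and its second component lifts to a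
smooth map to `V`. -/
def SmoothAt (ζ : EuclideanSpace ℝ (Fin m) → D.total) (t : EuclideanSpace ℝ (Fin m)) : Prop :=
  ContMDiffAt (𝓡 m) (𝓡 m) ∞ (fun t => (ζ t).1.1) t ∧
    ∃ σ : EuclideanSpace ℝ (Fin m) → Fin (m + 1) → ℝ, ContDiffAt ℝ ∞ σ t ∧
      ∀ᶠ t' in 𝓝 t, Represents (D.P (σ t')) (ζ t').1.2

/-- The charts of the blowup: those that detect smoothness of maps and have smooth inverse. -/
structure IsGoodChart (e : OpenPartialHomeomorph D.total (EuclideanSpace ℝ (Fin m))) : Prop where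
  symm_smooth : ∀ t ∈ e.target, D.SmoothAt e.symm t
  smooth : ∀ ζ t, D.SmoothAt ζ t → ζ t ∈ e.source → ContDiffAt ℝ ∞ (fun t => e (ζ t)) t

lemma continuousAt_g {z : Y} (hz : z ∉ D.Z) : ContinuousAt D.g z := by
  obtain ⟨s, hs⟩ := D.off z hz
  refine continuousAt_of_represents (s := fun z => D.P (s z)) ?_ (hs.mono fun z h => h.2)
  exact (LinearMap.continuous_of_finiteDimensional D.P).continuousAt.comp
    hs.self_of_nhds.1.continuousAt

/-- The chart of the blowup induced by a chart of `Y` outside the center. -/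
noncomputable def chartOff (φ : OpenPartialHomeomorph Y (EuclideanSpace ℝ (Fin m))) :
    OpenPartialHomeomorph D.total (EuclideanSpace ℝ (Fin m)) where
  toFun w := φ w.1.1
  invFun t := D.sec (φ.symm t)
  source := {w | w.1.1 ∈ φ.source ∧ w.1.1 ∉ D.Z}
  target := φ.target ∩ φ.symm ⁻¹' D.Zᶜ
  map_source' w hw := ⟨φ.map_source hw.1, by
    change φ.symm (φ w.1.1) ∉ D.Z
    rw [φ.left_inv hw.1]; exact hw.2⟩
  map_target' t ht := ⟨φ.map_target ht.1, ht.2⟩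
  left_inv' w hw := by
    refine Subtype.ext (Prod.ext ?_ ?_)
    · exact φ.left_inv hw.1
    · rw [φ.left_inv hw.1, D.sec_snd hw.2, w.2.2 hw.2]
  right_inv' t ht := φ.right_inv ht.1
  open_source :=
    (φ.open_source.inter D.isClosed.isOpen_compl).preimage
      (continuous_fst.comp continuous_subtype_val)
  open_target := φ.continuousOn_symm.isOpen_inter_preimage φ.open_target D.isClosed.isOpen_compl
  continuousOn_toFun := φ.continuousOn.comp
    (continuous_fst.comp continuous_subtype_val).continuousOn fun w hw => hw.1
  continuousOn_invFun := by
    rw [Topology.IsInducing.subtypeVal.continuousOn_iff]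
    have h1 : ContinuousOn φ.symm (φ.target ∩ φ.symm ⁻¹' D.Zᶜ) :=
      φ.continuousOn_symm.mono inter_subset_left
    have h2 : ContinuousOn (fun t => D.g (φ.symm t)) (φ.target ∩ φ.symm ⁻¹' D.Zᶜ) :=
      ContinuousOn.comp (g := D.g) (t := D.Zᶜ)
        (fun z hz => (D.continuousAt_g hz).continuousWithinAt) h1 fun t ht => ht.2
    refine (h1.prodMk h2).congr fun t ht => ?_
    exact Prod.ext rfl (D.sec_snd ht.2)

lemma isGoodChart_chartOff {φ : OpenPartialHomeomorph Y (EuclideanSpace ℝ (Fin m))}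
    (hφ : φ ∈ IsManifold.maximalAtlas (𝓡 m) ∞ Y) : D.IsGoodChart (D.chartOff φ) where
  symm_smooth t ht := by
    have hφt : ContMDiffAt (𝓡 m) (𝓡 m) ∞ φ.symm t := contMDiffAt_symm_of_mem_maximalAtlas hφ ht.1
    refine ⟨hφt, ?_⟩
    obtain ⟨s, hs⟩ := D.off (φ.symm t) ht.2
    refine ⟨fun t => s (φ.symm t), ?_, ?_⟩
    · rw [← contMDiffAt_iff_contDiffAt]
      exact hs.self_of_nhds.1.comp t hφt
    · filter_upwards [hφt.continuousAt.eventually hs,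
        (D.chartOff φ).open_target.mem_nhds ht] with t' h1 h2
      change Represents (D.P (s (φ.symm t'))) (D.sec (φ.symm t')).1.2
      rw [D.sec_snd h2.2]
      exact h1.2
  smooth ζ t hζ ht := by
    rw [← contMDiffAt_iff_contDiffAt]
    exact ContMDiffAt.comp (g := φ) (f := fun t => (ζ t).1.1) t
      (contMDiffAt_of_mem_maximalAtlas hφ ht.1) hζ.1

section Over

variable {φ : OpenPartialHomeomorph Y (EuclideanSpace ℝ (Fin m))} {A : Finset (Fin m)}
  {c : Fin m → Fin (m + 1) → ℝ} {f : Fin m → (Fin (m + 1) → ℝ) →ₗ[ℝ] ℝ}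

/-- A chart of `Y` in which the center is a coordinate subspace, with a dual frame. -/
structure OverData (φ : OpenPartialHomeomorph Y (EuclideanSpace ℝ (Fin m))) (A : Finset (Fin m))
    (c : Fin m → Fin (m + 1) → ℝ) (f : Fin m → (Fin (m + 1) → ℝ) →ₗ[ℝ] ℝ) : Prop where
  φ_mem : φ ∈ IsManifold.maximalAtlas (𝓡 m) ∞ Y
  frame : IsFrame D.U A c
  mem_iff : ∀ x ∈ φ.source, x ∈ D.Z ↔ ∀ i ∈ A, φ x i = 0
  represents : ∀ x ∈ φ.source, x ∉ D.Z → Represents (D.P (∑ i ∈ A, φ x i • c i)) (D.g x)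
  sub_mem : ∀ x, x - ∑ i ∈ A, f i x • c i ∈ D.U
  dual : ∀ a : Fin m → ℝ, ∀ w ∈ D.U, ∀ i ∈ A, f i (w + ∑ k ∈ A, a k • c k) = a i

variable {D}

lemma OverData.dual_P (h : D.OverData φ A c f) (x : Fin (m + 1) → ℝ) {i : Fin m} (hi : i ∈ A) :
    f i (D.P x) = f i x := by
  have h1 : D.P x = (-(x - D.P x) + (x - ∑ i ∈ A, f i x • c i)) + ∑ i ∈ A, f i x • c i := by abel
  rw [h1]
  exact h.dual _ _ (D.U.add_mem (D.U.neg_mem (D.sub_P_mem x)) (h.sub_mem x)) i hi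

lemma OverData.dual_sum (h : D.OverData φ A c f) (a : Fin m → ℝ) {i : Fin m} (hi : i ∈ A) :
    f i (D.P (∑ k ∈ A, a k • c k)) = a i := by
  rw [h.dual_P _ hi]
  simpa using h.dual a 0 D.U.zero_mem i hi

lemma OverData.eq_P_sum (h : D.OverData φ A c f) {v : Fin (m + 1) → ℝ}
    (hv : v ∈ LinearMap.range D.P) : v = D.P (∑ i ∈ A, f i v • c i) := by
  have h1 := (D.P_eq_zero_iff _).2 (h.sub_mem v)
  rw [map_sub, sub_eq_zero, D.P_eq_self hv] at h1
  exact h1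

lemma OverData.P_directionLift_ne_zero (h : D.OverData φ A c f) {j : Fin m} (hj : j ∈ A)
    (t : EuclideanSpace ℝ (Fin m)) : D.P (directionLift A c j t) ≠ 0 :=
  D.P_ne_zero (directionLift_notMem h.frame hj t)

/-- The point of the blowup with coordinates `t` in the `j`-th standard chart. -/
lemma OverData.mem_total (h : D.OverData φ A c f) {j : Fin m} (hj : j ∈ A)
    {t : EuclideanSpace ℝ (Fin m)} (ht : blowdownChart A j t ∈ φ.target) :
    ((φ.symm (blowdownChart A j t), Projectivization.mk ℝ (D.P (directionLift A c j t))
      (h.P_directionLift_ne_zero hj t)) : Y × RP m) ∈ D.total := by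
  refine ⟨fun _ => (mem_projSet_mk _).2 ⟨_, rfl⟩, fun hZ => ?_⟩
  have h1 := h.represents _ (φ.map_target ht) hZ
  rw [φ.right_inv ht, sum_blowdownChart_smul, map_smul] at h1
  exact Represents.unique ⟨_, rfl⟩ h1.of_smul

lemma OverData.coord_eq (h : D.OverData φ A c f) {j : Fin m} (hj : j ∈ A) {w : D.total}
    (hw : w.1.1 ∈ φ.source) (hf : f j w.1.2.rep ≠ 0) {i : Fin m} (hi : i ∈ A) :
    φ w.1.1 j * formRatio (f i) (f j) w.1.2 = φ w.1.1 i := by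
  by_cases hZ : w.1.1 ∈ D.Z
  · have h0 := (h.mem_iff _ hw).1 hZ
    rw [h0 i hi, h0 j hj, zero_mul]
  · have h1 := h.represents _ hw hZ
    rw [← w.2.2 hZ] at h1
    have h2 := (h1.form_rep_ne_zero_iff (f j)).1 hf
    rw [h1.formRatio_eq, h.dual_sum _ hi]
    rw [h.dual_sum _ hj] at h2 ⊢
    field_simp

open Classical in
/-- The `j`-th standard chart of the blowup over a chart of `Y` in which the center is a coordinate
subspace. -/
noncomputable def OverData.chart (h : D.OverData φ A c f) {j : Fin m} (hj : j ∈ A) :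
    OpenPartialHomeomorph D.total (EuclideanSpace ℝ (Fin m)) where
  -- the ratios of coordinates are read off from the line, the others from the point of `Y`
  toFun w := WithLp.toLp 2 fun i =>
    if i ∈ A ∧ i ≠ j then formRatio (f i) (f j) w.1.2 else φ w.1.1 i
  invFun t := if ht : blowdownChart A j t ∈ φ.target then ⟨_, h.mem_total hj ht⟩
    else D.sec (φ.symm t)
  source := {w | w.1.1 ∈ φ.source ∧ f j w.1.2.rep ≠ 0}
  target := blowdownChart A j ⁻¹' φ.target
  map_source' w hw := by
    have : blowdownChart A j (WithLp.toLp 2 fun i =>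
        if i ∈ A ∧ i ≠ j then formRatio (f i) (f j) w.1.2 else φ w.1.1 i) = φ w.1.1 := by
      ext i
      rw [blowdownChart_apply]
      split_ifs with hi
      · simpa [hi] using h.coord_eq hj hw.1 hw.2 hi.1
      · simp [hi]
    change blowdownChart A j _ ∈ φ.target
    rw [this]
    exact φ.map_source hw.1
  map_target' t ht := by
    replace ht : blowdownChart A j t ∈ φ.target := ht
    rw [dif_pos ht]
    refine ⟨φ.map_target ht, ?_⟩
    have hr : Represents (D.P (directionLift A c j t)) (Projectivization.mk ℝ
      (D.P (directionLift A c j t)) (h.P_directionLift_ne_zero hj t)) := ⟨_, rfl⟩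
    rw [hr.form_rep_ne_zero_iff, directionLift, h.dual_sum _ hj, if_pos rfl]
    exact one_ne_zero
  left_inv' w hw := by
    set t : EuclideanSpace ℝ (Fin m) := WithLp.toLp 2 fun i =>
        if i ∈ A ∧ i ≠ j then formRatio (f i) (f j) w.1.2 else φ w.1.1 i with htdef
    have hβ : blowdownChart A j t = φ w.1.1 := by
      ext i
      rw [blowdownChart_apply]
      split_ifs with hi
      · simpa [t, hi] using h.coord_eq hj hw.1 hw.2 hi.1
      · simp [t, hi]
    have ht : blowdownChart A j t ∈ φ.target := by rw [hβ]; exact φ.map_source hw.1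
    rw [dif_pos ht]
    refine Subtype.ext (Prod.ext ?_ ?_)
    · change φ.symm (blowdownChart A j t) = w.1.1
      rw [hβ, φ.left_inv hw.1]
    · have hrange : w.1.2.rep ∈ LinearMap.range D.P := by
        rw [← (Represents.rep w.1.2).mem_projSet_iff]
        by_cases hZ : w.1.1 ∈ D.Z
        · exact w.2.1 hZ
        · rw [w.2.2 hZ, (h.represents _ hw.1 hZ).mem_projSet_iff]
          exact ⟨_, rfl⟩
      have h1 : w.1.2.rep = f j w.1.2.rep • D.P (directionLift A c j t) := by
        conv_lhs => rw [h.eq_P_sum hrange]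
        rw [← map_smul, directionLift, Finset.smul_sum]
        congr 1
        refine Finset.sum_congr rfl fun i hi => ?_
        rw [smul_smul]
        congr 1
        by_cases hij : i = j
        · rw [if_pos hij, mul_one, hij]
        · rw [if_neg hij]
          have : t i = f i w.1.2.rep / f j w.1.2.rep := by
            simp [t, hi, hij, formRatio]
          rw [this]
          field_simp [hw.2]
      have h2 := Represents.rep w.1.2
      rw [h1] at h2
      exact Represents.unique ⟨_, rfl⟩ h2.of_smul
  right_inv' t ht := by
    replace ht : blowdownChart A j t ∈ φ.target := ht
    rw [dif_pos ht]
    have hr : Represents (D.P (directionLift A c j t)) (Projectivization.mk ℝ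
      (D.P (directionLift A c j t)) (h.P_directionLift_ne_zero hj t)) := ⟨_, rfl⟩
    ext i
    change (if i ∈ A ∧ i ≠ j then formRatio (f i) (f j) _ else
      φ (φ.symm (blowdownChart A j t)) i) = t i
    split_ifs with hi
    · rw [hr.formRatio_eq, directionLift, h.dual_sum _ hj, h.dual_sum _ hi.1, if_pos rfl,
        if_neg hi.2, div_one]
    · rw [φ.right_inv ht, blowdownChart_apply, if_neg hi]
  open_source := by
    refine IsOpen.inter ?_ ?_
    · exact φ.open_source.preimage (continuous_fst.comp continuous_subtype_val)
    · exact (isOpen_form_rep_ne_zero (f j)).preimage (continuous_snd.comp continuous_subtype_val)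
  open_target := φ.open_target.preimage (contDiff_blowdownChart A j).continuous
  continuousOn_toFun := by
    refine (PiLp.continuous_toLp 2 _).comp_continuousOn (continuousOn_pi.2 fun i => ?_)
    split_ifs with hi
    · intro w hw
      exact (ContinuousAt.comp (g := formRatio (f i) (f j)) (f := fun w : D.total => w.1.2)
        (continuousAt_formRatio (f i) (f j) hw.2)
        (continuous_snd.comp continuous_subtype_val).continuousAt).continuousWithinAt
    · exact (EuclideanSpace.proj (𝕜 := ℝ) i).continuous.comp_continuousOn
        (φ.continuousOn.comp (continuous_fst.comp continuous_subtype_val).continuousOn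
          fun w hw => hw.1)
  continuousOn_invFun := by
    rw [Topology.IsInducing.subtypeVal.continuousOn_iff]
    have h1 : ContinuousOn (fun t => φ.symm (blowdownChart A j t))
        (blowdownChart A j ⁻¹' φ.target) :=
      φ.continuousOn_symm.comp (contDiff_blowdownChart A j).continuous.continuousOn fun t ht => ht
    have h2 : Continuous (fun t => Projectivization.mk ℝ (D.P (directionLift A c j t))
        (h.P_directionLift_ne_zero hj t)) :=
      RP.continuous_mk ((LinearMap.continuous_of_finiteDimensional D.P).comp
        (contDiff_directionLift A c j).continuous) _
    refine (h1.prodMk h2.continuousOn).congr fun t ht => ?_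
    replace ht : blowdownChart A j t ∈ φ.target := ht
    simp only [Function.comp]
    rw [dif_pos ht]

lemma OverData.chart_apply (h : D.OverData φ A c f) {j : Fin m} (hj : j ∈ A) (w : D.total)
    (i : Fin m) : h.chart hj w i =
      if i ∈ A ∧ i ≠ j then formRatio (f i) (f j) w.1.2 else φ w.1.1 i := rfl

lemma OverData.chart_symm (h : D.OverData φ A c f) {j : Fin m} (hj : j ∈ A)
    {t : EuclideanSpace ℝ (Fin m)} (ht : blowdownChart A j t ∈ φ.target) :
    (h.chart hj).symm t = ⟨_, h.mem_total hj ht⟩ := dif_pos ht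

lemma OverData.blowdownChart_chart (h : D.OverData φ A c f) {j : Fin m} (hj : j ∈ A)
    {w : D.total} (hw : w ∈ (h.chart hj).source) :
    φ w.1.1 = blowdownChart A j (h.chart hj w) := by
  ext i
  rw [blowdownChart_apply]
  split_ifs with hi
  · rw [chart_apply, chart_apply, if_pos hi, if_neg (by simp)]
    exact (h.coord_eq hj hw.1 hw.2 hi.1).symm
  · rw [chart_apply, if_neg hi]

lemma OverData.isGoodChart (h : D.OverData φ A c f) {j : Fin m} (hj : j ∈ A) :
    D.IsGoodChart (h.chart hj) where
  symm_smooth t ht := by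
    have hev : ∀ᶠ t' in 𝓝 t, blowdownChart A j t' ∈ φ.target :=
      (h.chart hj).open_target.mem_nhds ht
    refine ⟨?_, directionLift A c j, (contDiff_directionLift A c j).contDiffAt, ?_⟩
    · have h1 : ContMDiffAt (𝓡 m) (𝓡 m) ∞ (fun t => φ.symm (blowdownChart A j t)) t :=
        ContMDiffAt.comp (g := φ.symm) t (contMDiffAt_symm_of_mem_maximalAtlas h.φ_mem ht)
          (contDiff_blowdownChart A j).contMDiff.contMDiffAt
      refine h1.congr_of_eventuallyEq ?_
      filter_upwards [hev] with t' ht'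
      rw [h.chart_symm hj ht']
    · filter_upwards [hev] with t' ht'
      rw [h.chart_symm hj ht']
      exact ⟨_, rfl⟩
  smooth ζ t hζ ht := by
    obtain ⟨h1, σ, hσ, hrep⟩ := hζ
    rw [contDiffAt_euclidean]
    intro i
    simp only [chart_apply]
    have hP : ∀ k, ContDiffAt ℝ ∞ (fun t => f k (D.P (σ t))) t := fun k =>
      ((f k).comp D.P).toContinuousLinearMap.contDiff.contDiffAt.comp t hσ
    split_ifs with hi
    · have h0 := (hrep.self_of_nhds.form_rep_ne_zero_iff (f j)).1 ht.2
      refine ((hP i).div (hP j) h0).congr_of_eventuallyEq ?_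
      filter_upwards [hrep] with t' ht'
      exact ht'.formRatio_eq _ _
    · have h2 : ContDiffAt ℝ ∞ (fun t => φ (ζ t).1.1) t := by
        rw [← contMDiffAt_iff_contDiffAt]
        exact ContMDiffAt.comp (g := φ) (f := fun t => (ζ t).1.1) t
          (contMDiffAt_of_mem_maximalAtlas h.φ_mem ht.1) h1
      exact contDiffAt_euclidean.1 h2 i

end Over

lemma exists_overData {z : Y} (hz : z ∈ D.Z) : ∃ φ A c f, D.OverData φ A c f ∧ z ∈ φ.source := by
  obtain ⟨φ, hφ, hzφ, A, c, hc, h1, h2⟩ := D.near_center z hz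
  obtain ⟨f, hf, hf'⟩ := hc.exists_dual
  exact ⟨φ, A, c, f, ⟨hφ, hc, h1, h2, hf, hf'⟩, hzφ⟩

variable {D} in
lemma OverData.exists_mem_source {φ : OpenPartialHomeomorph Y (EuclideanSpace ℝ (Fin m))}
    {A : Finset (Fin m)} {c : Fin m → Fin (m + 1) → ℝ} {f : Fin m → (Fin (m + 1) → ℝ) →ₗ[ℝ] ℝ}
    (h : D.OverData φ A c f) {w : D.total} (hw : w.1.1 ∈ φ.source) :
    ∃ j, ∃ hj : j ∈ A, w ∈ (h.chart hj).source := by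
  have hrange : w.1.2.rep ∈ LinearMap.range D.P := by
    rw [← (Represents.rep w.1.2).mem_projSet_iff]
    by_cases hZ : w.1.1 ∈ D.Z
    · exact w.2.1 hZ
    · rw [w.2.2 hZ, (h.represents _ hw hZ).mem_projSet_iff]
      exact ⟨_, rfl⟩
  by_contra! hcon
  have h0 : ∀ i ∈ A, f i w.1.2.rep = 0 := fun i hi => by
    by_contra hne
    exact hcon i hi ⟨hw, hne⟩
  apply w.1.2.rep_nonzero
  rw [h.eq_P_sum hrange, Finset.sum_eq_zero fun i hi => by rw [h0 i hi, zero_smul], map_zero]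

lemma exists_isGoodChart (w : D.total) : ∃ e, D.IsGoodChart e ∧ w ∈ e.source := by
  by_cases hw : w.1.1 ∈ D.Z
  · obtain ⟨φ, A, c, f, h, hz⟩ := D.exists_overData hw
    obtain ⟨j, hj, hwj⟩ := h.exists_mem_source hz
    exact ⟨_, h.isGoodChart hj, hwj⟩
  · exact ⟨_, D.isGoodChart_chartOff (IsManifold.chart_mem_maximalAtlas w.1.1),
      mem_chart_source _ _, hw⟩

noncomputable instance : ChartedSpace (EuclideanSpace ℝ (Fin m)) D.total where
  atlas := {e | D.IsGoodChart e}
  chartAt w := (D.exists_isGoodChart w).choose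
  mem_chart_source w := (D.exists_isGoodChart w).choose_spec.2
  chart_mem_atlas w := (D.exists_isGoodChart w).choose_spec.1

instance : IsManifold (𝓡 m) ∞ D.total := by
  refine isManifold_of_contDiffOn _ _ _ ?_
  -- `e'` carries smooth maps to the blowup to smooth maps, and `e.symm` is one of them
  rintro e e' he he' t ⟨⟨ht, ht'⟩, -⟩
  exact (IsGoodChart.smooth he' e.symm t (IsGoodChart.symm_smooth he t ht) ht').contDiffWithinAt

/-- The blowup as a bundled manifold. -/
noncomputable def blowup : SmoothMfd m := ⟨D.total⟩

/-- The blowdown map. -/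
def blowdown (w : D.blowup) : Y := w.1.1

end CenterData

end Existence

namespace CenterData

variable {m : ℕ} {Y : SmoothMfd m} (D : CenterData Y)

lemma IsGoodChart.mem_maximalAtlas {e : OpenPartialHomeomorph D.total (EuclideanSpace ℝ (Fin m))}
    (he : D.IsGoodChart e) : e ∈ IsManifold.maximalAtlas (𝓡 m) ∞ D.blowup :=
  IsManifold.subset_maximalAtlas (M := D.blowup) he

lemma contMDiff_blowdown : ContMDiff (𝓡 m) (𝓡 m) ∞ D.blowdown := by
  intro w
  obtain ⟨e, he, hw⟩ := D.exists_isGoodChart w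
  have h1 : ContMDiffAt (𝓡 m) (𝓡 m) ∞ (fun w : D.blowup => (e.symm (e w)).1.1) w :=
    ContMDiffAt.comp (M := D.blowup) (g := fun t => (e.symm t).1.1) w
      (he.symm_smooth _ (e.map_source hw)).1
      (contMDiffAt_of_mem_maximalAtlas (M := D.blowup) (IsGoodChart.mem_maximalAtlas D he) hw)
  refine h1.congr_of_eventuallyEq ?_
  filter_upwards [e.open_source.mem_nhds hw] with w' hw'
  rw [e.left_inv hw']
  rfl

lemma isLocalDiffeomorphAt_blowdown (w : D.blowup) (hw : D.blowdown w ∉ D.Z) :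
    IsLocalDiffeomorphAt (𝓡 m) (𝓡 m) ∞ D.blowdown w := by
  set φ := chartAt (EuclideanSpace ℝ (Fin m)) (D.blowdown w)
  have hφ : φ ∈ IsManifold.maximalAtlas (𝓡 m) ∞ Y := IsManifold.chart_mem_maximalAtlas _
  have he := IsGoodChart.mem_maximalAtlas D (D.isGoodChart_chartOff hφ)
  refine ⟨{ toFun := D.blowdown
            invFun := D.sec
            source := {w | D.blowdown w ∈ φ.source ∧ D.blowdown w ∉ D.Z}
            target := φ.source ∩ D.Zᶜ
            map_source' := fun w hw => hw
            map_target' := fun z hz => hz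
            left_inv' := fun w hw => by
              refine Subtype.ext (Prod.ext rfl ?_)
              exact (D.sec_snd hw.2).trans (w.2.2 hw.2).symm
            right_inv' := fun z hz => rfl
            open_source := (φ.open_source.inter D.isClosed.isOpen_compl).preimage
              D.contMDiff_blowdown.continuous
            open_target := φ.open_source.inter D.isClosed.isOpen_compl
            contMDiffOn_toFun := D.contMDiff_blowdown.contMDiffOn
            contMDiffOn_invFun := fun z hz => ?_ }, ⟨mem_chart_source _ _, hw⟩, fun _ _ => rfl⟩
  have ht : φ z ∈ (D.chartOff φ).target := ⟨φ.map_source hz.1, by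
    change φ.symm (φ z) ∉ D.Z
    rw [φ.left_inv hz.1]; exact hz.2⟩
  have h1 : ContMDiffAt (𝓡 m) (𝓡 m) ∞ (fun z => ((D.chartOff φ).symm (φ z) : D.blowup)) z :=
    ContMDiffAt.comp (M'' := D.blowup) (g := (D.chartOff φ).symm) z
      (contMDiffAt_symm_of_mem_maximalAtlas (M := D.blowup) he ht)
      (contMDiffAt_of_mem_maximalAtlas hφ hz.1)
  refine (h1.congr_of_eventuallyEq ?_).contMDiffWithinAt
  filter_upwards [φ.open_source.mem_nhds hz.1] with z' hz'
  change D.sec z' = D.sec (φ.symm (φ z'))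
  rw [φ.left_inv hz']

theorem isBlowup : IsBlowup Y D.blowup D.Z D.blowdown where
  isClosed_center := D.isClosed
  smooth := D.contMDiff_blowdown
  bijOn := by
    refine ⟨fun w hw => hw, ?_, fun z hz => ⟨D.sec z, hz, rfl⟩⟩
    intro w hw w' hw' h
    refine Subtype.ext (Prod.ext h ?_)
    exact (w.2.2 hw).trans ((congrArg D.g h).trans (w'.2.2 hw').symm)
  localDiffeo := D.isLocalDiffeomorphAt_blowdown
  localModel z hz := by
    obtain ⟨φ, A, c, f, h, hzφ⟩ := D.exists_overData hz
    have hw0 : (D.sec z).1.1 ∈ φ.source := hzφ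
    obtain ⟨j₀, hj₀, -⟩ := h.exists_mem_source hw0
    refine ⟨φ, h.φ_mem, hzφ, A, ⟨j₀, hj₀⟩, h.mem_iff, ?_⟩
    classical
    -- the standard charts exist only for `j ∈ A`; the values at other indices are irrelevant
    obtain ⟨ψ, hψ⟩ : ∃ ψ : Fin m → OpenPartialHomeomorph D.blowup (EuclideanSpace ℝ (Fin m)),
        ∀ j (hj : j ∈ A), ψ j = h.chart hj :=
      ⟨fun j => if hj : j ∈ A then h.chart hj else h.chart hj₀, fun j hj => dif_pos hj⟩
    refine ⟨ψ, fun j hj => ?_, ?_⟩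
    · rw [hψ j hj]
      exact ⟨IsGoodChart.mem_maximalAtlas D (h.isGoodChart hj), rfl,
        fun w hw => ⟨hw.1, h.blowdownChart_chart hj hw⟩⟩
    · intro w hw
      obtain ⟨j, hj, hwj⟩ := h.exists_mem_source (w := w) hw
      refine mem_iUnion₂.2 ⟨j, hj, ?_⟩
      rw [hψ j hj]
      exact hwj

end CenterData

/-! ### Lifts of the maps to `ℙ(V/U)` -/

section LineMap

variable {m : ℕ}

/-- A projection of `V` with kernel `U`. It identifies `ℙ(V/U)` with a subspace of `ℙ(V)`. -/
noncomputable def projAlong (U : Submodule ℝ (Fin (m + 1) → ℝ)) :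
    (Fin (m + 1) → ℝ) →ₗ[ℝ] (Fin (m + 1) → ℝ) :=
  (exists_isCompl U).choose.projection U (exists_isCompl U).choose_spec.symm

lemma projAlong_eq_zero_iff {U : Submodule ℝ (Fin (m + 1) → ℝ)} {x : Fin (m + 1) → ℝ} :
    projAlong U x = 0 ↔ x ∈ U :=
  Submodule.projection_apply_eq_zero_iff _

lemma projAlong_projAlong (U : Submodule ℝ (Fin (m + 1) → ℝ)) (x : Fin (m + 1) → ℝ) :
    projAlong U (projAlong U x) = projAlong U x :=
  congrArg (fun f => f x)
    (Submodule.isIdempotentElem_projection (exists_isCompl U).choose_spec.symm)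

lemma exists_projAlong_eq_smul {U : Submodule ℝ (Fin (m + 1) → ℝ)} {x x' : Fin (m + 1) → ℝ}
    (hx : x ∉ U) (h : U ⊔ Submodule.span ℝ {x} = U ⊔ Submodule.span ℝ {x'}) :
    ∃ a : ℝ, a ≠ 0 ∧ projAlong U x = a • projAlong U x' := by
  have h1 : x ∈ U ⊔ Submodule.span ℝ {x'} :=
    h ▸ Submodule.mem_sup_right (Submodule.mem_span_singleton_self x)
  obtain ⟨w, hw, u, hu, rfl⟩ := Submodule.mem_sup.1 h1
  obtain ⟨a, rfl⟩ := Submodule.mem_span_singleton.1 hu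
  refine ⟨a, ?_, by rw [map_add, projAlong_eq_zero_iff.2 hw, zero_add, map_smul]⟩
  rintro rfl
  exact hx (by simpa using hw)

lemma sup_span_eq_of_projAlong_eq_smul {U : Submodule ℝ (Fin (m + 1) → ℝ)}
    {x x' : Fin (m + 1) → ℝ} {a : ℝ} (ha : a ≠ 0) (h : projAlong U x = a • projAlong U x') :
    U ⊔ Submodule.span ℝ {x} = U ⊔ Submodule.span ℝ {x'} := by
  have key : ∀ (y y' : Fin (m + 1) → ℝ) (b : ℝ), projAlong U y = b • projAlong U y' →
      U ⊔ Submodule.span ℝ {y} ≤ U ⊔ Submodule.span ℝ {y'} := by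
    intro y y' b hb
    refine sup_le le_sup_left ?_
    rw [Submodule.span_singleton_le_iff_mem, Submodule.mem_sup]
    refine ⟨y - b • y', ?_, b • y', Submodule.smul_mem _ _ (Submodule.mem_span_singleton_self _),
      by simp⟩
    rw [← projAlong_eq_zero_iff, map_sub, map_smul, hb, sub_self]
  refine le_antisymm (key _ _ a h) (key _ _ a⁻¹ ?_)
  rw [h, smul_smul, inv_mul_cancel₀ ha, one_smul]

lemma exists_eq_smul_of_minors {u v : Fin (m + 1) → ℝ} (hu : u ≠ 0) (hv : v ≠ 0)
    (h : ∀ i j, u i * v j = u j * v i) : ∃ a : ℝ, a ≠ 0 ∧ u = a • v := by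
  obtain ⟨i, hi⟩ := Function.ne_iff.1 hv
  replace hi : v i ≠ 0 := hi
  have hua : u = (u i / v i) • v := by
    ext j
    simp only [Pi.smul_apply, smul_eq_mul]
    field_simp
    linarith [h i j]
  refine ⟨u i / v i, fun h0 => hu ?_, hua⟩
  rw [hua, h0, zero_smul]

variable {Y : SmoothMfd m} {q : Y → RP m} {L : List (Set (RP m))}
  {U : Submodule ℝ (Fin (m + 1) → ℝ)}

lemma IsLocalLift.eventually {y : Y} {s : Y → Fin (m + 1) → ℝ} (h : IsLocalLift q L U y s) :
    ∀ᶠ z in 𝓝 y, IsLocalLift q L U z s := eventually_eventually_nhds.2 h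

lemma continuousAt_projAlong (U : Submodule ℝ (Fin (m + 1) → ℝ)) {M : Type*} [TopologicalSpace M]
    {s : M → Fin (m + 1) → ℝ} {y : M} (h : ContinuousAt s y) :
    ContinuousAt (fun z => projAlong U (s z)) y :=
  (LinearMap.continuous_of_finiteDimensional (projAlong U)).continuousAt.comp h

/-- Two lifts differ by a non-vanishing factor, since they do so on a dense set. -/
theorem IsLocalLift.sup_span_eq (hd : Dense (offStrata q L)) {y : Y}
    {s s' : Y → Fin (m + 1) → ℝ} (h : IsLocalLift q L U y s) (h' : IsLocalLift q L U y s') :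
    U ⊔ Submodule.span ℝ {s y} = U ⊔ Submodule.span ℝ {s' y} := by
  have h0 := h.self_of_nhds
  have h0' := h'.self_of_nhds
  -- proportionality is the vanishing of the 2×2 minors, a closed condition
  have hminor : ∀ i j, projAlong U (s y) i * projAlong U (s' y) j =
      projAlong U (s y) j * projAlong U (s' y) i := by
    intro i j
    by_contra hne
    have hc : ∀ k, ContinuousAt (fun z => projAlong U (s z) k) y := fun k =>
      (continuous_apply k).continuousAt.comp (continuousAt_projAlong U h0.1.continuousAt)
    have hc' : ∀ k, ContinuousAt (fun z => projAlong U (s' z) k) y := fun k =>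
      (continuous_apply k).continuousAt.comp (continuousAt_projAlong U h0'.1.continuousAt)
    have hev := (((hc i).mul (hc' j)).sub ((hc j).mul (hc' i))).eventually_ne (sub_ne_zero.2 hne)
    obtain ⟨z, hz, hzne, hz1, hz2⟩ := ((mem_closure_iff_frequently.1 (hd y)).and_eventually
      (hev.and (h.and h'))).exists
    obtain ⟨a, -, ha⟩ := exists_projAlong_eq_smul hz1.2.1
      ((hz1.2.2 hz).symm.trans (hz2.2.2 hz))
    apply hzne
    simp only [Pi.sub_apply, Pi.mul_apply]
    rw [ha]
    simp only [Pi.smul_apply, smul_eq_mul]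
    ring
  obtain ⟨a, ha, hae⟩ := exists_eq_smul_of_minors (fun h => h0.2.1 (projAlong_eq_zero_iff.1 h))
    (fun h => h0'.2.1 (projAlong_eq_zero_iff.1 h)) hminor
  exact sup_span_eq_of_projAlong_eq_smul ha hae

/-- The map to `ℙ(V/U) ⊆ ℙ(V)` represented by the local lifts. -/
theorem exists_lineMap (hd : Dense (offStrata q L)) (U : Submodule ℝ (Fin (m + 1) → ℝ)) :
    ∃ g : Y → RP m, ∀ y s, IsLocalLift q L U y s → Represents (projAlong U (s y)) (g y) := by
  have key : ∀ y, ∃ l : RP m, ∀ s, IsLocalLift q L U y s → Represents (projAlong U (s y)) l := by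
    intro y
    by_cases hex : ∃ s, IsLocalLift q L U y s
    · obtain ⟨s, hs⟩ := hex
      have hne : projAlong U (s y) ≠ 0 := fun h =>
        hs.self_of_nhds.2.1 (projAlong_eq_zero_iff.1 h)
      refine ⟨Projectivization.mk ℝ _ hne, fun s' hs' => ?_⟩
      obtain ⟨a, ha, he⟩ := exists_projAlong_eq_smul hs.self_of_nhds.2.1 (hs.sup_span_eq hd hs')
      refine Represents.of_smul (a := a) ?_
      rw [← he]
      exact ⟨hne, rfl⟩
    -- without a lift the condition is void and any value will do
    · exact ⟨q y, fun s hs => (hex ⟨s, hs⟩).elim⟩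
  choose g hg using key
  exact ⟨g, hg⟩

namespace IsWonderful

/-- The data for blowing up the next proper transform. -/
theorem exists_centerData (hq : IsWonderful Y q L) (hL : IsStrataList L)
    {U₀ : Submodule ℝ (Fin (m + 1) → ℝ)} (hU : IsNext L U₀) :
    ∃ D : CenterData Y, D.Z = properTransform q L (projSet U₀) := by
  have hd := hq.dense_offStrata hL
  obtain ⟨g, hg⟩ := exists_lineMap hd U₀
  refine ⟨{
    Z := properTransform q L (projSet U₀)
    U := U₀
    P := projAlong U₀
    g := g
    isClosed := isClosed_closure
    ne_top := hU.ne_top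
    P_eq_zero_iff := fun x => projAlong_eq_zero_iff
    P_P := projAlong_projAlong U₀
    off := fun z hz => ?_
    near_center := fun z hz => ?_ }, rfl⟩
  · obtain ⟨M⟩ := hq.localModel z
    have hW : ¬ M.W ≤ U₀ := fun h => hz
      ((M.mem_properTransform_iff hd (M.W_eq_of_le hU h) z M.mem_source).2 M.coord_eq_zero)
    have hl := M.lift U₀ hU.mem hW
    exact ⟨M.s U₀, hl.eventually.mono fun z' h => ⟨h.self_of_nhds.1, hg _ _ h⟩⟩
  · obtain ⟨M⟩ := hq.localModel z
    have hW := M.W_eq_of_mem_properTransform hU hz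
    have hiff := M.mem_properTransform_iff hd hW
    refine ⟨M.φ, M.φ_mem, M.mem_source, M.A, M.c, hW ▸ M.frame, hiff, fun x hx hxZ => ?_⟩
    refine hg x (fun x => ∑ i ∈ M.A, M.φ x i • M.c i) ?_
    filter_upwards [M.φ.open_source.mem_nhds hx,
      (isClosed_closure.isOpen_compl : IsOpen (properTransform q L (projSet U₀))ᶜ).mem_nhds hxZ]
      with x' hx' hxZ'
    refine ⟨?_, ?_, ?_⟩
    · have h1 := contMDiffAt_of_mem_maximalAtlas M.φ_mem hx'
      have h2 : ContDiff ℝ ∞ fun t : EuclideanSpace ℝ (Fin m) => ∑ i ∈ M.A, t i • M.c i := by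
        fun_prop
      exact h2.contMDiff.contMDiffAt.comp x' h1
    · rw [← hW, M.frame.sum_mem_iff, ← hiff x' hx']
      exact hxZ'
    · rw [← hW]
      exact M.sameLine x' hx'

theorem exists_blowup (hq : IsWonderful Y q L) (hL : IsStrataList L)
    {U₀ : Submodule ℝ (Fin (m + 1) → ℝ)} (hU : IsNext L U₀) :
    ∃ (Y' : SmoothMfd m) (r : Y' → Y), IsBlowup Y Y' (properTransform q L (projSet U₀)) r := by
  obtain ⟨D, hD⟩ := hq.exists_centerData hL hU
  exact ⟨D.blowup, D.blowdown, hD ▸ D.isBlowup⟩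

end IsWonderful

end LineMap

/-! ### Successive blowups along the strata -/

section Admissible

variable {m : ℕ}

/-- The list consists of the projectivized elements of the lattice of codimension at least 2, each
one after all those strictly contained in it. -/
structure IsAdmissibleList (L : List (Set (RP m))) : Prop where
  nodup : L.Nodup
  mem_iff : ∀ S, S ∈ L ↔ S ∈ projBraidTruncation m
  pairwise : L.Pairwise fun S T => ¬ T ⊂ S

lemma ne_top_of_two_le_finrank {U : Submodule ℝ (Fin (m + 1) → ℝ)}
    (h : 2 ≤ Module.finrank ℝ ((Fin (m + 1) → ℝ) ⧸ U)) : U ≠ ⊤ := by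
  rintro rfl
  have := Module.finrank_zero_of_subsingleton (R := ℝ)
    (M := (Fin (m + 1) → ℝ) ⧸ (⊤ : Submodule ℝ (Fin (m + 1) → ℝ)))
  omega

lemma finrank_quotient_le_of_le {U W : Submodule ℝ (Fin (m + 1) → ℝ)} (h : W ≤ U) :
    Module.finrank ℝ ((Fin (m + 1) → ℝ) ⧸ U) ≤ Module.finrank ℝ ((Fin (m + 1) → ℝ) ⧸ W) := by
  have h1 := Submodule.finrank_quotient_add_finrank U
  have h2 := Submodule.finrank_quotient_add_finrank W
  have h3 := Submodule.finrank_mono h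
  omega

namespace IsAdmissibleList

variable {Lf : List (Set (RP m))}

lemma isStrataList (hLf : IsAdmissibleList Lf) {L : List (Set (RP m))} (h : L <+: Lf) :
    IsStrataList L := by
  intro T hT
  obtain ⟨U, hU, hc, rfl⟩ := (hLf.mem_iff T).1 (h.subset hT)
  exact ⟨U, hU, ne_top_of_two_le_finrank hc, rfl⟩

lemma exists_isNext (hLf : IsAdmissibleList Lf) {L : List (Set (RP m))} {S : Set (RP m)}
    (h : L ++ [S] <+: Lf) : ∃ U, S = projSet U ∧ IsNext L U := by
  have hS : S ∈ Lf := h.subset (by simp)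
  obtain ⟨U, hU, hc, rfl⟩ := (hLf.mem_iff S).1 hS
  obtain ⟨R, hR⟩ := h
  have hnd := hLf.nodup
  have hpw := hLf.pairwise
  rw [← hR, List.append_assoc] at hnd hpw
  refine ⟨U, rfl, hU, ne_top_of_two_le_finrank hc, fun hmem => ?_, fun W hW hlt => ?_⟩
  · exact (List.nodup_append.1 hnd).2.2 _ hmem _ (by simp) rfl
  · have hWL : projSet W ∈ Lf :=
      (hLf.mem_iff _).2 ⟨W, hW, hc.trans (finrank_quotient_le_of_le hlt.le), rfl⟩
    rw [← hR, List.append_assoc] at hWL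
    have hss := projSet_ssubset_iff.2 hlt
    rcases List.mem_append.1 hWL with h1 | h1
    · exact h1
    · rcases List.mem_cons.1 h1 with h2 | h2
      · exact absurd (projSet_injective h2) hlt.ne
      · have h3 := (List.pairwise_append.1 hpw).2.1
        exact absurd hss ((List.pairwise_cons.1 h3).1 _ h2)

theorem isWonderful (hLf : IsAdmissibleList Lf) {L : List (Set (RP m))} {Y : SmoothMfd m}
    {q : Y → RP m} (h : IsSuccessiveBlowup (RP.mfd m) L Y q) (hL : L <+: Lf) :
    IsWonderful Y q L := by
  have key : ∀ (L : List (Set (RP.mfd m))) (Y : SmoothMfd m) (q : Y → RP.mfd m),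
      IsSuccessiveBlowup (RP.mfd m) L Y q → L <+: Lf → IsWonderful Y q L := by
    intro L Y q h
    induction h with
    | nil => exact fun _ => isWonderful_nil
    | snoc S _ hb ih =>
      intro hL
      have hL' := (List.prefix_append _ _).trans hL
      obtain ⟨U, rfl, hU⟩ := hLf.exists_isNext hL
      exact (ih hL').step (hLf.isStrataList hL') hU hb
  exact key L Y q h hL

theorem exists_isSuccessiveBlowup (hLf : IsAdmissibleList Lf) :
    ∃ (Y : SmoothMfd m) (q : Y → RP m), IsSuccessiveBlowup (RP.mfd m) Lf Y q := by
  have key : ∀ L : List (Set (RP m)), L <+: Lf →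
      ∃ (Y : SmoothMfd m) (q : Y → RP m), IsSuccessiveBlowup (RP.mfd m) L Y q := by
    intro L
    induction L using List.reverseRecOn with
    | nil => exact fun _ => ⟨_, _, .nil⟩
    | append_singleton L S ih =>
      intro hL
      have hL' := (List.prefix_append _ _).trans hL
      obtain ⟨Y, q, hq⟩ := ih hL'
      obtain ⟨U, rfl, hU⟩ := hLf.exists_isNext hL
      obtain ⟨Y', r, hb⟩ := (hLf.isWonderful hq hL').exists_blowup (hLf.isStrataList hL') hU
      exact ⟨Y', _, .snoc _ hq hb⟩
  exact key Lf (List.prefix_refl _)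

end IsAdmissibleList

lemma finite_braidArrangement (m : ℕ) : (braidArrangement m).Finite := by
  refine (finite_range fun p : Fin (m + 1) × Fin (m + 1) => braidHyperplane p.1 p.2).subset ?_
  rintro _ ⟨i, j, -, rfl⟩
  exact ⟨(i, j), rfl⟩

lemma finite_intersectionLattice (m : ℕ) : (intersectionLattice (braidArrangement m)).Finite := by
  refine ((finite_braidArrangement m).finite_subsets.image sInf).subset ?_
  rintro _ ⟨ℬ, hB, rfl⟩
  exact ⟨ℬ, hB, rfl⟩

/-- An order by dimension is admissible. -/
theorem exists_isAdmissibleList (m : ℕ) : ∃ L : List (Set (RP m)), IsAdmissibleList L := by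
  have hfin : {U | U ∈ intersectionLattice (braidArrangement m) ∧
      2 ≤ Module.finrank ℝ ((Fin (m + 1) → ℝ) ⧸ U)}.Finite :=
    (finite_intersectionLattice m).subset fun U hU => hU.1
  classical
  set r : Submodule ℝ (Fin (m + 1) → ℝ) → Submodule ℝ (Fin (m + 1) → ℝ) → Prop :=
    fun U W => Module.finrank ℝ U ≤ Module.finrank ℝ W
  have : Std.Total r := ⟨fun U W => le_total _ _⟩
  have : IsTrans _ r := ⟨fun U W W' => le_trans⟩
  have hperm := List.perm_insertionSort r hfin.toFinset.toList
  refine ⟨(hfin.toFinset.toList.insertionSort r).map projSet, ?_, fun S => ?_, ?_⟩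
  · exact (hperm.nodup_iff.2 hfin.toFinset.nodup_toList).map projSet_injective
  · rw [List.mem_map]
    constructor
    · rintro ⟨U, hU, rfl⟩
      have := hfin.mem_toFinset.1 (Finset.mem_toList.1 (hperm.mem_iff.1 hU))
      exact ⟨U, this.1, this.2, rfl⟩
    · rintro ⟨U, hU, hc, rfl⟩
      exact ⟨U, hperm.mem_iff.2 (Finset.mem_toList.2 (hfin.mem_toFinset.2 ⟨hU, hc⟩)), rfl⟩
  · rw [List.pairwise_map]
    refine (List.pairwise_insertionSort r _).imp fun {U W} h hlt => ?_
    exact absurd (Submodule.finrank_lt_finrank_of_lt (projSet_ssubset_iff.1 hlt)) (not_lt.2 h)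

lemma const_mem_of_mem_intersectionLattice {U : Submodule ℝ (Fin (m + 1) → ℝ)}
    (hU : U ∈ intersectionLattice (braidArrangement m)) : (fun _ => 1 : Fin (m + 1) → ℝ) ∈ U := by
  obtain ⟨ℬ, hB, rfl⟩ := hU
  rw [Submodule.mem_sInf]
  intro W hW
  obtain ⟨i, j, -, rfl⟩ := hB hW
  exact mem_braidHyperplane.2 rfl

lemma projSet_nonempty_of_mem_intersectionLattice {U : Submodule ℝ (Fin (m + 1) → ℝ)}
    (hU : U ∈ intersectionLattice (braidArrangement m)) : (projSet U).Nonempty := by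
  have h0 : (fun _ => 1 : Fin (m + 1) → ℝ) ≠ 0 := fun h => one_ne_zero (congrFun h 0)
  exact ⟨Projectivization.mk ℝ _ h0,
    (mem_projSet_mk h0).2 (const_mem_of_mem_intersectionLattice hU)⟩

lemma projSet_sInf (s : Set (Submodule ℝ (Fin (m + 1) → ℝ))) :
    projSet (sInf s) = ⋂ U ∈ s, projSet U := by
  ext l
  simp only [mem_iInter]
  exact le_sInf_iff (a := l.submodule)

/-- The strata of the truncated projectivized arrangement are its members and the whole space. -/
theorem mem_strataOf_projBraidTruncation {S : Set (RP m)} :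
    S ∈ strataOf (projBraidTruncation m) ↔ S = univ ∨ S ∈ projBraidTruncation m := by
  constructor
  · rintro ⟨-, ℬ, hB, rfl⟩
    rcases ℬ.eq_empty_or_nonempty with rfl | ⟨S₀, hS₀⟩
    · left; simp
    · right
      set s := {U | U ∈ intersectionLattice (braidArrangement m) ∧ projSet U ∈ ℬ} with hs
      obtain ⟨U₀, hU₀, hc, rfl⟩ := hB hS₀
      refine ⟨sInf s, sInf_mem_intersectionLattice fun U hU => hU.1,
        hc.trans (finrank_quotient_le_of_le (sInf_le ⟨hU₀, hS₀⟩)), ?_⟩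
      rw [projSet_sInf]
      ext l
      simp only [mem_sInter, mem_iInter]
      constructor
      · exact fun h U hU => h _ hU.2
      · intro h T hT
        obtain ⟨U, hU, -, rfl⟩ := hB hT
        exact h U ⟨hU, hT⟩
  · rintro (rfl | hS)
    · exact ⟨⟨Projectivization.mk ℝ (fun _ => 1 : Fin (m + 1) → ℝ)
        (fun h => one_ne_zero (congrFun h 0)), mem_univ _⟩, ∅, empty_subset _, by simp⟩
    · refine ⟨?_, {S}, by simpa using hS, by simp⟩
      obtain ⟨U, hU, -, rfl⟩ := hS
      exact projSet_nonempty_of_mem_intersectionLattice hU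

lemma ne_univ_of_mem_projBraidTruncation {S : Set (RP m)} (h : S ∈ projBraidTruncation m) :
    S ≠ univ := by
  obtain ⟨U, -, hc, rfl⟩ := h
  rw [← projSet_top]
  exact fun h => ne_top_of_two_le_finrank hc (projSet_injective h)

/-- The orders of the strata admitted in the definition of the maximal wonderful model. -/
theorem isMaximalWonderfulModel_iff {𝒜 : Set (Set (RP m))}
    (h𝒜 : strataOf 𝒜 = strataOf (projBraidTruncation m)) {Y : SmoothMfd m} {p : Y → RP m} :
    IsMaximalWonderfulModel (RP.mfd m) 𝒜 Y p ↔
      ∃ L, IsAdmissibleList L ∧ IsSuccessiveBlowup (RP.mfd m) L Y p := by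
  have key : ∀ S, S ∈ strataOf 𝒜 ∧ S ≠ univ ↔ S ∈ projBraidTruncation m := by
    intro S
    rw [h𝒜, mem_strataOf_projBraidTruncation]
    constructor
    · rintro ⟨h | h, hne⟩
      · exact absurd h hne
      · exact h
    · exact fun h => ⟨Or.inr h, ne_univ_of_mem_projBraidTruncation h⟩
  constructor
  · rintro ⟨L, h1, h2, h3, h4⟩
    exact ⟨L, ⟨h1, fun S => (h2 S).trans (key S), h3⟩, h4⟩
  · rintro ⟨L, ⟨h1, h2, h3⟩, h4⟩
    exact ⟨L, h1, fun S => (h2 S).trans (key S).symm, h3, h4⟩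

end Admissible

/-! ### The ambient space of the model -/

section Ambient

lemma continuous_projectivization_map {V W : Type*} [AddCommGroup V] [Module ℝ V]
    [TopologicalSpace V] [AddCommGroup W] [Module ℝ W] [TopologicalSpace W] (f : V →ₗ[ℝ] W)
    (hf : Function.Injective f) (hc : Continuous f) :
    Continuous (Projectivization.map f hf : ℙ ℝ V → ℙ ℝ W) := by
  refine continuous_coinduced_dom.2 ?_
  have h1 : Continuous fun v : {v : V // v ≠ 0} =>
      (⟨f v, fun h => v.2 (hf (h.trans (map_zero f).symm))⟩ : {w : W // w ≠ 0}) :=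
    (hc.comp continuous_subtype_val).subtype_mk _
  exact continuous_coinduced_rng.comp h1

lemma continuousAt_of_represents_mkQ {m : ℕ} {U : Submodule ℝ (Fin (m + 1) → ℝ)} {M : Type*}
    [TopologicalSpace M] {s : M → Fin (m + 1) → ℝ} {g : M → ℙ ℝ ((Fin (m + 1) → ℝ) ⧸ U)} {z : M}
    (hs : ContinuousAt s z) (h : ∀ᶠ z' in 𝓝 z, Represents (U.mkQ (s z')) (g z')) :
    ContinuousAt g z := by
  set N := {z' | Represents (U.mkQ (s z')) (g z')} with hN
  have hc : ContinuousWithinAt g N z := by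
    rw [continuousWithinAt_iff_continuousAt_domRestrict g h.self_of_nhds]
    have h1 : ContinuousAt (fun z' : N => (⟨U.mkQ (s z'), z'.2.1⟩ :
        {v : (Fin (m + 1) → ℝ) ⧸ U // v ≠ 0})) ⟨z, h.self_of_nhds⟩ := by
      refine (Topology.IsInducing.subtypeVal (t := {v : (Fin (m + 1) → ℝ) ⧸ U | v ≠ 0})
        ).continuousAt_iff.2 ?_
      exact (U.isQuotientMap_mkQ.continuous.continuousAt).comp
        (ContinuousAt.comp (g := s) hs continuous_subtype_val.continuousAt)
    have h2 : Continuous (Projectivization.mk' ℝ (V := (Fin (m + 1) → ℝ) ⧸ U)) :=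
      continuous_coinduced_rng
    refine (h2.continuousAt.comp h1).congr (Filter.Eventually.of_forall fun z' => ?_)
    exact z'.2.2
  exact hc.continuousAt h

variable {m : ℕ} {U : Submodule ℝ (Fin (m + 1) → ℝ)}

/-- The inclusion of `ℙ(V/U)` into `ℙ(V)` given by a projection along `U`. -/
noncomputable def quotientEmbedding (U : Submodule ℝ (Fin (m + 1) → ℝ)) :
    ((Fin (m + 1) → ℝ) ⧸ U) →ₗ[ℝ] (Fin (m + 1) → ℝ) :=
  U.liftQ (projAlong U) fun _ hx => LinearMap.mem_ker.2 (projAlong_eq_zero_iff.2 hx)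

lemma quotientEmbedding_mkQ (x : Fin (m + 1) → ℝ) :
    quotientEmbedding U (U.mkQ x) = projAlong U x := rfl

lemma quotientEmbedding_injective : Function.Injective (quotientEmbedding U) := by
  rw [← LinearMap.ker_eq_bot, LinearMap.ker_eq_bot']
  intro x hx
  obtain ⟨x, rfl⟩ := U.mkQ_surjective x
  rw [quotientEmbedding_mkQ, projAlong_eq_zero_iff] at hx
  exact (Submodule.Quotient.mk_eq_zero U).2 hx

instance : T2Space (ℙ ℝ ((Fin (m + 1) → ℝ) ⧸ U)) := by
  refine T2Space.of_injective_continuous (Projectivization.map_injective (quotientEmbedding U)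
    quotientEmbedding_injective) (continuous_projectivization_map _ _ ?_)
  rw [U.isQuotientMap_mkQ.continuous_iff]
  exact LinearMap.continuous_of_finiteDimensional (projAlong U)

lemma mkQ_ne_zero_iff {x : Fin (m + 1) → ℝ} : U.mkQ x ≠ 0 ↔ x ∉ U :=
  (Submodule.Quotient.mk_eq_zero U).not

lemma map_mkQ_span (x : Fin (m + 1) → ℝ) :
    (Submodule.span ℝ {x}).map U.mkQ = Submodule.span ℝ {U.mkQ x} := by
  rw [Submodule.map_span, image_singleton]

lemma represents_mkQ_iff {x : Fin (m + 1) → ℝ} {w : ℙ ℝ ((Fin (m + 1) → ℝ) ⧸ U)} :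
    Represents (U.mkQ x) w ↔ x ∉ U ∧ w.submodule = (Submodule.span ℝ {x}).map U.mkQ := by
  rw [map_mkQ_span]
  exact ⟨fun h => ⟨mkQ_ne_zero_iff.1 h.1, h.submodule_eq⟩,
    fun h => Represents.of_submodule_eq (mkQ_ne_zero_iff.2 h.1) h.2⟩

lemma sup_span_eq_of_represents_mkQ {x x' : Fin (m + 1) → ℝ} {w : ℙ ℝ ((Fin (m + 1) → ℝ) ⧸ U)}
    (h : Represents (U.mkQ x) w) (h' : Represents (U.mkQ x') w) :
    U ⊔ Submodule.span ℝ {x} = U ⊔ Submodule.span ℝ {x'} := by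
  rw [← Submodule.comap_map_mkQ, ← Submodule.comap_map_mkQ, ← (represents_mkQ_iff.1 h).2,
    ← (represents_mkQ_iff.1 h').2]

lemma Represents.mkQ_of_sup_span_eq {x x' : Fin (m + 1) → ℝ}
    {w : ℙ ℝ ((Fin (m + 1) → ℝ) ⧸ U)} (h : Represents (U.mkQ x) w) (hx' : x' ∉ U)
    (he : U ⊔ Submodule.span ℝ {x} = U ⊔ Submodule.span ℝ {x'}) : Represents (U.mkQ x') w := by
  rw [represents_mkQ_iff]
  refine ⟨hx', ?_⟩
  rw [(represents_mkQ_iff.1 h).2, ← Submodule.map_comap_eq_of_surjective U.mkQ_surjective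
    ((Submodule.span ℝ {x}).map U.mkQ), Submodule.comap_map_mkQ, he, ← Submodule.comap_map_mkQ,
    Submodule.map_comap_eq_of_surjective U.mkQ_surjective]

/-- The points `(ℓ, (⟨ℓ, U⟩ / U)_U)` of the ambient space. -/
def modelGraph (m : ℕ) : Set (ModelAmbient m) :=
  {w | (∀ U ∈ braidArrangement m, w.1 ∉ projSet U) ∧
    ∀ U : BraidIndex m, (w.2 U).submodule = w.1.submodule.map U.1.mkQ}

lemma mem_modelGraph_iff {w : ModelAmbient m} : w ∈ modelGraph m ↔ ∃ x : Fin (m + 1) → ℝ,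
    Function.Injective x ∧ Represents x w.1 ∧
      ∀ U : BraidIndex m, Represents (U.1.mkQ x) (w.2 U) := by
  constructor
  · rintro ⟨h1, h2⟩
    have hr := Represents.rep w.1
    refine ⟨w.1.rep, fun i j hij => ?_, hr, fun U => ?_⟩
    · by_contra hne
      exact h1 _ ⟨i, j, hne, rfl⟩ ((hr.mem_projSet_iff _).2 (mem_braidHyperplane.2 hij))
    · rw [represents_mkQ_iff, ← hr.mem_projSet_iff, ← hr.submodule_eq]
      exact ⟨notMem_projSet_of_mem_braidComplement h1 U.2.1 U.2.2, h2 U⟩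
  · rintro ⟨x, hinj, h1, h2⟩
    refine ⟨?_, fun U => ?_⟩
    · rintro _ ⟨i, j, hne, rfl⟩ h
      rw [h1.mem_projSet_iff, mem_braidHyperplane] at h
      exact hne (hinj h)
    · rw [(represents_mkQ_iff.1 (h2 U)).2, h1.submodule_eq]

lemma Represents.smul_perm {x : Fin (m + 1) → ℝ} {l : RP m} (h : Represents x l)
    (σ : Equiv.Perm (Fin (m + 1))) : Represents (permMap σ x) (σ • l) :=
  h.map (permMap σ) (permMap_injective σ)

lemma mapQ_permMap_injective (σ : Equiv.Perm (Fin (m + 1)))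
    (U : Submodule ℝ (Fin (m + 1) → ℝ)) : Function.Injective
      (Submodule.mapQ (U.comap (permMap σ)) U (permMap σ) le_rfl) :=
  LinearMap.ker_eq_bot.1 (by rw [Submodule.ker_mapQ, Submodule.mkQ_map_self])

lemma Represents.ambientAct {w : ModelAmbient m} {σ : Equiv.Perm (Fin (m + 1))} {U : BraidIndex m}
    {x : Fin (m + 1) → ℝ} (h : Represents ((U.preimage σ).1.mkQ x) (w.2 (U.preimage σ))) :
    Represents (U.1.mkQ (permMap σ x)) ((ambientAct σ w).2 U) :=
  h.map (Submodule.mapQ (U.1.comap (permMap σ)) U.1 (permMap σ) le_rfl)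
    (mapQ_permMap_injective σ U.1)

lemma ambientAct_mem_modelGraph {w : ModelAmbient m} (hw : w ∈ modelGraph m)
    (σ : Equiv.Perm (Fin (m + 1))) : ambientAct σ w ∈ modelGraph m := by
  obtain ⟨x, hinj, h1, h2⟩ := mem_modelGraph_iff.1 hw
  exact mem_modelGraph_iff.2 ⟨permMap σ x, hinj.comp (σ⁻¹ : Equiv.Perm _).injective,
    h1.smul_perm σ, fun U => (h2 (U.preimage σ)).ambientAct⟩

lemma smul_mem_braidComplement {l : RP m} (hl : l ∈ braidComplement m)
    (σ : Equiv.Perm (Fin (m + 1))) : σ • l ∈ braidComplement m := by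
  rintro _ ⟨i, j, hne, rfl⟩ h
  have hr := Represents.rep l
  rw [(hr.smul_perm σ).mem_projSet_iff] at h
  refine hl (braidHyperplane (σ⁻¹ i) (σ⁻¹ j)) ⟨_, _, fun h => hne (Equiv.injective _ h), rfl⟩ ?_
  rw [hr.mem_projSet_iff]
  exact h

lemma continuous_ambientAct (σ : Equiv.Perm (Fin (m + 1))) :
    Continuous (ambientAct σ : ModelAmbient m → ModelAmbient m) := by
  have hp : Continuous (permMap σ : (Fin (m + 1) → ℝ) →ₗ[ℝ] (Fin (m + 1) → ℝ)) :=
    LinearMap.continuous_of_finiteDimensional _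
  refine Continuous.prodMk ?_ (continuous_pi fun U => ?_)
  · exact (continuous_projectivization_map (permMap σ) (permMap_injective σ) hp).comp continuous_fst
  · refine (continuous_projectivization_map _ _ ?_).comp
      ((continuous_apply (U.preimage σ)).comp continuous_snd)
    refine (Submodule.isQuotientMap_mkQ (U.1.comap (permMap σ))).continuous_iff.2 ?_
    exact U.1.isQuotientMap_mkQ.continuous.comp hp

lemma ambientAct_mem_projectiveModel {w : ModelAmbient m} (hw : w ∈ projectiveModel m)
    (σ : Equiv.Perm (Fin (m + 1))) : ambientAct σ w ∈ projectiveModel m :=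
  map_mem_closure (continuous_ambientAct σ) hw fun _ h => ambientAct_mem_modelGraph h σ

end Ambient

/-! ### The embedding into the ambient space -/

section Model

variable {m : ℕ}

/-- The projectivized hyperplanes of the braid arrangement. -/
noncomputable def hyperplaneList (m : ℕ) : List (Set (RP m)) :=
  (finite_braidArrangement m).toFinset.toList.map projSet

lemma mem_offStrata_hyperplaneList {Y : Type*} {q : Y → RP m} {z : Y} :
    z ∈ offStrata q (hyperplaneList m) ↔ q z ∈ braidComplement m := by
  simp [offStrata, hyperplaneList, braidComplement]

/-- What is needed of a manifold over projective space to embed it onto the De Concini–Procesi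
model. The lifts of the maps to `ℙ(V/U)` are those that are correct over the complement of the
arrangement. -/
structure IsModel (Y : SmoothMfd m) (q : Y → RP m) : Prop where
  smooth : ContMDiff (𝓡 m) (𝓡 m) ∞ q
  existsUnique : ∀ x ∈ braidComplement m, ∃! y, q y = x
  dense : Dense (offStrata q (hyperplaneList m))
  compact : CompactSpace Y
  exists_lift : ∀ y, ∃ s : BraidIndex m → Y → Fin (m + 1) → ℝ,
    (∀ U, IsLocalLift q (hyperplaneList m) U.1 y (s U)) ∧
    ∀ ξ : TangentSpace (𝓡 m) y, mfderiv (𝓡 m) (𝓡 m) q y ξ = 0 →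
      (∀ U, (mfderiv (𝓡 m) 𝓘(ℝ, Fin (m + 1) → ℝ) (s U) y ξ : Fin (m + 1) → ℝ) ∈
        U.1 ⊔ Submodule.span ℝ {s U y}) → ξ = 0
  separated : ∀ y₁ y₂, q y₁ = q y₂ → (∀ U : BraidIndex m, ∀ s₁ s₂,
    IsLocalLift q (hyperplaneList m) U.1 y₁ s₁ → IsLocalLift q (hyperplaneList m) U.1 y₂ s₂ →
      U.1 ⊔ Submodule.span ℝ {s₁ y₁} = U.1 ⊔ Submodule.span ℝ {s₂ y₂}) → y₁ = y₂

lemma sup_span_eq_top_of_finrank_quotient_lt_two {U : Submodule ℝ (Fin (m + 1) → ℝ)}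
    (hc : Module.finrank ℝ ((Fin (m + 1) → ℝ) ⧸ U) < 2) {x : Fin (m + 1) → ℝ} (hx : x ∉ U) :
    U ⊔ Submodule.span ℝ {x} = ⊤ := by
  have hlt : U < U ⊔ Submodule.span ℝ {x} := lt_of_le_of_ne le_sup_left fun h => hx <|
    h ▸ Submodule.mem_sup_right (Submodule.mem_span_singleton_self x)
  have h1 := Submodule.finrank_lt_finrank_of_lt hlt
  have h2 := Submodule.finrank_quotient_add_finrank U
  have h3 := Submodule.finrank_le (U ⊔ Submodule.span ℝ {x})
  exact Submodule.eq_top_of_finrank_eq (by omega)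

lemma IsLocalLift.of_isStrataList {Y : SmoothMfd m} {q : Y → RP m} {L : List (Set (RP m))}
    (hL : IsStrataList L) {U : Submodule ℝ (Fin (m + 1) → ℝ)} {y : Y} {s : Y → Fin (m + 1) → ℝ}
    (h : IsLocalLift q L U y s) : IsLocalLift q (hyperplaneList m) U y s := by
  filter_upwards [h] with z hz
  refine ⟨hz.1, hz.2.1, fun hoff => hz.2.2 fun T hT => ?_⟩
  obtain ⟨W, hW, htop, rfl⟩ := hL T hT
  exact notMem_projSet_of_mem_braidComplement (mem_offStrata_hyperplaneList.1 hoff) hW htop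

/-- For `U` of codimension 1 the space `ℙ(V/U)` is a point, and any vector outside `U` is a lift. -/
theorem IsWonderful.isModel {Y : SmoothMfd m} {q : Y → RP m} {L : List (Set (RP m))}
    (hq : IsWonderful Y q L) (hL : IsAdmissibleList L) : IsModel Y q where
  smooth := hq.smooth
  existsUnique x hx := by
    refine hq.existsUnique x fun T hT => ?_
    obtain ⟨W, hW, htop, rfl⟩ := hL.isStrataList (List.prefix_refl _) T hT
    exact notMem_projSet_of_mem_braidComplement hx hW htop
  dense := hq.dense.mono fun _ h => mem_offStrata_hyperplaneList.2 h
  compact := hq.compact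
  exists_lift y := by
    classical
    obtain ⟨M⟩ := hq.localModel y
    have he : ∀ U : BraidIndex m, ∃ e : Fin (m + 1) → ℝ, e ∉ U.1 := fun U => by
      obtain ⟨e, -, he⟩ := SetLike.exists_of_lt U.2.2.lt_top
      exact ⟨e, he⟩
    choose e he using he
    set s : BraidIndex m → Y → Fin (m + 1) → ℝ := fun U =>
      if 2 ≤ Module.finrank ℝ ((Fin (m + 1) → ℝ) ⧸ U.1) then M.s U.1 else fun _ => e U with hs
    refine ⟨s, fun U => ?_, fun ξ hξ hξs => M.immersion ξ hξ fun U hU htop hUL => ?_⟩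
    · by_cases hc : 2 ≤ Module.finrank ℝ ((Fin (m + 1) → ℝ) ⧸ U.1)
      · have hsU : s U = M.s U.1 := if_pos hc
        rw [hsU]
        refine (M.lift U.1 U.2.1 fun hle => M.projSet_notMem U.1 U.2.1 hle U.2.2
          ((hL.mem_iff _).2 ⟨U.1, U.2.1, hc, rfl⟩)).of_isStrataList
          (hL.isStrataList (List.prefix_refl _))
      · have hsU : s U = fun _ => e U := if_neg hc
        rw [hsU]
        refine Filter.Eventually.of_forall fun z => ⟨contMDiffAt_const, he U, fun hoff => ?_⟩
        have hr := Represents.rep (q z)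
        have hx : (q z).rep ∉ U.1 := by
          rw [← hr.mem_projSet_iff]
          exact notMem_projSet_of_mem_braidComplement (mem_offStrata_hyperplaneList.1 hoff)
            U.2.1 U.2.2
        rw [SameLineMod, hr.submodule_eq,
          sup_span_eq_top_of_finrank_quotient_lt_two (not_le.1 hc) hx,
          sup_span_eq_top_of_finrank_quotient_lt_two (not_le.1 hc) (he U)]
    · have hc : 2 ≤ Module.finrank ℝ ((Fin (m + 1) → ℝ) ⧸ U) := by
        obtain ⟨U', hU', hc, hUU'⟩ := (hL.mem_iff _).1 hUL
        rw [projSet_injective hUU']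
        exact hc
      have hsU : s ⟨U, hU, htop⟩ = M.s U := if_pos hc
      have := hξs ⟨U, hU, htop⟩
      rw [hsU] at this
      exact this
  separated y₁ y₂ h hs := hq.separated y₁ y₂ h fun U hU hUL s₁ s₂ h₁ h₂ => by
    have hL' := hL.isStrataList (List.prefix_refl _)
    obtain ⟨U', hU', htop, hUU'⟩ := hL' _ hUL
    rw [← projSet_injective hUU'] at htop
    exact hs ⟨U, hU, htop⟩ s₁ s₂ (h₁.of_isStrataList hL') (h₂.of_isStrataList hL')

namespace IsModel

variable {Y : SmoothMfd m} {q : Y → RP m}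

/-- The map to the ambient space given by the lifts. -/
theorem exists_embedding (hq : IsModel Y q) : ∃ F : Y → ModelAmbient m, (∀ y, (F y).1 = q y) ∧
    ∀ y (U : BraidIndex m) s, IsLocalLift q (hyperplaneList m) U.1 y s →
      Represents (U.1.mkQ (s y)) ((F y).2 U) := by
  choose s hs using hq.exists_lift
  have hne : ∀ y (U : BraidIndex m), U.1.mkQ (s y U y) ≠ 0 := fun y U =>
    mkQ_ne_zero_iff.2 ((hs y).1 U).self_of_nhds.2.1
  refine ⟨fun y => (q y, fun U => Projectivization.mk ℝ _ (hne y U)), fun y => rfl,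
    fun y U s' hs' => ?_⟩
  have h0 : Represents (U.1.mkQ (s y U y)) (Projectivization.mk ℝ _ (hne y U)) := ⟨_, rfl⟩
  exact h0.mkQ_of_sup_span_eq hs'.self_of_nhds.2.1 (((hs y).1 U).sup_span_eq hq.dense hs')

variable {F : Y → ModelAmbient m}

lemma mem_modelGraph (hF1 : ∀ y, (F y).1 = q y)
    (hF2 : ∀ y (U : BraidIndex m) s, IsLocalLift q (hyperplaneList m) U.1 y s →
      Represents (U.1.mkQ (s y)) ((F y).2 U))
    (hq : IsModel Y q) {y : Y} (hy : q y ∈ braidComplement m) : F y ∈ modelGraph m := by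
  refine ⟨fun U hU => by rw [hF1]; exact hy U hU, fun U => ?_⟩
  obtain ⟨s, hs, -⟩ := hq.exists_lift y
  have h1 := (hs U).self_of_nhds.2.2 (mem_offStrata_hyperplaneList.2 hy)
  rw [(represents_mkQ_iff.1 (hF2 y U _ (hs U))).2, hF1]
  apply Submodule.comap_injective_of_surjective U.1.mkQ_surjective
  rw [Submodule.comap_map_mkQ, Submodule.comap_map_mkQ]
  exact h1.symm

lemma continuous (hF1 : ∀ y, (F y).1 = q y)
    (hF2 : ∀ y (U : BraidIndex m) s, IsLocalLift q (hyperplaneList m) U.1 y s →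
      Represents (U.1.mkQ (s y)) ((F y).2 U)) (hq : IsModel Y q) : Continuous F := by
  refine Continuous.prodMk (f := fun y => (F y).1) ?_ (continuous_pi fun U => ?_)
  · simp only [hF1]
    exact hq.smooth.continuous
  · rw [continuous_iff_continuousAt]
    intro y
    obtain ⟨s, hs, -⟩ := hq.exists_lift y
    exact continuousAt_of_represents_mkQ (hs U).self_of_nhds.1.continuousAt
      ((hs U).eventually.mono fun z hz => hF2 z U _ hz)

lemma isClosedEmbedding (hF1 : ∀ y, (F y).1 = q y)
    (hF2 : ∀ y (U : BraidIndex m) s, IsLocalLift q (hyperplaneList m) U.1 y s →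
      Represents (U.1.mkQ (s y)) ((F y).2 U)) (hq : IsModel Y q) :
    Topology.IsClosedEmbedding F := by
  have := hq.compact
  refine (hq.continuous hF1 hF2).isClosedEmbedding fun y₁ y₂ h => ?_
  refine hq.separated y₁ y₂ (by rw [← hF1, ← hF1, h]) fun U s₁ s₂ h₁ h₂ => ?_
  exact sup_span_eq_of_represents_mkQ (hF2 y₁ U s₁ h₁) (h ▸ hF2 y₂ U s₂ h₂)

lemma range_eq (hF1 : ∀ y, (F y).1 = q y)
    (hF2 : ∀ y (U : BraidIndex m) s, IsLocalLift q (hyperplaneList m) U.1 y s →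
      Represents (U.1.mkQ (s y)) ((F y).2 U)) (hq : IsModel Y q) :
    range F = projectiveModel m := by
  have h1 : F '' offStrata q (hyperplaneList m) = modelGraph m := by
    ext w
    constructor
    · rintro ⟨y, hy, rfl⟩
      exact hq.mem_modelGraph hF1 hF2 (mem_offStrata_hyperplaneList.1 hy)
    · intro hw
      obtain ⟨y, hy, -⟩ := hq.existsUnique w.1 hw.1
      have hyc : q y ∈ braidComplement m := by rw [hy]; exact hw.1
      refine ⟨y, mem_offStrata_hyperplaneList.2 hyc, Prod.ext ((hF1 y).trans hy) ?_⟩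
      funext U
      apply Projectivization.submodule_injective
      rw [(hq.mem_modelGraph hF1 hF2 hyc).2 U, hw.2 U, hF1, hy]
  change _ = closure (modelGraph m)
  rw [← h1, (hq.isClosedEmbedding hF1 hF2).closure_image_eq, hq.dense.closure_eq, image_univ]

lemma isSmoothImmersion (hF1 : ∀ y, (F y).1 = q y)
    (hF2 : ∀ y (U : BraidIndex m) s, IsLocalLift q (hyperplaneList m) U.1 y s →
      Represents (U.1.mkQ (s y)) ((F y).2 U)) (hq : IsModel Y q) : IsSmoothImmersion Y F := by
  have hFq : (fun y => (F y).1) = q := funext hF1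
  refine ⟨hFq ▸ hq.smooth, fun y => ?_⟩
  obtain ⟨s, hs, himm⟩ := hq.exists_lift y
  refine ⟨s, fun U => (hs U).self_of_nhds.1,
    fun U => (hs U).eventually.mono fun z hz => represents_mkQ_iff.1 (hF2 z U _ hz), ?_⟩
  rw [hFq]
  exact himm

end IsModel

end Model

/-! ### The lifted action -/

section SmoothCriterion

variable {m : ℕ}

/-- A smooth map with injective differential has a smooth local left inverse. -/
lemma exists_contDiffAt_leftInverse {E E' : Type*} [NormedAddCommGroup E] [NormedSpace ℝ E]
    [FiniteDimensional ℝ E] [NormedAddCommGroup E'] [NormedSpace ℝ E'] [FiniteDimensional ℝ E']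
    {G : E → E'} {t : E} (hG : ContDiffAt ℝ ∞ G t) (hi : ∀ v, fderiv ℝ G t v = 0 → v = 0) :
    ∃ H : E' → E, ContDiffAt ℝ ∞ H (G t) ∧ ∀ᶠ t' in 𝓝 t, H (G t') = t' := by
  have : CompleteSpace E := FiniteDimensional.complete ℝ E
  obtain ⟨l, hl⟩ := LinearMap.exists_leftInverse_of_injective
    (fderiv ℝ G t : E →ₗ[ℝ] E') (LinearMap.ker_eq_bot'.2 hi)
  let l' : E' →L[ℝ] E := LinearMap.toContinuousLinearMap l
  have hk : ContDiffAt ℝ ∞ (fun t => l' (G t)) t := l'.contDiff.contDiffAt.comp t hG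
  have hk' : HasFDerivAt (fun t => l' (G t))
      ((ContinuousLinearEquiv.refl ℝ E : E ≃L[ℝ] E) : E →L[ℝ] E) t := by
    have h1 : HasFDerivAt (fun t => l' (G t)) (l'.comp (fderiv ℝ G t)) t :=
      l'.hasFDerivAt.comp t (hG.differentiableAt (by simp)).hasFDerivAt
    have h2 : l'.comp (fderiv ℝ G t) = (ContinuousLinearEquiv.refl ℝ E : E →L[ℝ] E) :=
      ContinuousLinearMap.ext fun v => congrArg (fun f => f v) hl
    rwa [h2] at h1
  let e := hk.toOpenPartialHomeomorph _ hk' (by simp)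
  refine ⟨fun w => e.symm (l' w), ?_, ?_⟩
  · have h1 : ContDiffAt ℝ ∞ e.symm (l' (G t)) := hk.to_localInverse hk' (by simp)
    exact ContDiffAt.comp (G t) h1 l'.contDiff.contDiffAt
  · filter_upwards [e.open_source.mem_nhds (hk.mem_toOpenPartialHomeomorph_source hk' (by simp))]
      with t' ht'
    exact e.left_inv ht'

lemma Represents.mem_affineOpen_iff {x : Fin (m + 1) → ℝ} {l : RP m} (h : Represents x l)
    (i : Fin (m + 1)) : l ∈ RP.affineOpen i ↔ x i ≠ 0 := by
  obtain ⟨h0, rfl⟩ := h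
  exact RP.mk_mem_affineOpen i x h0

lemma Represents.affine_eq {x : Fin (m + 1) → ℝ} {l : RP m} (h : Represents x l)
    (i : Fin (m + 1)) : RP.affine i l = WithLp.toLp 2 fun k => x (i.succAbove k) / x i := by
  obtain ⟨h0, rfl⟩ := h
  rfl

lemma contMDiffAt_of_represents {M : Type*} [TopologicalSpace M]
    [ChartedSpace (EuclideanSpace ℝ (Fin m)) M] {s : M → Fin (m + 1) → ℝ} {g : M → RP m} {z : M}
    (hs : ContMDiffAt (𝓡 m) 𝓘(ℝ, Fin (m + 1) → ℝ) ∞ s z)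
    (h : ∀ᶠ z' in 𝓝 z, Represents (s z') (g z')) : ContMDiffAt (𝓡 m) (𝓡 m) ∞ g z := by
  obtain ⟨i, hi⟩ := Function.ne_iff.1 h.self_of_nhds.1
  have hi : s z i ≠ 0 := hi
  have h1 : ContDiffAt ℝ ∞ (fun x : Fin (m + 1) → ℝ =>
      (WithLp.toLp 2 fun k => x (i.succAbove k) / x i : EuclideanSpace ℝ (Fin m))) (s z) := by
    rw [contDiffAt_euclidean]
    intro k
    exact ContDiffAt.div (by fun_prop) (by fun_prop) hi
  have h2 := contMDiffAt_symm_of_mem_maximalAtlas (n := ∞) (I := 𝓡 m)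
    (RP.affineChart_mem_maximalAtlas i) (x := WithLp.toLp 2 fun k => s z (i.succAbove k) / s z i)
    (mem_univ _)
  have h3 := h2.comp z (h1.contMDiffAt.comp z hs)
  refine h3.congr_of_eventuallyEq ?_
  have hc : ContinuousAt (fun z => s z i) z :=
    (continuous_apply i).continuousAt.comp hs.continuousAt
  filter_upwards [h, hc.eventually_ne hi] with z' hz' hi'
  change g z' = (RP.affineChart i).symm (WithLp.toLp 2 fun k => s z' (i.succAbove k) / s z' i)
  rw [← hz'.affine_eq i]
  exact ((RP.affineChart i).left_inv ((hz'.mem_affineOpen_iff i).2 hi')).symm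

lemma contMDiff_smul_perm (σ : Equiv.Perm (Fin (m + 1))) :
    ContMDiff (𝓡 m) (𝓡 m) ∞ fun l : RP m => σ • l := by
  intro l
  obtain ⟨i, hi⟩ := RP.exists_mem_affineOpen l
  have h1 := (RP.contMDiffOn_affineLift i).contMDiffAt ((RP.isOpen_affineOpen i).mem_nhds hi)
  have h2 : ContDiff ℝ ∞ (permMap σ) := (permMap σ).toContinuousLinearMap.contDiff
  refine contMDiffAt_of_represents (h2.contMDiff.contMDiffAt.comp l h1) ?_
  filter_upwards [(RP.isOpen_affineOpen i).mem_nhds hi] with l' hl'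
  exact (Represents.affineLift hl').smul_perm σ

/-- The projection of a vector along `U`, scaled to have `k`-th coordinate 1: a coordinate on the
part of `ℙ(V/U)` where this is possible. -/
noncomputable def normalizedProj (U : Submodule ℝ (Fin (m + 1) → ℝ)) (k : Fin (m + 1))
    (x : Fin (m + 1) → ℝ) : Fin (m + 1) → ℝ :=
  (projAlong U x k)⁻¹ • projAlong U x

lemma contDiffAt_normalizedProj {U : Submodule ℝ (Fin (m + 1) → ℝ)} {k : Fin (m + 1)}
    {x : Fin (m + 1) → ℝ} (hx : projAlong U x k ≠ 0) : ContDiffAt ℝ ∞ (normalizedProj U k) x := by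
  have h1 : ContDiff ℝ ∞ (projAlong U) := (projAlong U).toContinuousLinearMap.contDiff
  have h2 : ContDiff ℝ ∞ fun x => projAlong U x k :=
    ((LinearMap.proj k).comp (projAlong U)).toContinuousLinearMap.contDiff
  exact (h2.contDiffAt.inv hx).smul h1.contDiffAt

lemma exists_projAlong_eq_smul_of_represents {U : Submodule ℝ (Fin (m + 1) → ℝ)}
    {x x' : Fin (m + 1) → ℝ} {w : ℙ ℝ ((Fin (m + 1) → ℝ) ⧸ U)} (h : Represents (U.mkQ x) w)
    (h' : Represents (U.mkQ x') w) : ∃ a : ℝ, a ≠ 0 ∧ projAlong U x = a • projAlong U x' :=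
  (h.map (quotientEmbedding U) quotientEmbedding_injective).exists_smul
    (h'.map (quotientEmbedding U) quotientEmbedding_injective)

lemma projAlong_coord_ne_zero_of_represents {U : Submodule ℝ (Fin (m + 1) → ℝ)}
    {x x' : Fin (m + 1) → ℝ} {w : ℙ ℝ ((Fin (m + 1) → ℝ) ⧸ U)} (h : Represents (U.mkQ x) w)
    (h' : Represents (U.mkQ x') w) {k : Fin (m + 1)} (hk : projAlong U x k ≠ 0) :
    projAlong U x' k ≠ 0 := by
  obtain ⟨a, -, he⟩ := exists_projAlong_eq_smul_of_represents h h'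
  rw [he, Pi.smul_apply, smul_eq_mul] at hk
  exact right_ne_zero_of_mul hk

lemma normalizedProj_eq_of_represents {U : Submodule ℝ (Fin (m + 1) → ℝ)}
    {x x' : Fin (m + 1) → ℝ} {w : ℙ ℝ ((Fin (m + 1) → ℝ) ⧸ U)} (h : Represents (U.mkQ x) w)
    (h' : Represents (U.mkQ x') w) (k : Fin (m + 1)) :
    normalizedProj U k x = normalizedProj U k x' := by
  obtain ⟨a, ha, he⟩ := exists_projAlong_eq_smul_of_represents h h'
  rw [normalizedProj, normalizedProj, he, Pi.smul_apply, smul_eq_mul, mul_inv, smul_smul]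
  congr 1
  field_simp

lemma mem_sup_span_of_fderiv_normalizedProj {E : Type*} [NormedAddCommGroup E] [NormedSpace ℝ E]
    {U : Submodule ℝ (Fin (m + 1) → ℝ)} {k : Fin (m + 1)}
    {u : E → Fin (m + 1) → ℝ} {t v : E} (hu : DifferentiableAt ℝ u t)
    (hf : projAlong U (u t) k ≠ 0) (h : fderiv ℝ (fun t => normalizedProj U k (u t)) t v = 0) :
    fderiv ℝ u t v ∈ U ⊔ Submodule.span ℝ {u t} := by
  let P : (Fin (m + 1) → ℝ) →L[ℝ] (Fin (m + 1) → ℝ) := (projAlong U).toContinuousLinearMap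
  let f' : (Fin (m + 1) → ℝ) →L[ℝ] ℝ := ContinuousLinearMap.proj k
  have hP : HasFDerivAt (fun t => P (u t)) (P.comp (fderiv ℝ u t)) t :=
    P.hasFDerivAt.comp t hu.hasFDerivAt
  have hfP : HasFDerivAt (fun t => f' (P (u t))) (f'.comp (P.comp (fderiv ℝ u t))) t :=
    f'.hasFDerivAt.comp t hP
  have hN : DifferentiableAt ℝ (fun t => (f' (P (u t)))⁻¹ • P (u t)) t :=
    (hfP.differentiableAt.inv hf).smul hP.differentiableAt
  have h1 := hfP.smul hN.hasFDerivAt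
  have h2 : (fun t => P (u t)) =ᶠ[𝓝 t] fun t => f' (P (u t)) • ((f' (P (u t)))⁻¹ • P (u t)) := by
    filter_upwards [hfP.continuousAt.eventually_ne hf] with t' ht'
    rw [smul_smul, mul_inv_cancel₀ ht', one_smul]
  have h3 := congrArg (fun D => D v) (hP.unique (h1.congr_of_eventuallyEq h2))
  have h4 : fderiv ℝ (fun t => (f' (P (u t)))⁻¹ • P (u t)) t v = 0 := h
  simp only [ContinuousLinearMap.comp_apply, add_apply,
    smul_apply, ContinuousLinearMap.smulRight_apply, h4, smul_zero,
    zero_add, smul_smul] at h3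
  set c := f' (P (fderiv ℝ u t v)) * (f' (P (u t)))⁻¹
  have h5 : fderiv ℝ u t v - c • u t ∈ U := by
    rw [← projAlong_eq_zero_iff, map_sub, map_smul, sub_eq_zero]
    exact h3
  rw [Submodule.mem_sup]
  exact ⟨_, h5, c • u t, Submodule.smul_mem _ _ (Submodule.mem_span_singleton_self _), by simp⟩

end SmoothCriterion

namespace IsModel

variable {m : ℕ} {Y : SmoothMfd m} {q : Y → RP m} {F : Y → ModelAmbient m}

/-- The lifts and the immersion property, expressed in a chart. -/
lemma exists_lift_chart (hq : IsModel Y q) (y : Y) :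
    ∃ ψ ∈ IsManifold.maximalAtlas (𝓡 m) ∞ Y, y ∈ ψ.source ∧
      ∃ s : BraidIndex m → Y → Fin (m + 1) → ℝ,
        (∀ U, IsLocalLift q (hyperplaneList m) U.1 y (s U)) ∧
        ∀ i, q y ∈ RP.affineOpen i → ∀ v : EuclideanSpace ℝ (Fin m),
          fderiv ℝ (fun t => RP.affine i (q (ψ.symm t))) (ψ y) v = 0 →
          (∀ U, fderiv ℝ (fun t => s U (ψ.symm t)) (ψ y) v ∈
            U.1 ⊔ Submodule.span ℝ {s U (ψ.symm (ψ y))}) → v = 0 := by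
  set ψ := chartAt (EuclideanSpace ℝ (Fin m)) y
  have hψ : ψ ∈ IsManifold.maximalAtlas (𝓡 m) ∞ Y := IsManifold.chart_mem_maximalAtlas _
  have hyψ : y ∈ ψ.source := mem_chart_source _ _
  refine ⟨ψ, hψ, hyψ, ?_⟩
  have hy : ψ.symm (ψ y) = y := ψ.left_inv hyψ
  have ht : ψ y ∈ ψ.target := ψ.map_source hyψ
  generalize ψ y = t at hy ht ⊢
  rw [← hy]
  obtain ⟨s, hs, himm⟩ := hq.exists_lift (ψ.symm t)
  refine ⟨s, hs, fun i hi v hv hvs => ?_⟩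
  have hψd : MDifferentiableAt (𝓡 m) (𝓡 m) ψ.symm t :=
    (contMDiffAt_symm_of_mem_maximalAtlas hψ ht).mdifferentiableAt (by simp)
  have hqd : MDifferentiableAt (𝓡 m) (𝓡 m) q (ψ.symm t) := hq.smooth.mdifferentiableAt (by simp)
  have hcd : MDifferentiableAt (𝓡 m) (𝓡 m) (RP.affineChart i) (q (ψ.symm t)) :=
    (contMDiffAt_of_mem_maximalAtlas (n := ∞) (RP.affineChart_mem_maximalAtlas i)
      hi).mdifferentiableAt (by simp)
  have h1 : mfderiv (𝓡 m) (𝓡 m) q (ψ.symm t) (mfderiv (𝓡 m) (𝓡 m) ψ.symm t v) = 0 := by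
    refine mfderiv_eq_zero_of_mem_maximalAtlas (RP.affineChart_mem_maximalAtlas i) hi ?_
    rw [← mfderiv_eq_fderiv] at hv
    have h2 := mfderiv_comp t hcd (hqd.comp t hψd)
    rw [mfderiv_comp t hqd hψd] at h2
    have h3 := congrArg (fun D => D v) h2
    exact h3.symm.trans hv
  have h4 : mfderiv (𝓡 m) (𝓡 m) ψ.symm t v = 0 := by
    refine himm _ h1 fun U => ?_
    have h5 := hvs U
    rw [← mfderiv_eq_fderiv] at h5
    have h6 := mfderiv_comp t ((hs U).self_of_nhds.1.mdifferentiableAt (by simp)) hψd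
    have h7 := congrArg (fun D => D v) h6
    exact (congrArg (fun x => x ∈ U.1 ⊔ Submodule.span ℝ {s U (ψ.symm t)}) h7).mp h5
  rw [IsManifold.mem_maximalAtlas_iff_contMDiffOn] at hψ
  have hd : ψ.MDifferentiable (𝓡 m) (𝓡 m) :=
    ⟨hψ.1.mdifferentiableOn (by simp), hψ.2.mdifferentiableOn (by simp)⟩
  have h8 := hd.symm.ker_mfderiv_eq_bot (x := t) ht
  rw [LinearMap.ker_eq_bot'] at h8
  exact h8 v h4

/-- The model is locally a smooth retract of a coordinate space in which the embedding takes its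
values. -/
lemma exists_local_retraction (hq : IsModel Y q)
    (hF2 : ∀ y (U : BraidIndex m) s, IsLocalLift q (hyperplaneList m) U.1 y s →
      Represents (U.1.mkQ (s y)) ((F y).2 U)) [Fintype (BraidIndex m)] (y : Y) :
    ∃ (i : Fin (m + 1)) (k : BraidIndex m → Fin (m + 1))
      (R : EuclideanSpace ℝ (Fin m) × (BraidIndex m → Fin (m + 1) → ℝ) → Y),
      q y ∈ RP.affineOpen i ∧
      (∀ x : BraidIndex m → Fin (m + 1) → ℝ, (∀ U, Represents (U.1.mkQ (x U)) ((F y).2 U)) →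
        (∀ U, projAlong U.1 (x U) (k U) ≠ 0) ∧
        ContMDiffAt 𝓘(ℝ, EuclideanSpace ℝ (Fin m) × (BraidIndex m → Fin (m + 1) → ℝ)) (𝓡 m) ∞ R
          (RP.affine i (q y), fun U => normalizedProj U.1 (k U) (x U))) ∧
      ∀ᶠ z in 𝓝 y, ∀ x : BraidIndex m → Fin (m + 1) → ℝ,
        (∀ U, Represents (U.1.mkQ (x U)) ((F z).2 U)) →
        R (RP.affine i (q z), fun U => normalizedProj U.1 (k U) (x U)) = z := by
  obtain ⟨ψ, hψ, hyψ, s, hs, himm⟩ := hq.exists_lift_chart y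
  obtain ⟨i, hi⟩ := RP.exists_mem_affineOpen (q y)
  have hsy : ψ.symm (ψ y) = y := ψ.left_inv hyψ
  have hk : ∀ U : BraidIndex m, ∃ k, projAlong U.1 (s U y) k ≠ 0 := fun U =>
    Function.ne_iff.1 fun h => (hs U).self_of_nhds.2.1 (projAlong_eq_zero_iff.1 h)
  choose k hk using hk
  have hψs : ContMDiffAt (𝓡 m) (𝓡 m) ∞ ψ.symm (ψ y) :=
    contMDiffAt_symm_of_mem_maximalAtlas hψ (ψ.map_source hyψ)
  have hu : ∀ U, ContDiffAt ℝ ∞ (fun t => s U (ψ.symm t)) (ψ y) := fun U => by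
    rw [← contMDiffAt_iff_contDiffAt]
    refine ContMDiffAt.comp (g := s U) _ ?_ hψs
    rw [hsy]
    exact (hs U).self_of_nhds.1
  have hky : ∀ U, projAlong U.1 (s U (ψ.symm (ψ y))) (k U) ≠ 0 := by rw [hsy]; exact hk
  set G : EuclideanSpace ℝ (Fin m) →
      EuclideanSpace ℝ (Fin m) × (BraidIndex m → Fin (m + 1) → ℝ) := fun t =>
    (RP.affine i (q (ψ.symm t)), fun U => normalizedProj U.1 (k U) (s U (ψ.symm t))) with hGdef
  have hG1 : ContDiffAt ℝ ∞ (fun t => RP.affine i (q (ψ.symm t))) (ψ y) := by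
    rw [← contMDiffAt_iff_contDiffAt]
    refine ContMDiffAt.comp (g := RP.affineChart i) (f := fun t => q (ψ.symm t)) _ ?_
      (hq.smooth.contMDiffAt.comp _ hψs)
    refine contMDiffAt_of_mem_maximalAtlas (RP.affineChart_mem_maximalAtlas i) ?_
    rw [hsy]
    exact hi
  have hG2 : ∀ U, ContDiffAt ℝ ∞ (fun t => normalizedProj U.1 (k U) (s U (ψ.symm t))) (ψ y) :=
    fun U => ContDiffAt.comp (g := normalizedProj U.1 (k U)) _
      (contDiffAt_normalizedProj (hky U)) (hu U)
  have hG : ContDiffAt ℝ ∞ G (ψ y) := hG1.prodMk (contDiffAt_pi.2 hG2)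
  -- `G` is the embedding in coordinates; its differential is injective since `F` is an immersion
  obtain ⟨H, hH, hHG⟩ := exists_contDiffAt_leftInverse hG fun v hv => by
    have hd := (hG.differentiableAt (by simp)).hasFDerivAt
    have hd1 : fderiv ℝ (fun t => RP.affine i (q (ψ.symm t))) (ψ y) v = 0 := by
      have h2 : fderiv ℝ (fun t => RP.affine i (q (ψ.symm t))) (ψ y) v =
        (fderiv ℝ G (ψ y) v).1 := congrArg (fun D => D v) hd.fst.fderiv
      rw [h2, hv]; rfl
    refine himm i hi v hd1 fun U => ?_
    refine mem_sup_span_of_fderiv_normalizedProj (k := k U) ((hu U).differentiableAt (by simp))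
      (hky U) ?_
    have h2 : fderiv ℝ (fun t => normalizedProj U.1 (k U) (s U (ψ.symm t))) (ψ y) v =
      (fderiv ℝ G (ψ y) v).2 U := congrArg (fun D => D v) (hasFDerivAt_pi'.1 hd.snd U).fderiv
    rw [h2, hv]; rfl
  refine ⟨i, k, fun w => ψ.symm (H w), hi, fun x hx => ⟨fun U =>
    projAlong_coord_ne_zero_of_represents (hF2 _ U _ (hs U)) (hx U) (hk U), ?_⟩, ?_⟩
  · have h0 : (RP.affine i (q y), fun U => normalizedProj U.1 (k U) (x U)) = G (ψ y) := by
      rw [hGdef]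
      simp only [hsy]
      refine Prod.ext rfl (funext fun U => ?_)
      exact normalizedProj_eq_of_represents (hx U) (hF2 _ U _ (hs U)) _
    rw [h0]
    refine ContMDiffAt.comp (g := ψ.symm) _ ?_ hH.contMDiffAt
    rw [hHG.self_of_nhds]
    exact hψs
  · have h1 : ∀ᶠ z in 𝓝 y, ∀ U, IsLocalLift q (hyperplaneList m) U.1 z (s U) :=
      Filter.eventually_all.2 fun U => (hs U).eventually
    filter_upwards [h1, ψ.open_source.mem_nhds hyψ, (ψ.continuousAt hyψ).eventually hHG]
      with z h1 h2 h3 x hx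
    have h0 : (RP.affine i (q z), fun U => normalizedProj U.1 (k U) (x U)) = G (ψ z) := by
      rw [hGdef]
      simp only [ψ.left_inv h2]
      refine Prod.ext rfl (funext fun U => ?_)
      exact normalizedProj_eq_of_represents (hx U) (hF2 _ U _ (h1 U)) _
    rw [h0, h3, ψ.left_inv h2]

/-- A continuous map to the model is smooth if its composition with the embedding is. -/
theorem contMDiffAt_of_lifts (hq : IsModel Y q)
    (hF2 : ∀ y (U : BraidIndex m) s, IsLocalLift q (hyperplaneList m) U.1 y s →
      Represents (U.1.mkQ (s y)) ((F y).2 U))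
    {ζ : Y → Y} {y : Y} (hζ : ContinuousAt ζ y)
    (hqζ : ContMDiffAt (𝓡 m) (𝓡 m) ∞ (fun z => q (ζ z)) y)
    (hτ : ∀ U : BraidIndex m, ∃ τ : Y → Fin (m + 1) → ℝ,
      ContMDiffAt (𝓡 m) 𝓘(ℝ, Fin (m + 1) → ℝ) ∞ τ y ∧
        ∀ᶠ z in 𝓝 y, Represents (U.1.mkQ (τ z)) ((F (ζ z)).2 U)) :
    ContMDiffAt (𝓡 m) (𝓡 m) ∞ ζ y := by
  have : Finite (BraidIndex m) :=
    ((finite_intersectionLattice m).subset (fun U hU => hU.1) :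
      {U | U ∈ intersectionLattice (braidArrangement m) ∧ U ≠ ⊤}.Finite)
  have := Fintype.ofFinite (BraidIndex m)
  obtain ⟨i, k, R, hi, hx, hR⟩ := hq.exists_local_retraction hF2 (ζ y)
  choose τ hτs hτr using hτ
  obtain ⟨hk, hRs⟩ := hx (fun U => τ U y) fun U => (hτr U).self_of_nhds
  have hsm : ContMDiffAt (𝓡 m) 𝓘(ℝ, EuclideanSpace ℝ (Fin m) × (BraidIndex m → Fin (m + 1) → ℝ))
      ∞ (fun z => (RP.affine i (q (ζ z)), fun U => normalizedProj U.1 (k U) (τ U z))) y := by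
    refine ContMDiffAt.prodMk_space ?_ (contMDiffAt_pi_space.2 fun U => ?_)
    · exact ContMDiffAt.comp (g := RP.affineChart i) (f := fun z => q (ζ z)) _
        (contMDiffAt_of_mem_maximalAtlas (RP.affineChart_mem_maximalAtlas i) hi) hqζ
    · exact ContMDiffAt.comp (g := normalizedProj U.1 (k U)) _
        (contDiffAt_normalizedProj (hk U)).contMDiffAt (hτs U)
  refine (ContMDiffAt.comp (g := R) y hRs hsm).congr_of_eventuallyEq ?_
  filter_upwards [hζ.eventually hR, Filter.eventually_all.2 hτr] with z h1 h2
  exact (h1 (fun U => τ U z) h2).symm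

/-- The action on the ambient space preserves the image of the embedding and thus induces an action
on the model. The laws of an action can be checked over the complement of the arrangement. -/
theorem exists_mulAction (hq : IsModel Y q) (hF1 : ∀ y, (F y).1 = q y)
    (hF2 : ∀ y (U : BraidIndex m) s, IsLocalLift q (hyperplaneList m) U.1 y s →
      Represents (U.1.mkQ (s y)) ((F y).2 U)) :
    ∃ _ : MulAction (Equiv.Perm (Fin (m + 1))) Y, ∀ σ : Equiv.Perm (Fin (m + 1)),
      ContMDiff (𝓡 m) (𝓡 m) ∞ (fun y : Y => σ • y) ∧ (∀ y : Y, q (σ • y) = σ • q y) ∧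
      ∀ y : Y, F (σ • y) = ambientAct σ (F y) := by
  have hemb := hq.isClosedEmbedding hF1 hF2
  have hex : ∀ (σ : Equiv.Perm (Fin (m + 1))) (y : Y), ∃ y', F y' = ambientAct σ (F y) := by
    intro σ y
    have h1 := ambientAct_mem_projectiveModel (hq.range_eq hF1 hF2 ▸ mem_range_self y) σ
    rw [← hq.range_eq hF1 hF2] at h1
    exact h1
  choose act hact using hex
  have hqact : ∀ σ y, q (act σ y) = σ • q y := fun σ y => by
    rw [← hF1, hact, ← hF1]
    rfl
  have hcont : ∀ σ, Continuous (act σ) := fun σ => by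
    rw [hemb.isInducing.continuous_iff]
    refine ((continuous_ambientAct σ).comp (hq.continuous hF1 hF2)).congr fun y => ?_
    exact (hact σ y).symm
  -- continuous self-maps of `Y` are determined over the complement of the arrangement, where `q` is
  -- injective
  have hext : ∀ f g : Y → Y, Continuous f → Continuous g →
      (∀ y, q y ∈ braidComplement m → q (f y) = q (g y) ∧ q (g y) ∈ braidComplement m) → f = g := by
    intro f g hf hg h
    refine Continuous.ext_on hq.dense hf hg fun y hy => ?_
    obtain ⟨h1, h2⟩ := h y (mem_offStrata_hyperplaneList.1 hy)
    exact (hq.existsUnique _ h2).unique h1 rfl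
  have hone : act 1 = id := hext _ _ (hcont 1) continuous_id fun y hy => by
    rw [hqact, one_smul]
    exact ⟨rfl, hy⟩
  have hmul : ∀ σ τ, act (σ * τ) = act σ ∘ act τ := fun σ τ =>
    hext _ _ (hcont _) ((hcont σ).comp (hcont τ)) fun y hy => by
      simp only [Function.comp, hqact, mul_smul, true_and]
      exact smul_mem_braidComplement (smul_mem_braidComplement hy τ) σ
  let inst : MulAction (Equiv.Perm (Fin (m + 1))) Y :=
    { smul := act
      one_smul := fun y => congrFun hone y
      mul_smul := fun σ τ y => congrFun (hmul σ τ) y }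
  refine ⟨inst, fun σ => ⟨fun y => ?_, hqact σ, hact σ⟩⟩
  refine hq.contMDiffAt_of_lifts hF2 (ζ := act σ) (hcont σ).continuousAt ?_ fun U => ?_
  · simp only [hqact]
    exact (contMDiff_smul_perm σ).contMDiffAt.comp y hq.smooth.contMDiffAt
  -- a lift for `U` along `act σ` is the image under `σ` of a lift for `σ⁻¹ U`
  · obtain ⟨s, hs, -⟩ := hq.exists_lift y
    have hp : ContDiff ℝ ∞ (permMap σ) := (permMap σ).toContinuousLinearMap.contDiff
    refine ⟨fun z => permMap σ (s (U.preimage σ) z),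
      hp.contMDiff.contMDiffAt.comp y (hs _).self_of_nhds.1, ?_⟩
    filter_upwards [(hs (U.preimage σ)).eventually] with z hz
    rw [hact]
    exact (hF2 z (U.preimage σ) _ hz).ambientAct

end IsModel

/-! ### The permutation action on tangent spaces of projective space -/

section TangentAction

variable {m : ℕ}

lemma permMap_mul (σ τ : Equiv.Perm (Fin (m + 1))) (x : Fin (m + 1) → ℝ) :
    permMap (σ * τ) x = permMap σ (permMap τ x) := rfl

lemma permMap_dotProduct (σ : Equiv.Perm (Fin (m + 1))) (x y : Fin (m + 1) → ℝ) :
    permMap σ x ⬝ᵥ permMap σ y = x ⬝ᵥ y :=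
  comp_equiv_dotProduct_comp_equiv x y (σ⁻¹ : Equiv.Perm (Fin (m + 1)))

lemma mul_self_eq_one_of_permMap_eq_smul {σ : Equiv.Perm (Fin (m + 1))} {x : Fin (m + 1) → ℝ}
    (hx : x ≠ 0) {a : ℝ} (h : permMap σ x = a • x) : a * a = 1 := by
  have h1 := permMap_dotProduct σ x x
  rw [h, smul_dotProduct, dotProduct_smul, smul_eq_mul, smul_eq_mul, ← mul_assoc] at h1
  exact mul_right_cancel₀ (mt dotProduct_self_eq_zero.1 hx) (h1.trans (one_mul _).symm)

/-- The differential of the affine lift identifies the tangent space at a line with a complement of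
this line; the differential of a permutation fixing the line is the permutation up to scaling and
modulo the line. -/
lemma RP.mfderiv_affineLift_smul {i : Fin (m + 1)} {l : RP m} (hl : l ∈ RP.affineOpen i)
    {σ : Equiv.Perm (Fin (m + 1))} (hσ : σ • l = l) {a : ℝ}
    (ha : permMap σ (RP.affineLift i l) = a • RP.affineLift i l)
    (ξ : TangentSpace (𝓡 m) l) :
    ∃ b : ℝ, (mfderiv (𝓡 m) 𝓘(ℝ, Fin (m + 1) → ℝ) (RP.affineLift i) l (tangentAct l σ ξ) :
      Fin (m + 1) → ℝ) =
      a⁻¹ • permMap σ (mfderiv (𝓡 m) 𝓘(ℝ, Fin (m + 1) → ℝ) (RP.affineLift i) l ξ :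
        Fin (m + 1) → ℝ) + b • RP.affineLift i l := by
  have hnhds : RP.affineOpen i ∈ 𝓝 l := (RP.isOpen_affineOpen i).mem_nhds hl
  have hd : ∀ l', l' = l → MDifferentiableAt (𝓡 m) 𝓘(ℝ, Fin (m + 1) → ℝ) (RP.affineLift i) l' := by
    rintro _ rfl
    exact ((RP.contMDiffOn_affineLift i).contMDiffAt hnhds).mdifferentiableAt (by simp)
  have hσd : MDifferentiableAt (𝓡 m) (𝓡 m) (fun l : RP m => σ • l) l :=
    (contMDiff_smul_perm σ).mdifferentiableAt (by simp)
  set w := permMap σ (RP.affineLift i l) with hw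
  have hwi : w i = a := by rw [ha, Pi.smul_apply, RP.affineLift_self, smul_eq_mul, mul_one]
  have ha0 : a ≠ 0 := by
    have := mul_self_eq_one_of_permMap_eq_smul (RP.affineLift_ne_zero i l) ha
    rintro rfl
    simp at this
  let Q : (Fin (m + 1) → ℝ) → Fin (m + 1) → ℝ := fun x => (x i)⁻¹ • x
  have hinv : DifferentiableAt ℝ (fun x : Fin (m + 1) → ℝ => (x i)⁻¹) w :=
    DifferentiableAt.inv (by fun_prop) (by rw [hwi]; exact ha0)
  have hQ : HasFDerivAt Q _ w := hinv.hasFDerivAt.smul (hasFDerivAt_id w)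
  let T : (Fin (m + 1) → ℝ) →L[ℝ] (Fin (m + 1) → ℝ) := (permMap σ).toContinuousLinearMap
  have h1 : (fun l' : RP m => RP.affineLift i (σ • l')) =ᶠ[𝓝 l]
      fun l' => Q (T (RP.affineLift i l')) := by
    have hev : ∀ᶠ l' in 𝓝 l, σ • l' ∈ RP.affineOpen i :=
      hσd.continuousAt.eventually ((RP.isOpen_affineOpen i).mem_nhds (by
        change σ • l ∈ _
        rw [hσ]
        exact hl))
    filter_upwards [hev, hnhds] with l' h1 h2
    obtain ⟨b, hb, he⟩ := ((Represents.affineLift h2).smul_perm σ).exists_smul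
      (Represents.affineLift h1)
    have hbi : permMap σ (RP.affineLift i l') i = b := by
      rw [he, Pi.smul_apply, RP.affineLift_self, smul_eq_mul, mul_one]
    change _ = (permMap σ (RP.affineLift i l') i)⁻¹ • permMap σ (RP.affineLift i l')
    rw [hbi, he, smul_smul, inv_mul_cancel₀ hb, one_smul]
  have h2 := (hd l rfl).hasMFDerivAt
  have h3 : HasMFDerivAt (𝓡 m) 𝓘(ℝ, Fin (m + 1) → ℝ) (fun l' => Q (T (RP.affineLift i l'))) l _ :=
    HasMFDerivAt.comp (g := fun x => Q (T x)) l
      ((HasFDerivAt.comp (g := Q) _ hQ T.hasFDerivAt).hasMFDerivAt) h2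
  have h4 : HasMFDerivAt (𝓡 m) 𝓘(ℝ, Fin (m + 1) → ℝ)
      (fun l' : RP m => RP.affineLift i (σ • l')) l _ :=
    HasMFDerivAt.comp (g := RP.affineLift i) (f := fun l : RP m => σ • l) l (hd _ hσ).hasMFDerivAt
      hσd.hasMFDerivAt
  have h5 := congrArg (fun D => D ξ) (hasMFDerivAt_unique h4 (h3.congr_of_eventuallyEq h1))
  have h6 : ∀ l', l' = l → ∀ η : EuclideanSpace ℝ (Fin m),
      (mfderiv (𝓡 m) 𝓘(ℝ, Fin (m + 1) → ℝ) (RP.affineLift i) l' η : Fin (m + 1) → ℝ) =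
      (mfderiv (𝓡 m) 𝓘(ℝ, Fin (m + 1) → ℝ) (RP.affineLift i) l η : Fin (m + 1) → ℝ) := by
    rintro _ rfl η; rfl
  have h7 := (h6 _ hσ (tangentAct l σ ξ)).symm.trans h5
  set D : Fin (m + 1) → ℝ := mfderiv (𝓡 m) 𝓘(ℝ, Fin (m + 1) → ℝ) (RP.affineLift i) l ξ
  have h8 : (mfderiv (𝓡 m) 𝓘(ℝ, Fin (m + 1) → ℝ) (RP.affineLift i) l (tangentAct l σ ξ) :
      Fin (m + 1) → ℝ) = (w i)⁻¹ • permMap σ D +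
        (fderiv ℝ (fun x : Fin (m + 1) → ℝ => (x i)⁻¹) w (permMap σ D)) • w := h7
  refine ⟨fderiv ℝ (fun x : Fin (m + 1) → ℝ => (x i)⁻¹) w (permMap σ D) * a, ?_⟩
  rw [h8, hwi, mul_smul, ← ha]

lemma RP.eq_zero_of_mfderiv_affineLift_eq_smul {i : Fin (m + 1)} {l : RP m}
    (hl : l ∈ RP.affineOpen i) {ξ : TangentSpace (𝓡 m) l} {b : ℝ}
    (h : (mfderiv (𝓡 m) 𝓘(ℝ, Fin (m + 1) → ℝ) (RP.affineLift i) l ξ : Fin (m + 1) → ℝ) =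
      b • RP.affineLift i l) : ξ = 0 := by
  have hnhds : RP.affineOpen i ∈ 𝓝 l := (RP.isOpen_affineOpen i).mem_nhds hl
  have hd : MDifferentiableAt (𝓡 m) 𝓘(ℝ, Fin (m + 1) → ℝ) (RP.affineLift i) l :=
    ((RP.contMDiffOn_affineLift i).contMDiffAt hnhds).mdifferentiableAt (by simp)
  -- the `i`-th coordinate of the affine lift is constant
  have h1 : HasMFDerivAt (𝓡 m) 𝓘(ℝ, ℝ) (fun l' : RP m => RP.affineLift i l' i) l _ :=
    HasMFDerivAt.comp (g := fun x : Fin (m + 1) → ℝ => x i) l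
      ((ContinuousLinearMap.proj (R := ℝ) (φ := fun _ : Fin (m + 1) => ℝ) i).hasFDerivAt
        |>.hasMFDerivAt) hd.hasMFDerivAt
  have h2 : (fun l' : RP m => RP.affineLift i l' i) = fun _ => (1 : ℝ) :=
    funext fun l' => RP.affineLift_self i l'
  rw [h2] at h1
  have h3 : (mfderiv (𝓡 m) 𝓘(ℝ, Fin (m + 1) → ℝ) (RP.affineLift i) l ξ : Fin (m + 1) → ℝ) i = 0 :=
    congrArg (fun D => D ξ) (hasMFDerivAt_unique h1 (hasMFDerivAt_const (1 : ℝ) l))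
  rw [h, Pi.smul_apply, RP.affineLift_self, smul_eq_mul, mul_one] at h3
  rw [h3, zero_smul] at h
  refine mfderiv_eq_zero_of_mem_maximalAtlas (RP.affineChart_mem_maximalAtlas i) hl ?_
  let R : (Fin (m + 1) → ℝ) →ₗ[ℝ] EuclideanSpace ℝ (Fin m) :=
    (WithLp.linearEquiv 2 ℝ (Fin m → ℝ)).symm.toLinearMap ∘ₗ LinearMap.funLeft ℝ ℝ i.succAbove
  have h4 : (RP.affineChart i : RP m → EuclideanSpace ℝ (Fin m)) =
      fun l' => R.toContinuousLinearMap (RP.affineLift i l') := by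
    funext l'
    ext k
    simp [R, RP.affineLift, RP.affineChart, LinearMap.funLeft_apply]
  have h5 : HasMFDerivAt (𝓡 m) (𝓡 m) (fun l' : RP m =>
      R.toContinuousLinearMap (RP.affineLift i l')) l _ :=
    HasMFDerivAt.comp (g := fun x => R.toContinuousLinearMap x) l
      (R.toContinuousLinearMap.hasFDerivAt.hasMFDerivAt) hd.hasMFDerivAt
  rw [h4, h5.mfderiv]
  have h6 : R.toContinuousLinearMap (mfderiv (𝓡 m) 𝓘(ℝ, Fin (m + 1) → ℝ) (RP.affineLift i) l ξ :
      Fin (m + 1) → ℝ) = 0 := by rw [h]; exact map_zero _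
  exact h6

/-- The orthogonal projection along `v`. -/
noncomputable def orthProj (v : Fin (m + 1) → ℝ) : (Fin (m + 1) → ℝ) →ₗ[ℝ] (Fin (m + 1) → ℝ) where
  toFun x := x - ((v ⬝ᵥ x) / (v ⬝ᵥ v)) • v
  map_add' x y := by
    rw [dotProduct_add, add_div, add_smul]; abel
  map_smul' a x := by
    rw [dotProduct_smul, smul_eq_mul, mul_div_assoc, mul_smul, smul_sub]; rfl

lemma orthProj_apply (v x : Fin (m + 1) → ℝ) :
    orthProj v x = x - ((v ⬝ᵥ x) / (v ⬝ᵥ v)) • v := rfl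

lemma dotProduct_orthProj {v : Fin (m + 1) → ℝ} (hv : v ≠ 0) (x : Fin (m + 1) → ℝ) :
    v ⬝ᵥ orthProj v x = 0 := by
  rw [orthProj_apply, dotProduct_sub, dotProduct_smul, smul_eq_mul,
    div_mul_cancel₀ _ (mt dotProduct_self_eq_zero.1 hv), sub_self]

lemma orthProj_eq_self {v x : Fin (m + 1) → ℝ} (h : v ⬝ᵥ x = 0) : orthProj v x = x := by
  rw [orthProj_apply, h, zero_div, zero_smul, sub_zero]

lemma orthProj_smul_self {v : Fin (m + 1) → ℝ} (hv : v ≠ 0) (a : ℝ) : orthProj v (a • v) = 0 := by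
  rw [orthProj_apply, dotProduct_smul, smul_eq_mul,
    mul_div_cancel_right₀ _ (mt dotProduct_self_eq_zero.1 hv), sub_self]

/-- The tangent space at the line spanned by `v` is the orthogonal complement of `v`, with the
stabilizer acting by the permutation action twisted by its character on the line. -/
theorem exists_tangentSpace_equiv (l : RP m) : ∃ (v : Fin (m + 1) → ℝ) (_ : Represents v l)
    (E : TangentSpace (𝓡 m) l →ₗ[ℝ] (Fin (m + 1) → ℝ)), Function.Injective E ∧
      (∀ x, v ⬝ᵥ x = 0 ↔ ∃ ξ, E ξ = x) ∧
      ∀ (σ : Equiv.Perm (Fin (m + 1))) (a : ℝ), permMap σ v = a • v →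
        ∀ ξ, permMap σ (E ξ) = a • E (tangentAct l σ ξ) := by
  obtain ⟨i, hi⟩ := RP.exists_mem_affineOpen l
  have hr := Represents.affineLift hi
  set v := RP.affineLift i l with hv
  have hv0 : v ≠ 0 := hr.1
  let D : TangentSpace (𝓡 m) l →ₗ[ℝ] (Fin (m + 1) → ℝ) :=
    (mfderiv (𝓡 m) 𝓘(ℝ, Fin (m + 1) → ℝ) (RP.affineLift i) l).toLinearMap
  have hinj : Function.Injective (orthProj v ∘ₗ D) := by
    rw [← LinearMap.ker_eq_bot, LinearMap.ker_eq_bot']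
    intro ξ hξ
    rw [LinearMap.comp_apply, orthProj_apply, sub_eq_zero] at hξ
    exact RP.eq_zero_of_mfderiv_affineLift_eq_smul hi hξ
  refine ⟨v, hr, orthProj v ∘ₗ D, hinj, ?_, ?_⟩
  -- the image is contained in the orthogonal complement of `v`, and both have dimension `m`
  · let f : Module.Dual ℝ (Fin (m + 1) → ℝ) :=
      { toFun := fun x => v ⬝ᵥ x
        map_add' := dotProduct_add v
        map_smul' := fun a x => dotProduct_smul a v x }
    have hf : f ≠ 0 := fun h => hv0 (dotProduct_self_eq_zero.1 (congrArg (fun g => g v) h))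
    have h1 := Module.Dual.finrank_ker_add_one_of_ne_zero hf
    have h2 := LinearMap.finrank_range_of_inj hinj
    have h3 : Module.finrank ℝ (TangentSpace (𝓡 m) l) = m :=
      finrank_euclideanSpace_fin (𝕜 := ℝ) (n := m)
    rw [Module.finrank_fin_fun] at h1
    have h4 : LinearMap.range (orthProj v ∘ₗ D) = LinearMap.ker f := by
      refine Submodule.eq_of_le_of_finrank_eq ?_ (by omega)
      rintro _ ⟨ξ, rfl⟩
      exact dotProduct_orthProj hv0 _
    intro x
    change x ∈ LinearMap.ker f ↔ _
    rw [← h4]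
    rfl
  · intro σ a ha ξ
    have ha1 := mul_self_eq_one_of_permMap_eq_smul hv0 ha
    have ha0 : a ≠ 0 := by
      rintro rfl
      simp at ha1
    have hσ : σ • l = l := by
      have h1 := hr.smul_perm σ
      rw [ha] at h1
      exact h1.of_smul.unique hr
    obtain ⟨b, hb⟩ := RP.mfderiv_affineLift_smul hi hσ ha ξ
    have h1 : v ⬝ᵥ permMap σ (orthProj v (D ξ)) = 0 := by
      have h2 := permMap_dotProduct σ v (orthProj v (D ξ))
      rw [dotProduct_orthProj hv0, ha, smul_dotProduct, smul_eq_mul] at h2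
      exact (mul_eq_zero.1 h2).resolve_left ha0
    have h2 : D (tangentAct l σ ξ) = a⁻¹ • permMap σ (D ξ) + b • v := hb
    -- since `σ` preserves both the line and its orthogonal complement, it commutes with the
    -- projection
    have h3 : D ξ = orthProj v (D ξ) + ((v ⬝ᵥ D ξ) / (v ⬝ᵥ v)) • v := by
      rw [orthProj_apply, sub_add_cancel]
    have h4 : orthProj v (permMap σ (D ξ)) = permMap σ (orthProj v (D ξ)) := by
      conv_lhs => rw [h3, map_add, map_smul, ha, smul_smul, map_add, orthProj_smul_self hv0,
        add_zero, orthProj_eq_self h1]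
    rw [LinearMap.comp_apply, LinearMap.comp_apply, h2, map_add, orthProj_smul_self hv0, add_zero,
      map_smul, h4, smul_smul, mul_inv_cancel₀ ha0, one_smul]

end TangentAction

/-! ### The strata of the `ℒ`-stratification -/

section Strata

variable {m : ℕ}

/-- The subspace of vectors fixed by the squares of the elements of `H`. -/
noncomputable def squareFixed (H : Subgroup (Equiv.Perm (Fin (m + 1)))) :
    Submodule ℝ (Fin (m + 1) → ℝ) :=
  sInf {W | ∃ g ∈ H, ∃ k, g (g k) ≠ k ∧ W = braidHyperplane (g (g k)) k}

variable {H : Subgroup (Equiv.Perm (Fin (m + 1)))}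

lemma squareFixed_mem_intersectionLattice (H : Subgroup (Equiv.Perm (Fin (m + 1)))) :
    squareFixed H ∈ intersectionLattice (braidArrangement m) := by
  refine ⟨_, ?_, rfl⟩
  rintro _ ⟨g, -, k, hne, rfl⟩
  exact ⟨_, _, hne, rfl⟩

lemma mem_squareFixed {x : Fin (m + 1) → ℝ} :
    x ∈ squareFixed H ↔ ∀ g ∈ H, ∀ k, x (g (g k)) = x k := by
  rw [squareFixed, Submodule.mem_sInf]
  constructor
  · intro h g hg k
    by_cases hk : g (g k) = k
    · rw [hk]
    · exact mem_braidHyperplane.1 (h _ ⟨g, hg, k, hk, rfl⟩)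
  · rintro h _ ⟨g, hg, k, -, rfl⟩
    exact mem_braidHyperplane.2 (h g hg k)

lemma mem_squareFixed_iff_permMap {x : Fin (m + 1) → ℝ} :
    x ∈ squareFixed H ↔ ∀ g ∈ H, permMap g (permMap g x) = x := by
  rw [mem_squareFixed]
  constructor
  · exact fun h g hg => funext fun k => h g⁻¹ (H.inv_mem hg) k
  · intro h g hg k
    have h1 := congrFun (h g⁻¹ (H.inv_mem hg)) k
    change x (g⁻¹⁻¹ (g⁻¹⁻¹ k)) = x k at h1
    rwa [inv_inv] at h1

lemma permMap_mem_squareFixed {x : Fin (m + 1) → ℝ} (hx : x ∈ squareFixed H)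
    {k : Equiv.Perm (Fin (m + 1))} (hk : k ∈ H) : permMap k x ∈ squareFixed H := by
  rw [mem_squareFixed_iff_permMap] at hx ⊢
  intro g hg
  have h1 := hx (k⁻¹ * g * k) (H.mul_mem (H.mul_mem (H.inv_mem hk) hg) hk)
  have h2 : permMap g (permMap g (permMap k x)) =
      permMap k (permMap (k⁻¹ * g * k) (permMap (k⁻¹ * g * k) x)) := by
    simp only [← permMap_mul]
    congr 2
    group
  rw [h2, h1]

/-- The elements of `H` commute on the space fixed by all squares. -/
lemma permMap_comm_of_mem_squareFixed {x : Fin (m + 1) → ℝ} (hx : x ∈ squareFixed H)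
    {g k : Equiv.Perm (Fin (m + 1))} (hg : g ∈ H) (hk : k ∈ H) :
    permMap g (permMap k x) = permMap k (permMap g x) := by
  have hsq : ∀ y ∈ squareFixed H, ∀ g ∈ H, permMap g (permMap g y) = y := fun y hy =>
    mem_squareFixed_iff_permMap.1 hy
  have h1 : permMap g (permMap k (permMap g (permMap k x))) = x := hsq x hx _ (H.mul_mem hg hk)
  have h2 := permMap_mem_squareFixed (permMap_mem_squareFixed hx hk) hg
  rw [← hsq _ h2 k hk, ← hsq _ (permMap_mem_squareFixed h2 hk) g hg, h1]

/-- The space fixed by all squares is spanned by simultaneous eigenvectors of `H`. -/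
lemma squareFixed_le_span (H : Subgroup (Equiv.Perm (Fin (m + 1)))) :
    squareFixed H ≤ Submodule.span ℝ {x | ∀ g ∈ H, permMap g x = x ∨ permMap g x = -x} := by
  classical
  -- diagonalize one element after the other: `y = (y + k y) / 2 + (y - k y) / 2`, and the summands
  -- remain eigenvectors of the previous elements since these commute with `k`
  have key : ∀ S : Finset (Equiv.Perm (Fin (m + 1))), (∀ g ∈ S, g ∈ H) → squareFixed H ≤
      Submodule.span ℝ {x | x ∈ squareFixed H ∧ ∀ g ∈ S, permMap g x = x ∨ permMap g x = -x} := by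
    intro S
    induction S using Finset.induction_on with
    | empty => exact fun _ x hx => Submodule.subset_span ⟨hx, by simp⟩
    | insert k S _ ih =>
      intro hS
      refine (ih fun g hg => hS g (Finset.mem_insert_of_mem hg)).trans (Submodule.span_le.2 ?_)
      rintro y ⟨hy, hyS⟩
      have hk : k ∈ H := hS k (Finset.mem_insert_self _ _)
      have hky := permMap_mem_squareFixed hy hk
      have hkk : permMap k (permMap k y) = y := mem_squareFixed_iff_permMap.1 hy k hk
      have hkg : ∀ g ∈ S, permMap g y = y ∧ permMap g (permMap k y) = permMap k y ∨
          permMap g y = -y ∧ permMap g (permMap k y) = -permMap k y := by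
        intro g hg
        rw [permMap_comm_of_mem_squareFixed hy (hS g (Finset.mem_insert_of_mem hg)) hk]
        rcases hyS g hg with h | h
        · exact Or.inl ⟨h, by rw [h]⟩
        · exact Or.inr ⟨h, by rw [h, map_neg]⟩
      have h1 : y + permMap k y ∈ Submodule.span ℝ {x | x ∈ squareFixed H ∧
          ∀ g ∈ insert k S, permMap g x = x ∨ permMap g x = -x} := by
        refine Submodule.subset_span ⟨add_mem hy hky, fun g hg => ?_⟩
        rcases Finset.mem_insert.1 hg with rfl | hg
        · left; rw [map_add, hkk]; exact add_comm _ _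
        · rcases hkg g hg with ⟨h, h'⟩ | ⟨h, h'⟩
          · left; rw [map_add, h, h']
          · right; rw [map_add, h, h']; abel
      have h2 : y - permMap k y ∈ Submodule.span ℝ {x | x ∈ squareFixed H ∧
          ∀ g ∈ insert k S, permMap g x = x ∨ permMap g x = -x} := by
        refine Submodule.subset_span ⟨sub_mem hy hky, fun g hg => ?_⟩
        rcases Finset.mem_insert.1 hg with rfl | hg
        · right; rw [map_sub, hkk]; abel
        · rcases hkg g hg with ⟨h, h'⟩ | ⟨h, h'⟩
          · left; rw [map_sub, h, h']
          · right; rw [map_sub, h, h']; abel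
      have h3 : y = (1 / 2 : ℝ) • (y + permMap k y) + (1 / 2 : ℝ) • (y - permMap k y) := by
        rw [← smul_add, add_add_sub_cancel, ← two_smul ℝ, smul_smul]
        norm_num
      rw [SetLike.mem_coe, h3]
      exact add_mem (Submodule.smul_mem _ _ h1) (Submodule.smul_mem _ _ h2)
  refine (key (Finset.univ.filter (· ∈ H)) (by simp)).trans (Submodule.span_mono ?_)
  rintro x ⟨-, hx⟩ g hg
  exact hx g (by simpa using hg)

lemma exists_permMap_eq_smul {l : RP m} {x : Fin (m + 1) → ℝ} (hx : Represents x l)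
    {g : Equiv.Perm (Fin (m + 1))} (hg : g • l = l) :
    ∃ a : ℝ, a * a = 1 ∧ permMap g x = a • x := by
  have h1 := hx.smul_perm g
  rw [hg] at h1
  obtain ⟨a, -, ha⟩ := h1.exists_smul hx
  exact ⟨a, mul_self_eq_one_of_permMap_eq_smul hx.1 ha, ha⟩

lemma Represents.smul_eq_self {l : RP m} {x : Fin (m + 1) → ℝ} (hx : Represents x l)
    {g : Equiv.Perm (Fin (m + 1))} {a : ℝ} (h : permMap g x = a • x) : g • l = l := by
  have h1 := hx.smul_perm g
  rw [h] at h1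
  exact h1.of_smul.unique hx

lemma mem_squareFixed_of_represents {l : RP m} (hH : H ≤ MulAction.stabilizer _ l)
    {x : Fin (m + 1) → ℝ} (hx : Represents x l) : x ∈ squareFixed H := by
  rw [mem_squareFixed_iff_permMap]
  intro g hg
  obtain ⟨a, ha, h⟩ := exists_permMap_eq_smul hx (hH hg)
  rw [h, map_smul, h, smul_smul, ha, one_smul]

/-- The elements of `F(l, H)` are those that act on the space fixed by all squares of elements
of `H` in the same way as on the line `l`. -/
theorem mem_kernelF_iff {l : RP m} (hH : H ≤ MulAction.stabilizer _ l)
    {h : Equiv.Perm (Fin (m + 1))} : h ∈ kernelF m l H ↔ h ∈ H ∧ ∃ (v : Fin (m + 1) → ℝ) (a : ℝ),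
      Represents v l ∧
      permMap h v = a • v ∧ ∀ x ∈ squareFixed H, permMap h x = a • x := by
  obtain ⟨v, hv, E, hinj, hrange, hE⟩ := exists_tangentSpace_equiv l
  have hvE : ∀ ξ, v ⬝ᵥ E ξ = 0 := fun ξ => (hrange _).2 ⟨ξ, rfl⟩
  refine and_congr_right fun hhH => ?_
  obtain ⟨a, haa, ha⟩ := exists_permMap_eq_smul hv (hH hhH)
  have ha0 : a ≠ 0 := by
    rintro rfl
    simp at haa
  constructor
  · intro hfix
    refine ⟨v, a, hv, ha, fun x hx => ?_⟩
    suffices hle : Submodule.span ℝ {x | ∀ g ∈ H, permMap g x = x ∨ permMap g x = -x} ≤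
        LinearMap.ker (permMap h - a • LinearMap.id) by
      exact sub_eq_zero.1 (LinearMap.mem_ker.1 (hle (squareFixed_le_span H hx)))
    rw [Submodule.span_le]
    intro x hx
    rw [SetLike.mem_coe, LinearMap.mem_ker, LinearMap.sub_apply, sub_eq_zero]
    change permMap h x = a • x
    -- the component of an eigenvector orthogonal to the line is an eigenvector as well
    obtain ⟨ξ, hξ⟩ := (hrange _).1 (dotProduct_orthProj hv.1 x)
    have hx' : x = E ξ + ((v ⬝ᵥ x) / (v ⬝ᵥ v)) • v := by
      rw [hξ, orthProj_apply, sub_add_cancel]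
    have heig : ∀ g ∈ H, ∃ b : ℝ, tangentAct l g ξ = b • ξ := by
      intro g hg
      obtain ⟨c, hcc, hc⟩ := exists_permMap_eq_smul hv (hH hg)
      have hgx : ∃ e : ℝ, permMap g x = e • x := by
        rcases hx g hg with h | h
        · exact ⟨1, by rw [h, one_smul]⟩
        · exact ⟨-1, by rw [h, neg_smul, one_smul]⟩
      obtain ⟨e, he⟩ := hgx
      have h1 : orthProj v (permMap g x) = e • E ξ := by rw [he, map_smul, hξ]
      have h2 : orthProj v (permMap g x) = c • E (tangentAct l g ξ) := by
        conv_lhs => rw [hx', map_add, map_smul, hc, smul_smul, map_add, orthProj_smul_self hv.1,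
          add_zero, hE g c hc, map_smul, orthProj_eq_self (hvE _)]
      refine ⟨c * e, hinj ?_⟩
      rw [map_smul, mul_smul, ← h1, h2, smul_smul, hcc, one_smul]
    -- so `ξ` spans an invariant line of the tangent space, which `h` fixes pointwise
    have hfixξ : tangentAct l h ξ = ξ := by
      by_cases hξ0 : ξ = 0
      · rw [hξ0, map_zero]
      refine hfix ξ ?_
      have hmem : Submodule.span ℝ {ξ} ∈ {L : Submodule ℝ (TangentSpace (𝓡 m) l) |
          Module.finrank ℝ L = 1 ∧ ∀ h ∈ H, L.map (tangentAct l h) = L} := by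
        refine ⟨finrank_span_singleton hξ0, fun g hg => ?_⟩
        obtain ⟨b, hb⟩ := heig g hg
        rw [Submodule.map_span, image_singleton, hb]
        refine Submodule.span_singleton_smul_eq (IsUnit.mk0 b ?_) _
        rintro rfl
        rw [zero_smul] at hb
        obtain ⟨c, -, hc⟩ := exists_permMap_eq_smul hv (hH hg)
        have h1 := hE g c hc ξ
        rw [hb, map_zero, smul_zero] at h1
        exact hξ0 (hinj ((permMap_injective g (h1.trans (map_zero _).symm)).trans
          (map_zero E).symm))
      exact (le_sSup hmem : Submodule.span ℝ {ξ} ≤ tangentL m l H)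
        (Submodule.mem_span_singleton_self ξ)
    rw [hx', map_add, map_smul, ha, hE h a ha, hfixξ, smul_add, smul_comm a]
  · rintro ⟨v', a', hv', ha', hsq⟩
    have haa' : a' = a := by
      obtain ⟨c, hc0, hc⟩ := hv.exists_smul hv'
      have h1 : permMap h v = a' • v := by rw [hc, map_smul, ha', smul_comm]
      exact smul_left_injective ℝ hv.1 (h1.symm.trans ha)
    rw [haa'] at hsq
    suffices hle : tangentL m l H ≤ LinearMap.ker (tangentAct l h - LinearMap.id) by
      exact fun ξ hξ => sub_eq_zero.1 (LinearMap.mem_ker.1 (hle hξ))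
    refine sSup_le ?_
    rintro L ⟨hL1, hLH⟩ ξ hξ
    rw [LinearMap.mem_ker, LinearMap.sub_apply, sub_eq_zero]
    change tangentAct l h ξ = ξ
    -- a vector on an invariant line is an eigenvector; eigenvalues of permutations are `±1`, so
    -- squares fix it
    have hmem : E ξ ∈ squareFixed H := by
      rw [mem_squareFixed_iff_permMap]
      intro g hg
      by_cases hξ0 : ξ = 0
      · rw [hξ0, map_zero, map_zero, map_zero]
      obtain ⟨c, -, hc⟩ := exists_permMap_eq_smul hv (hH hg)
      have hmap : tangentAct l g ξ ∈ L := by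
        rw [← hLH g hg]
        exact Submodule.mem_map_of_mem hξ
      obtain ⟨b, hb⟩ := (finrank_eq_one_iff_of_nonzero' (⟨ξ, hξ⟩ : L)
        (fun h0 => hξ0 (congrArg Subtype.val h0))).1 hL1 ⟨_, hmap⟩
      have hb' : tangentAct l g ξ = b • ξ := (congrArg Subtype.val hb).symm
      have h1 : permMap g (E ξ) = (c * b) • E ξ := by
        rw [hE g c hc, hb', map_smul, smul_smul]
      have h2 := mul_self_eq_one_of_permMap_eq_smul
        (fun h0 => hξ0 (hinj (h0.trans (map_zero E).symm))) h1
      rw [h1, map_smul, h1, smul_smul, h2, one_smul]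
    have h1 := hsq _ hmem
    rw [hE h a ha] at h1
    exact hinj (smul_right_injective _ ha0 h1)

lemma isClosed_projSet (U : Submodule ℝ (Fin (m + 1) → ℝ)) : IsClosed (projSet U) := by
  rw [← RP.isQuotientMap_mk'.isClosed_preimage]
  have h1 : (Projectivization.mk' ℝ (V := Fin (m + 1) → ℝ)) ⁻¹' projSet U =
      Subtype.val ⁻¹' (U : Set (Fin (m + 1) → ℝ)) := by
    ext v
    exact mem_projSet_mk v.2
  rw [h1]
  exact (Submodule.closed_of_finiteDimensional U).preimage continuous_subtype_val

lemma isPreconnected_projSet (U : Submodule ℝ (Fin (m + 1) → ℝ)) : IsPreconnected (projSet U) := by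
  refine isPreconnected_of_forall_pair fun l hl l' hl' => ?_
  by_cases hne : l = l'
  · exact ⟨{l}, by simpa using hl, rfl, by simp [hne], isPreconnected_singleton⟩
  have hr := Represents.rep l
  have hr' := Represents.rep l'
  set x := l.rep
  set x' := l'.rep
  -- two different lines in `U` are joined by the lines spanned by the points of a segment in `U`
  let γ : ℝ → Fin (m + 1) → ℝ := fun t => (1 - t) • x + t • x'
  have hγ0 : ∀ t, γ t ≠ 0 := by
    intro t h0
    by_cases ht : t = 0
    · refine hr.1 ?_
      simpa [γ, ht] using h0
    · refine hne (hr.unique (Represents.of_smul (a := -(t⁻¹ * (1 - t))) ?_))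
      have h1 : -(t⁻¹ * (1 - t)) • x = x' := by
        rw [neg_smul, mul_smul, eq_neg_of_add_eq_zero_left h0, smul_neg, neg_neg, smul_smul,
          inv_mul_cancel₀ ht, one_smul]
      rw [h1]
      exact hr'
  have hγc : Continuous γ := by fun_prop
  have hγU : ∀ t, γ t ∈ U := fun t => U.add_mem (U.smul_mem _ ((hr.mem_projSet_iff U).1 hl))
    (U.smul_mem _ ((hr'.mem_projSet_iff U).1 hl'))
  refine ⟨range fun t => Projectivization.mk ℝ (γ t) (hγ0 t), ?_, ⟨0, ?_⟩, ⟨1, ?_⟩,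
    isPreconnected_range (RP.continuous_mk hγc hγ0)⟩
  · rintro _ ⟨t, rfl⟩
    exact (mem_projSet_mk (hγ0 t)).2 (hγU t)
  · refine Represents.unique ⟨_, rfl⟩ (?_ : Represents (γ 0) l)
    simpa [γ] using hr
  · refine Represents.unique ⟨_, rfl⟩ (?_ : Represents (γ 1) l')
    simpa [γ] using hr'

/-- The components of the fixed point sets are projective spaces: where a permutation has the
eigenvalue 1 and where it has the eigenvalue -1 are disjoint closed sets. -/
theorem stratumL_eq {l : RP m} (hH : H ≤ MulAction.stabilizer _ l) :
    stratumL m l H = projSet (squareFixed H) := by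
  have hr := Represents.rep l
  have hlsq := mem_squareFixed_of_represents hH hr
  have hl : l ∈ projSet (squareFixed H) := (hr.mem_projSet_iff _).2 hlsq
  have hsub : projSet (squareFixed H) ⊆ {y : RP m | ∀ g ∈ kernelF m l H, g • y = y} := by
    intro y hy g hg
    obtain ⟨-, v, a, -, -, hsq⟩ := (mem_kernelF_iff hH).1 hg
    have hry := Represents.rep y
    exact hry.smul_eq_self (hsq _ ((hry.mem_projSet_iff _).1 hy))
  refine Subset.antisymm (fun y hy => ?_)
    ((isPreconnected_projSet _).subset_connectedComponentIn hl hsub)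
  have hry := Represents.rep y
  rw [hry.mem_projSet_iff, mem_squareFixed_iff_permMap]
  intro g hg
  have hgl : permMap (g * g) l.rep = l.rep := mem_squareFixed_iff_permMap.1 hlsq g hg
  -- it suffices that the squares of elements of `H` lie in `F(l, H)` and have the eigenvalue 1 on
  -- `y`
  have hgF : g * g ∈ kernelF m l H := by
    refine (mem_kernelF_iff hH).2 ⟨H.mul_mem hg hg, l.rep, 1, hr, ?_, fun x hx => ?_⟩
    · rw [one_smul, hgl]
    · rw [one_smul]
      exact mem_squareFixed_iff_permMap.1 hx g hg
  have hplus : ∀ {z : RP m}, z ∈ projSet (LinearMap.ker (permMap (g * g) - LinearMap.id)) ↔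
      permMap (g * g) z.rep = z.rep := fun {z} => by
    rw [(Represents.rep z).mem_projSet_iff, LinearMap.mem_ker, LinearMap.sub_apply, sub_eq_zero]
    rfl
  have hminus : ∀ {z : RP m}, z ∈ projSet (LinearMap.ker (permMap (g * g) + LinearMap.id)) ↔
      permMap (g * g) z.rep = -z.rep := fun {z} => by
    rw [(Represents.rep z).mem_projSet_iff, LinearMap.mem_ker, LinearMap.add_apply,
      ← eq_neg_iff_add_eq_zero]
    rfl
  have hcover : stratumL m l H ⊆ projSet (LinearMap.ker (permMap (g * g) - LinearMap.id)) ∪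
      projSet (LinearMap.ker (permMap (g * g) + LinearMap.id)) := by
    intro z hz
    have hfix := connectedComponentIn_subset _ _ hz (g * g) hgF
    obtain ⟨a, haa, ha⟩ := exists_permMap_eq_smul (Represents.rep z) hfix
    rcases mul_self_eq_one_iff.1 haa with rfl | rfl
    · left; rw [hplus, ha, one_smul]
    · right; rw [hminus, ha, neg_smul, one_smul]
  rcases hcover hy with h | h
  · exact hplus.1 h
  · obtain ⟨z, -, hz1, hz2⟩ := isPreconnected_closed_iff.1 isPreconnected_connectedComponentIn _ _
      (isClosed_projSet _) (isClosed_projSet _) hcover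
      ⟨l, mem_connectedComponentIn (hsub hl), hplus.2 hgl⟩ ⟨y, hy, h⟩
    have h1 := (hplus.1 hz1).symm.trans (hminus.1 hz2)
    exact absurd (self_eq_neg.1 h1) z.rep_nonzero

/-- A square is an even permutation, hence not a transposition. -/
lemma two_le_finrank_of_squareFixed_ne_top (h : squareFixed H ≠ ⊤) :
    2 ≤ Module.finrank ℝ ((Fin (m + 1) → ℝ) ⧸ squareFixed H) := by
  by_contra hlt
  obtain ⟨_, ⟨a, b, hab, rfl⟩, hle⟩ :=
    le_of_mem_intersectionLattice (squareFixed_mem_intersectionLattice H) h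
  -- a space of codimension 1 in the lattice is one of the hyperplanes
  have hmem : ∀ x ∈ braidHyperplane a b, x ∈ squareFixed H := by
    intro x hx
    by_contra hxn
    have h1 := sup_span_eq_top_of_finrank_quotient_lt_two (not_le.1 hlt) hxn
    have h2 : squareFixed H ⊔ Submodule.span ℝ {x} ≤ braidHyperplane a b :=
      sup_le hle (by rwa [Submodule.span_singleton_le_iff_mem])
    rw [h1, top_le_iff] at h2
    have h3 : (Pi.single a 1 : Fin (m + 1) → ℝ) ∈ braidHyperplane a b := h2 ▸ Submodule.mem_top
    rw [mem_braidHyperplane] at h3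
    simp [hab.symm] at h3
  -- `x` lies in the hyperplane, and its coordinates at `a` and `b` are the only ones that coincide;
  -- a square of an element of `H` fixes `x`, so it is the identity or the transposition of `a` and
  -- `b`
  let x : Fin (m + 1) → ℝ := fun k => if k = a then (b : ℕ) else (k : ℕ)
  have hx : x ∈ squareFixed H := hmem x (mem_braidHyperplane.2 (by simp [x]))
  rw [mem_squareFixed] at hx
  have hval : ∀ k k', x k = x k' → k = k' ∨ (k = a ∧ k' = b) ∨ (k = b ∧ k' = a) := by
    intro k k' hkk
    simp only [x] at hkk
    split_ifs at hkk with h1 h2 h2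
    · exact Or.inl (h1.trans h2.symm)
    · exact Or.inr (Or.inl ⟨h1, (Fin.ext (by exact_mod_cast hkk)).symm⟩)
    · exact Or.inr (Or.inr ⟨Fin.ext (by exact_mod_cast hkk), h2⟩)
    · exact Or.inl (Fin.ext (by exact_mod_cast hkk))
  apply h
  rw [eq_top_iff]
  intro y _
  rw [mem_squareFixed]
  intro g hg
  have hcases : ∀ k, (g * g) k = k ∨ ((g * g) k = a ∧ k = b) ∨ ((g * g) k = b ∧ k = a) :=
    fun k => hval _ _ (hx g hg k)
  have hswap : g * g ≠ Equiv.swap a b := by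
    intro he
    have h1 := congrArg Equiv.Perm.sign he
    rw [map_mul, Int.units_mul_self, Equiv.Perm.sign_swap hab] at h1
    exact absurd h1 (by decide)
  have hga : (g * g) a = a := by
    by_contra hne
    have h1 : (g * g) a = b := by
      rcases hcases a with h | ⟨-, h⟩ | ⟨h, -⟩
      · exact absurd h hne
      · exact absurd h hab
      · exact h
    refine hswap (Equiv.ext fun k => ?_)
    rcases hcases k with h | ⟨h, rfl⟩ | ⟨h, rfl⟩
    · have hka : k ≠ a := fun hk => hne (hk ▸ h)
      have hkb : k ≠ b := fun hk => hka ((g * g).injective (h.trans (hk.trans h1.symm)))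
      rw [h, Equiv.swap_apply_of_ne_of_ne hka hkb]
    · rw [h, Equiv.swap_apply_right]
    · rw [h, Equiv.swap_apply_left]
  intro k
  change y ((g * g) k) = y k
  rcases hcases k with h | ⟨h, -⟩ | ⟨-, h⟩
  · rw [h]
  · rw [(g * g).injective (h.trans hga.symm), hga]
  · rw [h, hga]

/-- Every permutation gives a member of the family `ℒ`, by means of the line of constant vectors. -/
lemma projSet_squareFixed_zpowers_mem (g : Equiv.Perm (Fin (m + 1))) :
    projSet (squareFixed (Subgroup.zpowers g)) ∈
      familyL m (Equiv.Perm (Fin (m + 1))) (RP m) := by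
  have h0 : (fun _ => 1 : Fin (m + 1) → ℝ) ≠ 0 := fun h => one_ne_zero (congrFun h 0)
  have hr : Represents (fun _ => 1 : Fin (m + 1) → ℝ) (Projectivization.mk ℝ _ h0) := ⟨h0, rfl⟩
  have hH : Subgroup.zpowers g ≤ MulAction.stabilizer (Equiv.Perm (Fin (m + 1)))
      (Projectivization.mk ℝ _ h0 : RP m) := fun σ _ =>
    hr.smul_eq_self (a := 1) (by rw [one_smul]; rfl)
  exact ⟨_, _, hH, (stratumL_eq hH).symm⟩

lemma mem_squareFixed_zpowers {g : Equiv.Perm (Fin (m + 1))} {x : Fin (m + 1) → ℝ} :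
    x ∈ squareFixed (Subgroup.zpowers g) ↔ ∀ k, x (g (g k)) = x k := by
  rw [mem_squareFixed]
  refine ⟨fun h => h g (Subgroup.mem_zpowers g), fun h σ hσ => ?_⟩
  let K : Subgroup (Equiv.Perm (Fin (m + 1))) :=
    { carrier := {τ | ∀ k, x (τ k) = x k}
      one_mem' := fun k => rfl
      mul_mem' := fun {σ τ} hσ hτ k => (hσ (τ k)).trans (hτ k)
      inv_mem' := fun {σ} hσ k => by
        have := hσ (σ⁻¹ k)
        have h1 : σ (σ⁻¹ k) = k := σ.apply_symm_apply k
        rw [h1] at this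
        exact this.symm }
  obtain ⟨n, rfl⟩ := hσ
  have hg : g * g ∈ K := h
  have h1 : g ^ n * g ^ n ∈ K := by
    rw [← ((Commute.refl g).mul_zpow n)]
    exact K.zpow_mem hg n
  exact h1

lemma apply_swap_eq_of_eq {x : Fin (m + 1) → ℝ} {a b : Fin (m + 1)} (h : x a = x b)
    (k : Fin (m + 1)) : x (Equiv.swap a b k) = x k := by
  rw [Equiv.swap_apply_def]
  split_ifs with h1 h2
  · rw [h1, h]
  · rw [h2, h]
  · rfl

/-- The square of a 3-cycle is a 3-cycle. -/
lemma mem_squareFixed_three_cycle {a b c : Fin (m + 1)} (hab : a ≠ b) (hbc : b ≠ c) (hac : a ≠ c)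
    {x : Fin (m + 1) → ℝ} :
    x ∈ squareFixed (Subgroup.zpowers (Equiv.swap a b * Equiv.swap b c)) ↔
      x a = x b ∧ x b = x c := by
  rw [mem_squareFixed_zpowers]
  constructor
  · intro h
    have ha : (Equiv.swap a b * Equiv.swap b c) a = b := by
      simp [Equiv.swap_apply_of_ne_of_ne hab hac]
    have hb : (Equiv.swap a b * Equiv.swap b c) b = c := by
      simp [Equiv.swap_apply_of_ne_of_ne hac.symm hbc.symm]
    have hc : (Equiv.swap a b * Equiv.swap b c) c = a := by simp
    have h1 := h a
    have h2 := h b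
    rw [ha, hb] at h1
    rw [hb, hc] at h2
    exact ⟨h2, h2.symm.trans h1.symm⟩
  · rintro ⟨h1, h2⟩ k
    simp only [Equiv.Perm.mul_apply]
    rw [apply_swap_eq_of_eq h1, apply_swap_eq_of_eq h2, apply_swap_eq_of_eq h1,
      apply_swap_eq_of_eq h2]

/-- The square of a 4-cycle is the product of two disjoint transpositions. -/
lemma mem_squareFixed_four_cycle {i j k l : Fin (m + 1)} (hij : i ≠ j) (hik : i ≠ k) (hil : i ≠ l)
    (hjk : j ≠ k) (hjl : j ≠ l) (hkl : k ≠ l) {x : Fin (m + 1) → ℝ} :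
    x ∈ squareFixed (Subgroup.zpowers (Equiv.swap i k * Equiv.swap j l * Equiv.swap i j)) ↔
      x i = x j ∧ x k = x l := by
  set g := Equiv.swap i k * Equiv.swap j l * Equiv.swap i j with hg
  have hi : g i = l := by
    simp [hg, Equiv.swap_apply_of_ne_of_ne hil.symm hkl.symm]
  have hl : g l = j := by
    simp [hg, Equiv.swap_apply_of_ne_of_ne hil.symm hjl.symm,
      Equiv.swap_apply_of_ne_of_ne hij.symm hjk]
  have hj : g j = k := by
    simp [hg, Equiv.swap_apply_of_ne_of_ne hij hil]
  have hk : g k = i := by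
    simp [hg, Equiv.swap_apply_of_ne_of_ne hik.symm hjk.symm,
      Equiv.swap_apply_of_ne_of_ne hjk.symm hkl]
  rw [mem_squareFixed_zpowers]
  constructor
  · intro h
    have h1 := h i
    have h2 := h l
    rw [hi, hl] at h1
    rw [hl, hj] at h2
    exact ⟨h1.symm, h2⟩
  · rintro ⟨h1, h2⟩ p
    by_cases hpi : p = i
    · rw [hpi, hi, hl, h1]
    by_cases hpj : p = j
    · rw [hpj, hj, hk, h1]
    by_cases hpk : p = k
    · rw [hpk, hk, hi, h2]
    by_cases hpl : p = l
    · rw [hpl, hl, hj, h2]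
    have hp : g p = p := by
      simp [hg, Equiv.swap_apply_of_ne_of_ne hpi hpj, Equiv.swap_apply_of_ne_of_ne hpj hpl,
        Equiv.swap_apply_of_ne_of_ne hpi hpk]
    rw [hp, hp]

lemma braidHyperplane_comm (i j : Fin (m + 1)) : braidHyperplane i j = braidHyperplane j i := by
  ext x
  rw [mem_braidHyperplane, mem_braidHyperplane]
  exact eq_comm

/-- Two different hyperplanes of the arrangement meet in the fixed space of the square of a 3-cycle
or of a 4-cycle. -/
lemma exists_perm_of_pairs {i j k l : Fin (m + 1)} (hij : i ≠ j) (hkl : k ≠ l)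
    (hne : braidHyperplane i j ≠ braidHyperplane k l) : ∃ g : Equiv.Perm (Fin (m + 1)),
      squareFixed (Subgroup.zpowers g) = braidHyperplane i j ⊓ braidHyperplane k l := by
  have key : ∀ {a b c : Fin (m + 1)}, a ≠ b → b ≠ c →
      braidHyperplane a b ≠ braidHyperplane b c → ∃ g : Equiv.Perm (Fin (m + 1)),
        squareFixed (Subgroup.zpowers g) = braidHyperplane a b ⊓ braidHyperplane b c := by
    intro a b c hab hbc hne
    have hac : a ≠ c := by
      rintro rfl
      exact hne (braidHyperplane_comm _ _)
    refine ⟨_, Submodule.ext fun x => (mem_squareFixed_three_cycle hab hbc hac).trans ?_⟩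
    rw [Submodule.mem_inf, mem_braidHyperplane, mem_braidHyperplane]
  by_cases hik : i = k
  · subst hik
    rw [braidHyperplane_comm i j] at hne ⊢
    exact key hij.symm hkl hne
  by_cases hil : i = l
  · subst hil
    rw [braidHyperplane_comm i j, braidHyperplane_comm k i] at hne ⊢
    exact key hij.symm hkl.symm hne
  by_cases hjk : j = k
  · subst hjk
    exact key hij hkl hne
  by_cases hjl : j = l
  · subst hjl
    rw [braidHyperplane_comm k j] at hne ⊢
    exact key hij hkl.symm hne
  refine ⟨_, Submodule.ext fun x =>
    (mem_squareFixed_four_cycle hij hik hil hjk hjl hkl).trans ?_⟩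
  rw [Submodule.mem_inf, mem_braidHyperplane, mem_braidHyperplane]

/-- An element of the lattice of codimension at least 2 is the intersection of the pairwise
intersections of the hyperplanes that contain it. -/
theorem exists_familyL_of_notMem {U : Submodule ℝ (Fin (m + 1) → ℝ)}
    (hU : U ∈ intersectionLattice (braidArrangement m))
    (hc : 2 ≤ Module.finrank ℝ ((Fin (m + 1) → ℝ) ⧸ U)) {y : RP m} (hy : y ∉ projSet U) :
    ∃ T ∈ familyL m (Equiv.Perm (Fin (m + 1))) (RP m), projSet U ⊆ T ∧ y ∉ T := by
  obtain ⟨ℬ, hB, rfl⟩ := hU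
  have hr := Represents.rep y
  rw [hr.mem_projSet_iff, Submodule.mem_sInf] at hy
  push Not at hy
  obtain ⟨W, hW, hyW⟩ := hy
  -- `U` is not the hyperplane `W` since its codimension is at least 2, so a second one contains it
  obtain ⟨W', hW', hne⟩ : ∃ W' ∈ ℬ, W' ≠ W := by
    by_contra! hall
    have hWe : sInf ℬ = W := le_antisymm (sInf_le hW) (le_sInf fun W' h => (hall W' h).ge)
    obtain ⟨i, j, hij, rfl⟩ := hB hW
    rw [hWe] at hc
    have h1 : Module.finrank ℝ ((Fin (m + 1) → ℝ) ⧸ braidHyperplane i j) ≤ 1 := by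
      have h2 := ((LinearMap.proj j : (Fin (m + 1) → ℝ) →ₗ[ℝ] ℝ) -
        LinearMap.proj i).quotKerEquivRange.finrank_eq
      have h3 := Submodule.finrank_le (LinearMap.range
        ((LinearMap.proj j : (Fin (m + 1) → ℝ) →ₗ[ℝ] ℝ) - LinearMap.proj i))
      rw [Module.finrank_self] at h3
      exact h2.trans_le h3
    omega
  obtain ⟨i, j, hij, rfl⟩ := hB hW
  obtain ⟨k, l, hkl, rfl⟩ := hB hW'
  obtain ⟨g, hg⟩ := exists_perm_of_pairs hij hkl hne.symm
  refine ⟨_, projSet_squareFixed_zpowers_mem g, ?_, ?_⟩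
  · rw [hg]
    exact projSet_subset_iff.2 (le_inf (sInf_le hW) (sInf_le hW'))
  · rw [hg, hr.mem_projSet_iff]
    exact fun h => hyW h.1

theorem strataOf_familyL : strataOf (familyL m (Equiv.Perm (Fin (m + 1))) (RP m)) =
    strataOf (projBraidTruncation m) := by
  have hfam : ∀ S ∈ familyL m (Equiv.Perm (Fin (m + 1))) (RP m),
      S = univ ∨ S ∈ projBraidTruncation m := by
    rintro _ ⟨l, H, hH, rfl⟩
    rw [stratumL_eq hH]
    by_cases htop : squareFixed H = ⊤
    · left; rw [htop, projSet_top]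
    · exact Or.inr ⟨_, squareFixed_mem_intersectionLattice H,
        two_le_finrank_of_squareFixed_ne_top htop, rfl⟩
  ext S
  constructor
  · rintro ⟨hne, ℬ, hB, rfl⟩
    refine ⟨hne, ℬ ∩ projBraidTruncation m, inter_subset_right, ?_⟩
    refine Subset.antisymm (sInter_subset_sInter inter_subset_left) fun y hy T hT => ?_
    rcases hfam T (hB hT) with rfl | h
    · exact mem_univ _
    · exact hy T ⟨hT, h⟩
  · rintro ⟨hne, ℬ, hB, rfl⟩
    refine ⟨hne, {T | T ∈ familyL m (Equiv.Perm (Fin (m + 1))) (RP m) ∧ ∃ S ∈ ℬ, S ⊆ T},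
      fun T hT => hT.1, ?_⟩
    refine Subset.antisymm ?_ fun y hy S hS => ?_
    · rintro y hy T ⟨-, S, hS, hST⟩
      exact hST (hy S hS)
    · by_contra hyS
      obtain ⟨U, hU, hc, rfl⟩ := hB hS
      obtain ⟨T, hT, hUT, hyT⟩ := exists_familyL_of_notMem hU hc hyS
      exact hyT (hy T ⟨hT, _, hS, hUT⟩)

end Strata

theorem mainTheorem4 (m : ℕ) :
    strataOf (familyL m (Equiv.Perm (Fin (m + 1))) (RP m)) = strataOf (projBraidTruncation m) ∧
    (∃ (Y : SmoothMfd m) (p : Y → RP m), IsMaximalWonderfulModel (RP.mfd m)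
      (familyL m (Equiv.Perm (Fin (m + 1))) (RP m)) Y p) ∧
    ∀ (Y : SmoothMfd m) (p : Y → RP m), IsMaximalWonderfulModel (RP.mfd m)
      (familyL m (Equiv.Perm (Fin (m + 1))) (RP m)) Y p →
      ∃ F : Y → ModelAmbient m,
        (∀ y, (F y).1 = p y) ∧
        Topology.IsClosedEmbedding F ∧
        IsSmoothImmersion Y F ∧
        range F = projectiveModel m ∧
        ∃ _ : MulAction (Equiv.Perm (Fin (m + 1))) Y,
          ∀ σ : Equiv.Perm (Fin (m + 1)),
            ContMDiff (𝓡 m) (𝓡 m) ∞ (fun y : Y => σ • y) ∧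
            (∀ y : Y, p (σ • y) = σ • p y) ∧
            ∀ y : Y, F (σ • y) = ambientAct σ (F y) := by
  refine ⟨strataOf_familyL, ?_, fun Y p hp => ?_⟩
  · obtain ⟨L, hL⟩ := exists_isAdmissibleList m
    obtain ⟨Y, q, hq⟩ := hL.exists_isSuccessiveBlowup
    exact ⟨Y, q, (isMaximalWonderfulModel_iff strataOf_familyL).2 ⟨L, hL, hq⟩⟩
  · obtain ⟨L, hL, hq⟩ := (isMaximalWonderfulModel_iff strataOf_familyL).1 hp
    have hY := (hL.isWonderful hq (List.prefix_refl L)).isModel hL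
    obtain ⟨F, hF1, hF2⟩ := hY.exists_embedding
    exact ⟨F, hF1, hY.isClosedEmbedding hF1 hF2, hY.isSmoothImmersion hF1 hF2,
      hY.range_eq hF1 hF2, hY.exists_mulAction hF1 hF2⟩
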